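/- For an $n\times n$ complex matrix let $\|\cdot\|_1$ be the trace norm (the sum of the singular values), and let $(A,B)=\operatorname{Tr}(A^\dagger B)$. A *tight frame* in dimension $n$ is a measurable family $(w_\alpha)_{\alpha\in S}$ of Hermitian $n\times n$ matrices, indexed by a probability space $(S,\mu)$, with $$\int (w_\alpha,\sigma)\,w_\alpha\,\mathrm d\mu(\alpha)=\frac{\sigma}{n^2}\qquad\text{for every Hermitian }\sigma .$$ For $\alpha_1,\dots,\alpha_m$ drawn independently from $\mu$ let $\mathcal R(\sigma)=\frac{n^2}{m}\sum_{i=1}^m (w_{\alpha_i},\sigma)\,w_{\alpha_i}$. The reconstruction of a state $\rho$ from these $m$ measurements *succeeds* if $\rho$ is the unique solution of $$\min_{\sigma\ \mathrm{Hermitian}}\|\sigma\|_1\quad\text{subject to}\quad \mathcal R(\sigma)=\mathcal R(\rho),$$ and $p_f(\rho)$ denotes the probability, over $\alpha_1,\dots,\alpha_m$, that it does not succeed. A state of dimension $n$ and rank $r$ (positive semidefinite, trace one) is *efficiently* reconstructed by compressed sensing if $p_f(\rho)<1/2$ for a number of measurements $m=O(nr\,\mathrm{polylog}(n))$. **Theorem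 (Incoherence properties of generic states).** Let $A\in\mathbb R$ and $a,d\in\mathbb N$. There are constants $K,C\in\mathbb R$ and $k\in\mathbb N$ and numbers $m=m(n,r)\in\mathbb N$, all depending only on $A,a,d$ (and $m$ also on $n,r$), with $$m(n,r)\le K\,n\,r\,(1+\log n)^k\qquad\text{for all } n\ge 1 \text{ and } r\ge 0,$$ such that the following holds for all $n\ge1$ and all $r$. Let $(w_\alpha)_{\alpha\in S}$ be any tight frame in dimension $n$ with $\|w_\alpha\|_1\le A(1+\log n)^a$ for all $\alpha\in S$, and let $\rho$ be a random state of dimension $n$ and rank $r$ whose distribution is invariant under $\rho\mapsto U\rho U^\dagger$ for every unitary $U$. Then $$\Pr_\rho\Bigl[\,p_f(\rho)<\tfrac12\ \text{ fails for } m=m(n,r) \text{ measurements}\Bigr]\le \frac{C}{n^{d}} .$$ -/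

import Mathlib

open MeasureTheory
open scoped ENNReal ComplexOrder

namespace CompressedSensing

/-- The trace norm (Schatten 1-norm): the sum of the singular values. -/
noncomputable def traceNorm {n : ℕ} (A : Matrix (Fin n) (Fin n) ℂ) : ℝ :=
  ∑ i : Fin n, (Matrix.toEuclideanLin A).singularValues i

/-- The Hilbert-Schmidt scalar product `(A, B) = Tr(A† B)`. -/
noncomputable def hsInner {n : ℕ} (A B : Matrix (Fin n) (Fin n) ℂ) : ℂ :=
  Matrix.trace (A.conjTranspose * B)

/-- A family of observables `w α` in dimension `n`, indexed by a space `S` with a probability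
measure `μ`, is a tight frame: every `w α` is Hermitian, and `E_α [(w_α, σ) w_α] = σ / n²` for
every Hermitian `σ`. The expectation of a matrix is taken entrywise, and it is required to exist. -/
structure IsTightFrame {S : Type*} [MeasurableSpace S] {n : ℕ} (μ : Measure S)
    (w : S → Matrix (Fin n) (Fin n) ℂ) : Prop where
  prob : IsProbabilityMeasure μ
  measurable : ∀ i j, Measurable fun α => w α i j
  hermitian : ∀ α, (w α).IsHermitian
  integrable : ∀ σ : Matrix (Fin n) (Fin n) ℂ, σ.IsHermitian → ∀ i j,
    Integrable (fun α => hsInner (w α) σ * w α i j) μ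
  resolution : ∀ σ : Matrix (Fin n) (Fin n) ℂ, σ.IsHermitian → ∀ i j,
    ∫ α, hsInner (w α) σ * w α i j ∂μ = σ i j / (n : ℂ) ^ 2

/-- The sampling operator `σ ↦ (n² / m) ∑ i, (v i, σ) v i` of the observables `v 1, …, v m`. -/
noncomputable def samplingOp {n m : ℕ} (v : Fin m → Matrix (Fin n) (Fin n) ℂ)
    (σ : Matrix (Fin n) (Fin n) ℂ) : Matrix (Fin n) (Fin n) ℂ :=
  ((n : ℂ) ^ 2 / (m : ℂ)) • ∑ i, hsInner (v i) σ • v i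

/-- The measured data determine `ρ` through trace-norm minimization: `ρ` is the unique solution of
`min ‖σ‖₁` over the Hermitian `σ` with `R(σ) = R(ρ)`, where `R` is the sampling operator. -/
def IsReconstructed {n m : ℕ} (v : Fin m → Matrix (Fin n) (Fin n) ℂ)
    (ρ : Matrix (Fin n) (Fin n) ℂ) : Prop :=
  ∀ σ : Matrix (Fin n) (Fin n) ℂ, σ.IsHermitian → samplingOp v σ = samplingOp v ρ → σ ≠ ρ →
    traceNorm ρ < traceNorm σ

/-- The failure probability `p_f(ρ)`: the probability that `ρ` is not reconstructed from `m`
observables that are drawn independently from the frame. -/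
noncomputable def failureProb {S : Type*} [MeasurableSpace S] {n : ℕ} (μ : Measure S)
    (w : S → Matrix (Fin n) (Fin n) ℂ) (m : ℕ) (ρ : Matrix (Fin n) (Fin n) ℂ) : ℝ≥0∞ :=
  (Measure.pi fun _ : Fin m => μ) {α | ¬ IsReconstructed (fun i => w (α i)) ρ}

/-- A quantum state of dimension `n` and rank `r`. -/
def IsState {n : ℕ} (r : ℕ) (ρ : Matrix (Fin n) (Fin n) ℂ) : Prop :=
  ρ.PosSemidef ∧ ρ.trace = 1 ∧ ρ.rank = r

/-- The Borel σ-algebra on matrices (the product of those of the entries). -/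
noncomputable instance matrixMeasurableSpace {n : ℕ} : MeasurableSpace (Matrix (Fin n) (Fin n) ℂ) :=
  inferInstanceAs (MeasurableSpace (Fin n → Fin n → ℂ))

/-- `Λ` is the law of a random state of dimension `n` and rank `r`, and it is invariant under
conjugation by unitary matrices. -/
structure IsInvariantStateLaw {n : ℕ} (r : ℕ) (Λ : Measure (Matrix (Fin n) (Fin n) ℂ)) :
    Prop where
  prob : IsProbabilityMeasure Λ
  state : ∀ᵐ ρ ∂Λ, IsState r ρ
  invariant : ∀ U ∈ Matrix.unitaryGroup (Fin n) ℂ,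
    Λ.map (fun ρ => U * ρ * U.conjTranspose) = Λ

end CompressedSensing

namespace CompressedSensing

/-! ### A trace inequality and the matrix Khintchine inequality -/

/-! Let `P` be the projection onto the range of `ρ` and `B` the bound on the trace norms of the
frame. By duality (`isReconstructed_of_certificate`), `ρ` is recovered as soon as two things hold.
Some real combination of the measured observables is close to `P` on the tangent space at `P` and
has operator norm at most 1/2 on the complement. And every Hermitian matrix invisible to the
measurements has its tangential part controlled by its complementary part.

Both hold with good probability from about `n r polylog(n)` samples if the frame is incoherent with
`P`: the tangential part of `w α` has squared norm of order `r / n`, and `w α` has overlap of order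
`√r / n` with the trace-corrected projection `golfStart`, up to logarithms. A fixed frame may be
aligned with a particular `ρ`, but not with a generic one. In an eigenbasis of `w α` both quantities
are bounded through sums over the diagonal of the rotated projection, weighted by the eigenvalues,
whose absolute values sum to at most `B`. So it suffices that the diagonal entries lie within about
`√r / n` of `r / n`. Unitary invariance lets such an entry be replaced by the quadratic form of `P`
at a vector of random signs, and its tails follow from a moment recursion (`signAvg_indicator_le`,
`IsInvariantProjLaw.measureReal_diag_le`). Fubini and Markov (`IsInvariantStateLaw.measure_not_le`)
then show that, outside a set of states of probability `C / n ^ d`, incoherence fails only for a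
polynomially small fraction of the frame.

The exceptional observables are cut off (`coef`), at the price of a small bias. The certificate
comes from the golfing scheme: each batch of samples replaces the current residual by the tangential
part of what the batch missed. This halves both its norm and its typical overlap with the frame, so
logarithmically many batches suffice, and the complementary errors add up to a geometric series
(`IsGolfScheme.measureReal_golf_le`). A batch is controlled by a second-moment bound, by Bernstein's
inequality and by matrix concentration. The last of these rests on a matrix Khintchine inequality
proved by flipping one sign at a time. Control on the kernel follows from concentration of a sum of
rank-one matrices (`measureReal_not_tang_le_perp_le`).

The total failure probability is at most `1/3 + 1/8 = 11/24`. If `r ≥ n / 10`, the same number of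
samples is of order `n²` up to logarithms, and the measurements are injective on all Hermitian
matrices with probability at least 7/8. -/

/-- The terms `i` and `N - i` are paired. For nonnegative numbers each pair is at most `a ^ N + b ^
N` by rearrangement, and evenness of `N` makes the absolute values harmless. -/
theorem two_mul_geom_sum_le (a b : ℝ) {N : ℕ} (hN : Even N) :
    2 * ∑ i ∈ Finset.range (N + 1), a ^ i * b ^ (N - i) ≤ (N + 1) * (a ^ N + b ^ N) := by
  have h1 : ∑ i ∈ Finset.range (N + 1), a ^ i * b ^ (N - i)
      = ∑ i ∈ Finset.range (N + 1), a ^ (N - i) * b ^ i := by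
    rw [← Finset.sum_range_reflect]
    refine Finset.sum_congr rfl fun i hi => ?_
    have : i ≤ N := by simpa [Nat.lt_succ_iff] using hi
    simp only [Nat.add_sub_cancel]
    rw [Nat.sub_sub_self this]
  rw [two_mul]
  nth_rewrite 2 [h1]
  rw [← Finset.sum_add_distrib]
  have h2 : ∀ i ∈ Finset.range (N + 1),
      a ^ i * b ^ (N - i) + a ^ (N - i) * b ^ i ≤ a ^ N + b ^ N := by
    intro i hi
    have hi' : i ≤ N := by simpa [Nat.lt_succ_iff] using hi
    obtain ⟨j, rfl⟩ := Nat.exists_eq_add_of_le hi'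
    simp only [Nat.add_sub_cancel_left]
    have hle : a ^ i * b ^ j + a ^ j * b ^ i ≤ |a| ^ i * |b| ^ j + |a| ^ j * |b| ^ i := by
      simp only [← abs_pow, ← abs_mul]
      exact add_le_add (le_abs_self _) (le_abs_self _)
    have hpow : 0 ≤ (|a| ^ i - |b| ^ i) * (|a| ^ j - |b| ^ j) := by
      rcases le_total |a| |b| with h | h
      · exact mul_nonneg_of_nonpos_of_nonpos
          (sub_nonpos.2 (pow_le_pow_left₀ (abs_nonneg _) h _))
          (sub_nonpos.2 (pow_le_pow_left₀ (abs_nonneg _) h _))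
      · exact mul_nonneg (sub_nonneg.2 (pow_le_pow_left₀ (abs_nonneg _) h _))
          (sub_nonneg.2 (pow_le_pow_left₀ (abs_nonneg _) h _))
    rw [← hN.pow_abs a, ← hN.pow_abs b, pow_add, pow_add]
    nlinarith
  refine (Finset.sum_le_sum h2).trans (le_of_eq ?_)
  simp
  ring

theorem sub_mul_pow_sub_pow_le (a b : ℝ) {N : ℕ} (hN : Even N) :
    (a - b) * (a ^ (N + 1) - b ^ (N + 1)) ≤
      (N + 1) / 2 * ((a - b) ^ 2 * (a ^ N + b ^ N)) := by
  have h := geom_sum₂_mul a b (N + 1)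
  simp only [Nat.add_sub_cancel] at h
  rw [← h]
  have := mul_le_mul_of_nonneg_left (two_mul_geom_sum_le a b hN) (sq_nonneg (a - b))
  nlinarith

section Trace

variable {ι : Type*} [Fintype ι] [DecidableEq ι]

theorem exists_unitary_diagonal {H : Matrix ι ι ℂ} (hH : H.IsHermitian) :
    ∃ U ∈ Matrix.unitaryGroup ι ℂ,
      H = U * Matrix.diagonal (fun i => (hH.eigenvalues i : ℂ)) * star U := by
  refine ⟨hH.eigenvectorUnitary, hH.eigenvectorUnitary.2, ?_⟩
  have h := hH.spectral_theorem
  rw [Unitary.conjStarAlgAut_apply] at h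
  exact h

theorem pow_unitary_diagonal {U : Matrix ι ι ℂ} (hU : U ∈ Matrix.unitaryGroup ι ℂ) (x : ι → ℂ)
    (a : ℕ) : (U * Matrix.diagonal x * star U) ^ a =
      U * Matrix.diagonal (fun i => x i ^ a) * star U := by
  induction a with
  | zero => simpa using (Matrix.mem_unitaryGroup_iff.1 hU).symm
  | succ a ih =>
    rw [pow_succ, ih]
    simp only [Matrix.mul_assoc]
    rw [← Matrix.mul_assoc (star U) U, Matrix.mem_unitaryGroup_iff'.1 hU, Matrix.one_mul,
      ← Matrix.mul_assoc (Matrix.diagonal _) (Matrix.diagonal _), Matrix.diagonal_mul_diagonal]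
    simp [pow_succ]

/-- The weights are the squared overlaps of the two eigenbases and do not depend on the exponents. A
polynomial inequality in two real variables thus becomes a trace inequality for matrices that need
not commute. -/
theorem exists_trace_pow_mul_pow {H Y : Matrix ι ι ℂ} (hH : H.IsHermitian) (hY : Y.IsHermitian) :
    ∃ (x y : ι → ℝ) (c : ι → ι → ℝ), (∀ j k, 0 ≤ c j k) ∧
      ∀ a b : ℕ, (Matrix.trace (H ^ a * Y ^ b)).re = ∑ j, ∑ k, x j ^ a * y k ^ b * c j k := by
  obtain ⟨U, hU, hHU⟩ := exists_unitary_diagonal hH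
  obtain ⟨V, hV, hYV⟩ := exists_unitary_diagonal hY
  refine ⟨hH.eigenvalues, hY.eigenvalues, fun j k => Complex.normSq ((star U * V) j k),
    fun j k => Complex.normSq_nonneg _, fun a b => ?_⟩
  have hHa := pow_unitary_diagonal hU (fun i => (hH.eigenvalues i : ℂ)) a
  have hYb := pow_unitary_diagonal hV (fun i => (hY.eigenvalues i : ℂ)) b
  rw [← hHU] at hHa
  rw [← hYV] at hYb
  rw [hHa, hYb]
  have : Matrix.trace (U * Matrix.diagonal (fun i => ((hH.eigenvalues i : ℂ)) ^ a) * star U *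
      (V * Matrix.diagonal (fun i => ((hY.eigenvalues i : ℂ)) ^ b) * star V)) =
      Matrix.trace ((Matrix.diagonal (fun i => ((hH.eigenvalues i : ℂ)) ^ a) * (star U * V)) *
        (Matrix.diagonal (fun i => ((hY.eigenvalues i : ℂ)) ^ b) * star (star U * V))) := by
    rw [star_mul, star_star, Matrix.mul_assoc U, Matrix.mul_assoc U, Matrix.trace_mul_comm U]
    simp only [Matrix.mul_assoc]
  rw [this, Matrix.trace]
  simp only [Matrix.diag, Matrix.mul_apply (M := Matrix.diagonal _ * (star U * V)),
    Matrix.diagonal_mul, Complex.re_sum]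
  refine Finset.sum_congr rfl fun j _ => Finset.sum_congr rfl fun k _ => ?_
  rw [Matrix.star_apply]
  generalize (star U * V) j k = z
  have : (hH.eigenvalues j : ℂ) ^ a * z * ((hY.eigenvalues k : ℂ) ^ b * star z) =
      ((hH.eigenvalues j ^ a * hY.eigenvalues k ^ b * Complex.normSq z : ℝ) : ℂ) := by
    push_cast
    rw [Complex.normSq_eq_conj_mul_self]
    simp only [Complex.star_def]
    ring
  rw [this, Complex.ofReal_re]

theorem trace_sub_mul_pow_sub_pow_le {H Y : Matrix ι ι ℂ} (hH : H.IsHermitian)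
    (hY : Y.IsHermitian) {N : ℕ} (hN : Even N) :
    (Matrix.trace ((H - Y) * (H ^ (N + 1) - Y ^ (N + 1)))).re ≤
      (N + 1) / 2 * (Matrix.trace ((H - Y) ^ 2 * (H ^ N + Y ^ N))).re := by
  obtain ⟨x, y, c, hc, h⟩ := exists_trace_pow_mul_pow hH hY
  have e1 : (Matrix.trace ((H - Y) * (H ^ (N + 1) - Y ^ (N + 1)))).re =
      ∑ j, ∑ k, (x j - y k) * (x j ^ (N + 1) - y k ^ (N + 1)) * c j k := by
    have : Matrix.trace ((H - Y) * (H ^ (N + 1) - Y ^ (N + 1))) =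
        Matrix.trace (H ^ (N + 2) * Y ^ 0) - Matrix.trace (H ^ 1 * Y ^ (N + 1)) -
        Matrix.trace (H ^ (N + 1) * Y ^ 1) + Matrix.trace (H ^ 0 * Y ^ (N + 2)) := by
      rw [Matrix.trace_mul_comm (H ^ (N + 1)) (Y ^ 1)]
      simp only [← Matrix.trace_sub, ← Matrix.trace_add]
      congr 1
      simp only [pow_zero, pow_one, mul_one, one_mul, pow_succ' _ (N + 1)]
      noncomm_ring
    rw [this]
    simp only [Complex.sub_re, Complex.add_re, h, ← Finset.sum_sub_distrib, ← Finset.sum_add_distrib]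
    refine Finset.sum_congr rfl fun j _ => Finset.sum_congr rfl fun k _ => by ring
  have e2 : (Matrix.trace ((H - Y) ^ 2 * (H ^ N + Y ^ N))).re =
      ∑ j, ∑ k, (x j - y k) ^ 2 * (x j ^ N + y k ^ N) * c j k := by
    have : Matrix.trace ((H - Y) ^ 2 * (H ^ N + Y ^ N)) =
        Matrix.trace (H ^ (N + 2) * Y ^ 0) - 2 * Matrix.trace (H ^ (N + 1) * Y ^ 1) +
        Matrix.trace (H ^ N * Y ^ 2) + Matrix.trace (H ^ 2 * Y ^ N) -
        2 * Matrix.trace (H ^ 1 * Y ^ (N + 1)) + Matrix.trace (H ^ 0 * Y ^ (N + 2)) := by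
      have e : (H - Y) ^ 2 * (H ^ N + Y ^ N) = H * H * H ^ N - H * Y * H ^ N - Y * H * H ^ N
          + Y * Y * H ^ N + H * H * Y ^ N - H * Y * Y ^ N - Y * H * Y ^ N + Y * Y * Y ^ N := by
        rw [sq]; noncomm_ring
      have c1 : Matrix.trace (H * Y * H ^ N) = Matrix.trace (H ^ (N + 1) * Y ^ 1) := by
        rw [Matrix.trace_mul_comm, ← mul_assoc, ← pow_succ, pow_one]
      have c2 : Matrix.trace (Y * H * H ^ N) = Matrix.trace (H ^ (N + 1) * Y ^ 1) := by
        rw [mul_assoc, ← pow_succ', Matrix.trace_mul_comm, pow_one]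
      have c3 : Matrix.trace (Y * Y * H ^ N) = Matrix.trace (H ^ N * Y ^ 2) := by
        rw [Matrix.trace_mul_comm, sq]
      have c4 : Matrix.trace (Y * H * Y ^ N) = Matrix.trace (H ^ 1 * Y ^ (N + 1)) := by
        rw [mul_assoc, Matrix.trace_mul_comm, mul_assoc, ← pow_succ, pow_one]
      rw [e]
      simp only [Matrix.trace_sub, Matrix.trace_add, c1, c2, c3, c4]
      simp only [mul_assoc, ← pow_succ', pow_one, pow_zero, mul_one, one_mul, sq]
      ring
    rw [this]
    simp only [Complex.sub_re, Complex.add_re, Complex.mul_re, h, Complex.re_ofNat,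
      Complex.im_ofNat, zero_mul, sub_zero, Finset.mul_sum, ← Finset.sum_sub_distrib,
      ← Finset.sum_add_distrib]
    refine Finset.sum_congr rfl fun j _ => Finset.sum_congr rfl fun k _ => by ring
  rw [e1, e2, Finset.mul_sum]
  refine Finset.sum_le_sum fun j _ => ?_
  rw [Finset.mul_sum]
  refine Finset.sum_le_sum fun k _ => ?_
  have := mul_le_mul_of_nonneg_right (sub_mul_pow_sub_pow_le (x j) (y k) hN) (hc j k)
  linarith

end Trace

end CompressedSensing

namespace CompressedSensing

/-! ### Random signs and single sign flips. -/

section Signs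

variable {κ : Type*}

/-- The sign `±1` attached to a Boolean. -/
def sgn (b : Bool) : ℝ := if b then 1 else -1

@[simp] theorem sgn_not (b : Bool) : sgn (!b) = -sgn b := by cases b <;> simp [sgn]

@[simp] theorem sgn_mul_self (b : Bool) : sgn b * sgn b = 1 := by cases b <;> simp [sgn]

@[simp] theorem abs_sgn (b : Bool) : |sgn b| = 1 := by cases b <;> simp [sgn]

variable [DecidableEq κ]

/-- Flip the `i`-th sign. -/
def flipAt (i : κ) (ε : κ → Bool) : κ → Bool := Function.update ε i (!ε i)

theorem flipAt_involutive (i : κ) : Function.Involutive (flipAt i) := by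
  intro ε
  ext j
  by_cases h : j = i
  · subst h; simp [flipAt]
  · simp [flipAt, h]

@[simp] theorem flipAt_same (i : κ) (ε : κ → Bool) : flipAt i ε i = !ε i := by simp [flipAt]

theorem flipAt_of_ne {i j : κ} (h : j ≠ i) (ε : κ → Bool) : flipAt i ε j = ε j := by
  simp [flipAt, h]

variable [Fintype κ]

theorem sum_flipAt {M : Type*} [AddCommMonoid M] (i : κ) (f : (κ → Bool) → M) :
    ∑ ε, f (flipAt i ε) = ∑ ε, f ε :=
  Equiv.sum_comp (flipAt_involutive i).toPerm f

/-- The average over all choices of signs. -/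
noncomputable def signAvg (f : (κ → Bool) → ℝ) : ℝ :=
  ∑ ε : κ → Bool, (Fintype.card (κ → Bool) : ℝ)⁻¹ * f ε

theorem signAvg_mono {f g : (κ → Bool) → ℝ} (h : ∀ ε, f ε ≤ g ε) : signAvg f ≤ signAvg g :=
  Finset.sum_le_sum fun ε _ => mul_le_mul_of_nonneg_left (h ε) (by positivity)

theorem signAvg_const (c : ℝ) : signAvg (fun _ : κ → Bool => c) = c := by
  rw [signAvg, Finset.sum_const, nsmul_eq_mul, Finset.card_univ, ← mul_assoc, mul_inv_cancel₀,
    one_mul]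
  exact Nat.cast_ne_zero.2 Fintype.card_ne_zero

theorem signAvg_pow_le {f : (κ → Bool) → ℝ} (hf : ∀ ε, 0 ≤ f ε) (p : ℕ) :
    signAvg f ^ p ≤ signAvg fun ε => f ε ^ p := by
  refine Real.pow_arith_mean_le_arith_mean_pow Finset.univ (fun _ => _) f ?_ ?_ (fun ε _ => hf ε) p
  · intro _ _; positivity
  · simp

theorem signAvg_le_of_pow_le {f : (κ → Bool) → ℝ} (hf : ∀ ε, 0 ≤ f ε) {p : ℕ} (hp : p ≠ 0)
    {c : ℝ} (hc : 0 ≤ c) (h : signAvg (fun ε => f ε ^ p) ≤ c ^ p) : signAvg f ≤ c :=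
  le_of_pow_le_pow_left₀ hp hc ((signAvg_pow_le hf p).trans h)

/-- The sum of vectors with signs. -/
noncomputable def signSum {E : Type*} [AddCommGroup E] [Module ℝ E] (A : κ → E) (ε : κ → Bool) :
    E := ∑ i, sgn (ε i) • A i

theorem signSum_sub_flipAt {E : Type*} [AddCommGroup E] [Module ℝ E] (A : κ → E) (ε : κ → Bool)
    (i : κ) : signSum A ε - signSum A (flipAt i ε) = (2 * sgn (ε i)) • A i := by
  rw [signSum, signSum, ← Finset.sum_sub_distrib, Finset.sum_eq_single i]
  · rw [flipAt_same, sgn_not, ← sub_smul]; congr 1; ring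
  · intro j _ hj; rw [flipAt_of_ne hj, sub_self]
  · intro h; exact absurd (Finset.mem_univ i) h

end Signs

open scoped Matrix.Norms.L2Operator

/-! ### Operator norm and traces. -/

section Norms

variable {ι : Type*} [Fintype ι] [DecidableEq ι]

theorem norm_star_dotProduct_mulVec_le (M : Matrix ι ι ℂ) (x y : EuclideanSpace ℂ ι) :
    ‖star x.ofLp ⬝ᵥ (M.mulVec y.ofLp)‖ ≤ ‖M‖ * (‖x‖ * ‖y‖) := by
  have h : star x.ofLp ⬝ᵥ (M.mulVec y.ofLp) = inner ℂ x (WithLp.toLp 2 (M.mulVec y.ofLp)) := by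
    rw [EuclideanSpace.inner_eq_star_dotProduct, dotProduct_comm]
  rw [h]
  refine (norm_inner_le_norm _ _).trans ?_
  have := Matrix.l2_opNorm_mulVec M y
  calc ‖x‖ * _ ≤ ‖x‖ * (‖M‖ * ‖y‖) := mul_le_mul_of_nonneg_left this (norm_nonneg _)
    _ = _ := by ring

/-- The trace is the sum of the quadratic forms of `M` at the columns of `K`. -/
theorem re_trace_mul_mul_conjTranspose_le (M K : Matrix ι ι ℂ) :
    (Matrix.trace (M * (K * K.conjTranspose))).re ≤
      ‖M‖ * (Matrix.trace (K * K.conjTranspose)).re := by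
  have h : ∀ M : Matrix ι ι ℂ, Matrix.trace (M * (K * K.conjTranspose)) =
      ∑ j, star (fun i => K i j) ⬝ᵥ (M.mulVec fun i => K i j) := by
    intro M
    rw [← mul_assoc, Matrix.trace_mul_comm, Matrix.trace]
    refine Finset.sum_congr rfl fun j _ => ?_
    rw [Matrix.diag, Matrix.mul_apply]
    rfl
  have h1 := h 1
  rw [one_mul] at h1
  rw [h, h1, Complex.re_sum, Complex.re_sum, Finset.mul_sum]
  refine Finset.sum_le_sum fun j _ => ?_
  refine (Complex.re_le_norm _).trans
    ((norm_star_dotProduct_mulVec_le M (WithLp.toLp 2 fun i => K i j)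
      (WithLp.toLp 2 fun i => K i j)).trans (le_of_eq ?_))
  rw [← sq, EuclideanSpace.norm_sq_eq, Matrix.one_mulVec]
  simp only [dotProduct, Pi.star_apply, Complex.re_sum]
  congr 1
  refine Finset.sum_congr rfl fun i _ => ?_
  rw [Complex.star_def, ← Complex.normSq_eq_conj_mul_self, Complex.ofReal_re,
    Complex.normSq_eq_norm_sq]

theorem norm_pow_le_trace {X : Matrix ι ι ℂ} (hX : X.IsHermitian) {p : ℕ} (hp : p ≠ 0) :
    ‖X‖ ^ (2 * p) ≤ (Matrix.trace (X ^ (2 * p))).re := by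
  obtain ⟨U, hU, hXU⟩ := exists_unitary_diagonal hX
  have hn : ∀ D : Matrix ι ι ℂ, ‖U * D * star U‖ = ‖D‖ := fun D => by
    have e1 := CStarRing.norm_coe_unitary_mul (⟨U, hU⟩ : Matrix.unitaryGroup ι ℂ) (D * star U)
    have e2 := CStarRing.norm_mul_coe_unitary D (star (⟨U, hU⟩ : Matrix.unitaryGroup ι ℂ))
    simp only [Unitary.coe_star] at e1 e2
    rw [mul_assoc, e1, e2]
  have hp2 := pow_unitary_diagonal hU (fun i => (hX.eigenvalues i : ℂ)) (2 * p)
  rw [← hXU] at hp2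
  have htr : (Matrix.trace (X ^ (2 * p))).re = ∑ i, hX.eigenvalues i ^ (2 * p) := by
    rw [hp2, mul_assoc, Matrix.trace_mul_comm, mul_assoc, Matrix.mem_unitaryGroup_iff'.1 hU,
      mul_one, Matrix.trace_diagonal, Complex.re_sum]
    refine Finset.sum_congr rfl fun i _ => ?_
    rw [← Complex.ofReal_pow, Complex.ofReal_re]
  have hnorm : ‖X‖ = ‖fun i => (hX.eigenvalues i : ℂ)‖ := by
    conv_lhs => rw [hXU]
    rw [hn, Matrix.l2_opNorm_diagonal]
  have heven : ∀ i, 0 ≤ hX.eigenvalues i ^ (2 * p) := fun i => (even_two_mul p).pow_nonneg _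
  rw [htr, hnorm]
  rcases isEmpty_or_nonempty ι with h | h
  · have : (fun i => (hX.eigenvalues i : ℂ)) = 0 := Subsingleton.elim _ _
    rw [this, norm_zero, zero_pow (by omega)]
    exact Finset.sum_nonneg fun i _ => heven i
  · obtain ⟨i, hi⟩ : ∃ i, ‖fun i => (hX.eigenvalues i : ℂ)‖ = ‖(hX.eigenvalues i : ℂ)‖ := by
      obtain ⟨i, -, hi⟩ := Finset.exists_max_image Finset.univ
        (fun i => ‖(hX.eigenvalues i : ℂ)‖) Finset.univ_nonempty
      refine ⟨i, le_antisymm ?_ (norm_le_pi_norm (fun i => (hX.eigenvalues i : ℂ)) i)⟩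
      exact (pi_norm_le_iff_of_nonneg (norm_nonneg _)).2 fun j => hi j (Finset.mem_univ j)
    rw [hi, Complex.norm_real, Real.norm_eq_abs, (even_two_mul p).pow_abs]
    exact Finset.single_le_sum (f := fun i => hX.eigenvalues i ^ (2 * p)) (fun i _ => heven i)
      (Finset.mem_univ i)

end Norms

/-! ### Moments of Rademacher sums of matrices. -/

section Khintchine

theorem isHermitian_signSum {ι κ : Type*} [Fintype κ] {A : κ → Matrix ι ι ℂ} (hA : ∀ i, (A i).IsHermitian)
    (ε : κ → Bool) : (signSum A ε).IsHermitian := by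
  rw [Matrix.IsHermitian, signSum, Matrix.conjTranspose_sum]
  refine Finset.sum_congr rfl fun i _ => ?_
  rw [Matrix.conjTranspose_smul, (hA i).eq, star_trivial]

variable {ι κ : Type*} [Fintype ι] [DecidableEq ι] [Fintype κ] [DecidableEq κ]

/-- One step of the moment recursion, by an exchangeable pair. One factor of the power is expanded
into its terms, and each term is compared with the sum whose `i`-th sign is flipped. The difference
of the two sums is `2 ε i A i`, and `trace_sub_mul_pow_sub_pow_le` turns it into a factor `A i ^ 2`.
-/
theorem sum_trace_signSum_pow_le {A : κ → Matrix ι ι ℂ} (hA : ∀ i, (A i).IsHermitian) (p : ℕ) :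
    ∑ ε, (Matrix.trace (signSum A ε ^ (2 * p + 2))).re ≤
      (2 * (p : ℝ) + 1) * ‖∑ i, A i ^ 2‖ * ∑ ε, (Matrix.trace (signSum A ε ^ (2 * p))).re := by
  have h1 : ∀ i, ∑ ε, (Matrix.trace ((sgn (ε i) • A i) * signSum A ε ^ (2 * p + 1))).re ≤
      (2 * (p : ℝ) + 1) * ∑ ε, (Matrix.trace (A i ^ 2 * signSum A ε ^ (2 * p))).re := by
    intro i
    -- Averaging over `ε` and over its flip at `i` antisymmetrizes the power, since the prefactor
    -- changes sign.
    have e1 : 2 * ∑ ε, (Matrix.trace ((sgn (ε i) • A i) * signSum A ε ^ (2 * p + 1))).re =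
        ∑ ε, (1 / 2) * (Matrix.trace ((signSum A ε - signSum A (flipAt i ε)) *
          (signSum A ε ^ (2 * p + 1) - signSum A (flipAt i ε) ^ (2 * p + 1)))).re := by
      rw [two_mul]
      nth_rewrite 2 [← sum_flipAt i]
      rw [← Finset.sum_add_distrib]
      refine Finset.sum_congr rfl fun ε _ => ?_
      rw [signSum_sub_flipAt, flipAt_same, sgn_not, mul_sub, Matrix.trace_sub, Complex.sub_re]
      simp only [mul_smul, Matrix.smul_mul, Matrix.trace_smul, Complex.smul_re, smul_eq_mul]
      ring
    have e2 : ∀ ε, (Matrix.trace ((signSum A ε - signSum A (flipAt i ε)) ^ 2 *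
          (signSum A ε ^ (2 * p) + signSum A (flipAt i ε) ^ (2 * p)))).re =
        4 * ((Matrix.trace (A i ^ 2 * signSum A ε ^ (2 * p))).re +
          (Matrix.trace (A i ^ 2 * signSum A (flipAt i ε) ^ (2 * p))).re) := by
      intro ε
      rw [signSum_sub_flipAt, smul_pow, mul_pow, sq (sgn _), sgn_mul_self, mul_add,
        Matrix.trace_add, Complex.add_re]
      simp only [Matrix.smul_mul, Matrix.trace_smul, Complex.smul_re, smul_eq_mul]
      ring
    have e3 : ∑ ε, (Matrix.trace (A i ^ 2 * signSum A (flipAt i ε) ^ (2 * p))).re =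
        ∑ ε, (Matrix.trace (A i ^ 2 * signSum A ε ^ (2 * p))).re :=
      sum_flipAt i fun ε => (Matrix.trace (A i ^ 2 * signSum A ε ^ (2 * p))).re
    have e4 : 2 * ∑ ε, (Matrix.trace ((sgn (ε i) • A i) * signSum A ε ^ (2 * p + 1))).re ≤
        ∑ ε, (2 * (p : ℝ) + 1) * ((Matrix.trace (A i ^ 2 * signSum A ε ^ (2 * p))).re +
          (Matrix.trace (A i ^ 2 * signSum A (flipAt i ε) ^ (2 * p))).re) := by
      rw [e1]
      refine Finset.sum_le_sum fun ε _ => ?_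
      have := trace_sub_mul_pow_sub_pow_le (isHermitian_signSum hA ε)
        (isHermitian_signSum hA (flipAt i ε)) (even_two_mul p)
      rw [e2] at this
      push_cast at this
      linarith
    rw [← Finset.mul_sum, Finset.sum_add_distrib, e3] at e4
    linarith
  calc ∑ ε, (Matrix.trace (signSum A ε ^ (2 * p + 2))).re
      = ∑ i, ∑ ε, (Matrix.trace ((sgn (ε i) • A i) * signSum A ε ^ (2 * p + 1))).re := by
        rw [Finset.sum_comm]
        refine Finset.sum_congr rfl fun ε _ => ?_
        rw [pow_succ' _ (2 * p + 1), ← Complex.re_sum, ← Matrix.trace_sum, ← Finset.sum_mul]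
        rfl
    _ ≤ ∑ i, (2 * (p : ℝ) + 1) * ∑ ε, (Matrix.trace (A i ^ 2 * signSum A ε ^ (2 * p))).re :=
        Finset.sum_le_sum fun i _ => h1 i
    _ = (2 * (p : ℝ) + 1) * ∑ ε, (Matrix.trace ((∑ i, A i ^ 2) * signSum A ε ^ (2 * p))).re := by
        rw [← Finset.mul_sum, Finset.sum_comm]
        congr 1
        refine Finset.sum_congr rfl fun ε _ => ?_
        rw [← Complex.re_sum, ← Matrix.trace_sum, ← Finset.sum_mul]
    _ ≤ (2 * (p : ℝ) + 1) * ∑ ε, ‖∑ i, A i ^ 2‖ * (Matrix.trace (signSum A ε ^ (2 * p))).re := by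
        refine mul_le_mul_of_nonneg_left (Finset.sum_le_sum fun ε _ => ?_) (by positivity)
        have e : signSum A ε ^ (2 * p) = signSum A ε ^ p * (signSum A ε ^ p).conjTranspose := by
          rw [((isHermitian_signSum hA ε).pow p).eq, two_mul, pow_add]
        rw [e]
        exact re_trace_mul_mul_conjTranspose_le _ _
    _ = _ := by rw [← Finset.mul_sum]; ring

/-- Fixing `q` in advance bounds every factor `2 p + 1` of the recursion by `2 q`. -/
theorem signAvg_trace_signSum_pow_le {A : κ → Matrix ι ι ℂ} (hA : ∀ i, (A i).IsHermitian)
    (q p : ℕ) (hp : p ≤ q) : signAvg (fun ε => (Matrix.trace (signSum A ε ^ (2 * p))).re) ≤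
      (2 * q * ‖∑ i, A i ^ 2‖) ^ p * Fintype.card ι := by
  induction p with
  | zero => simp [signAvg_const]
  | succ p ih =>
    have h := sum_trace_signSum_pow_le hA p
    have ih := ih (by omega)
    have h0 : 0 ≤ signAvg (fun ε => (Matrix.trace (signSum A ε ^ (2 * p))).re) := by
      refine Finset.sum_nonneg fun ε _ => mul_nonneg (by positivity) ?_
      rcases eq_or_ne p 0 with rfl | h
      · simp
      · exact le_trans (by positivity) (norm_pow_le_trace (isHermitian_signSum hA ε) h)
    have h1 : signAvg (fun ε => (Matrix.trace (signSum A ε ^ (2 * (p + 1)))).re) ≤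
        (2 * p + 1) * ‖∑ i, A i ^ 2‖ *
          signAvg (fun ε => (Matrix.trace (signSum A ε ^ (2 * p))).re) := by
      rw [signAvg, signAvg, ← Finset.mul_sum, ← Finset.mul_sum, mul_left_comm]
      exact mul_le_mul_of_nonneg_left h (by positivity)
    have hpq : (2 * p + 1 : ℝ) ≤ 2 * q := by
      have : (p + 1 : ℝ) ≤ q := by exact_mod_cast hp
      linarith
    calc _ ≤ _ := h1
      _ ≤ 2 * q * ‖∑ i, A i ^ 2‖ *
          ((2 * q * ‖∑ i, A i ^ 2‖) ^ p * Fintype.card ι) :=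
        mul_le_mul (mul_le_mul_of_nonneg_right hpq (norm_nonneg _)) ih h0 (by positivity)
      _ = _ := by ring

/-- **Matrix Khintchine inequality** for the expected operator norm of a Rademacher sum. -/
theorem signAvg_norm_signSum_le {A : κ → Matrix ι ι ℂ} (hA : ∀ i, (A i).IsHermitian)
    {p : ℕ} (hp : p ≠ 0) (hι : (Fintype.card ι : ℝ) ≤ Real.exp p) :
    signAvg (fun ε => ‖signSum A ε‖) ≤ √(6 * p * ‖∑ i, A i ^ 2‖) := by
  refine signAvg_le_of_pow_le (p := 2 * p) (fun ε => norm_nonneg _) (by omega)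
    (Real.sqrt_nonneg _) ?_
  calc signAvg (fun ε => ‖signSum A ε‖ ^ (2 * p))
      ≤ signAvg (fun ε => (Matrix.trace (signSum A ε ^ (2 * p))).re) :=
        signAvg_mono fun ε => norm_pow_le_trace (isHermitian_signSum hA ε) hp
    _ ≤ (2 * p * ‖∑ i, A i ^ 2‖) ^ p * Fintype.card ι :=
        signAvg_trace_signSum_pow_le hA p p le_rfl
    -- The dimension is at most `e ^ p ≤ 3 ^ p`, so after the root of order `2 p` it costs only a
    -- constant.
    _ ≤ (2 * p * ‖∑ i, A i ^ 2‖) ^ p * 3 ^ p := by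
        refine mul_le_mul_of_nonneg_left (hι.trans ?_) (by positivity)
        rw [← Real.exp_one_pow]
        exact pow_le_pow_left₀ (Real.exp_pos 1).le (by linarith [Real.exp_one_lt_d9]) p
    _ = _ := by
        rw [pow_mul, Real.sq_sqrt (by positivity), ← mul_pow]
        congr 1; ring

end Khintchine

end CompressedSensing

namespace CompressedSensing

set_option linter.unusedSectionVars false

/-! ### Symmetrization of sums of independent vectors. -/

section Symmetrization

variable {S κ E : Type*} [MeasurableSpace S] [Fintype κ] [DecidableEq κ] [NormedAddCommGroup E]
  [NormedSpace ℝ E] [CompleteSpace E] {μ : Measure S} [IsProbabilityMeasure μ]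

/-- Exchange `β i` and `β' i` at the indices `i` with `ε i = false`. -/
def swapAt (ε : κ → Bool) (x : (κ → S) × (κ → S)) : (κ → S) × (κ → S) :=
  (fun i => if ε i then x.1 i else x.2 i, fun i => if ε i then x.2 i else x.1 i)

/-- Seen as a product over the indices of copies of `μ × μ`, the map acts in each coordinate as the
identity or as the swap. -/
theorem measurePreserving_swapAt (μ : Measure S) [IsProbabilityMeasure μ] (ε : κ → Bool) :
    MeasurePreserving (swapAt (S := S) ε)
      ((Measure.pi fun _ : κ => μ).prod (Measure.pi fun _ : κ => μ))
      ((Measure.pi fun _ : κ => μ).prod (Measure.pi fun _ : κ => μ)) := by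
  have h1 := measurePreserving_arrowProdEquivProdArrow S S κ (fun _ => μ) (fun _ => μ)
  have h2 : ∀ i : κ, MeasurePreserving (if ε i then id else Prod.swap) (μ.prod μ) (μ.prod μ) := by
    intro i
    cases ε i
    · simpa using Measure.measurePreserving_swap
    · simpa using MeasurePreserving.id _
  have h3 := measurePreserving_pi (fun _ : κ => μ.prod μ) (fun _ : κ => μ.prod μ) h2
  have h4 := (h1.comp h3).comp (h1.symm _)
  convert h4 using 1
  funext x
  refine Prod.ext ?_ ?_ <;> funext i <;> cases h : ε i <;>
    simp [swapAt, MeasurableEquiv.arrowProdEquivProdArrow, Equiv.arrowProdEquivProdArrow, h]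

theorem integrable_sum_comp_eval {f : S → E} (hf : Integrable f μ) (c : κ → ℝ) :
    Integrable (fun β : κ → S => ∑ i, c i • f (β i)) (Measure.pi fun _ : κ => μ) :=
  integrable_finsetSum _ fun i _ =>
    (integrable_comp_eval (μ := fun _ : κ => μ) (i := i) hf).smul (c i)

theorem integrable_signAvg_norm_signSum {f : S → E} (hf : Integrable f μ) :
    Integrable (fun β : κ → S => signAvg fun ε => ‖signSum (fun i => f (β i)) ε‖)
      (Measure.pi fun _ : κ => μ) :=
  integrable_finsetSum _ fun ε _ =>
    (integrable_sum_comp_eval hf fun i => sgn (ε i)).norm.const_mul _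

/-- **Symmetrization**: a sum of centered independent vectors is dominated by a Rademacher sum. -/
theorem integral_norm_sum_sub_le_signAvg {f : S → E} (hf : Integrable f μ) :
    ∫ β : κ → S, ‖∑ i, f (β i) - (Fintype.card κ : ℝ) • ∫ α, f α ∂μ‖ ∂(Measure.pi fun _ => μ) ≤
      2 * ∫ β : κ → S, signAvg (fun ε => ‖signSum (fun i => f (β i)) ε‖)
        ∂(Measure.pi fun _ => μ) := by
  set π := Measure.pi fun _ : κ => μ with hπ
  have hi : ∀ i : κ, Integrable (fun β : κ → S => f (β i)) π := fun i =>
    integrable_comp_eval (μ := fun _ : κ => μ) (i := i) hf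
  have hsum : Integrable (fun β : κ → S => ∑ i, f (β i)) π := integrable_finsetSum _ fun i _ => hi i
  have hmean : ∫ β, ∑ i, f (β i) ∂π = (Fintype.card κ : ℝ) • ∫ α, f α ∂μ := by
    rw [integral_finsetSum _ fun i _ => hi i]
    have : ∀ i : κ, ∫ β, f (β i) ∂π = ∫ α, f α ∂μ := fun i =>
      integral_comp_eval (μ := fun _ : κ => μ) (i := i) hf.1
    simp [this, Nat.cast_smul_eq_nsmul]
  have hsgn : ∀ ε : κ → Bool, Integrable (fun β : κ → S => signSum (fun i => f (β i)) ε) π :=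
    fun ε => integrable_sum_comp_eval hf fun i => sgn (ε i)
  have hprod : ∀ ε : κ → Bool, Integrable (fun x : (κ → S) × (κ → S) =>
      signSum (fun i => f (x.1 i)) ε - signSum (fun i => f (x.2 i)) ε) (π.prod π) := fun ε =>
    ((hsgn ε).comp_fst π).sub ((hsgn ε).comp_snd π)
  have hdiff : Integrable (fun x : (κ → S) × (κ → S) =>
      ∑ i, f (x.1 i) - ∑ i, f (x.2 i)) (π.prod π) := (hsum.comp_fst π).sub (hsum.comp_snd π)
  -- The mean is the integral over an independent copy, and the norm of an integral is at most the
  -- integral of the norm.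
  have h1 : ∫ β : κ → S, ‖∑ i, f (β i) - (Fintype.card κ : ℝ) • ∫ α, f α ∂μ‖ ∂π ≤
      ∫ x : (κ → S) × (κ → S), ‖∑ i, f (x.1 i) - ∑ i, f (x.2 i)‖ ∂(π.prod π) := by
    rw [integral_prod _ hdiff.norm]
    refine integral_mono (hsum.sub (integrable_const _)).norm hdiff.norm.integral_prod_left ?_
    intro β
    have : ∑ i, f (β i) - (Fintype.card κ : ℝ) • ∫ α, f α ∂μ =
        ∫ β', (∑ i, f (β i) - ∑ i, f (β' i)) ∂π := by
      rw [integral_sub (integrable_const _) hsum, hmean]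
      simp
    simp only [this]
    exact norm_integral_le_integral_norm _
  -- Exchanging the two copies where `ε` is negative introduces the signs without changing the law.
  -- The triangle inequality then separates the copies.
  have h2 : ∀ ε : κ → Bool,
      ∫ x : (κ → S) × (κ → S), ‖∑ i, f (x.1 i) - ∑ i, f (x.2 i)‖ ∂(π.prod π) ≤
        2 * ∫ β, ‖signSum (fun i => f (β i)) ε‖ ∂π := by
    intro ε
    have hm := measurePreserving_swapAt μ ε
    rw [← hπ] at hm
    have e1 : ∫ x : (κ → S) × (κ → S), ‖∑ i, f (x.1 i) - ∑ i, f (x.2 i)‖ ∂(π.prod π) =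
        ∫ x : (κ → S) × (κ → S),
          ‖signSum (fun i => f (x.1 i)) ε - signSum (fun i => f (x.2 i)) ε‖ ∂(π.prod π) := by
      rw [← hm.map_eq, integral_map hm.measurable.aemeasurable
        (by rw [hm.map_eq]; exact hdiff.norm.1), hm.map_eq]
      refine integral_congr_ae (Filter.Eventually.of_forall fun x => ?_)
      simp only [signSum, ← Finset.sum_sub_distrib]
      congr 1
      refine Finset.sum_congr rfl fun i _ => ?_
      cases h : ε i <;> simp [swapAt, sgn, h] <;> abel
    rw [e1]
    calc _ ≤ ∫ x : (κ → S) × (κ → S), (‖signSum (fun i => f (x.1 i)) ε‖ +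
          ‖signSum (fun i => f (x.2 i)) ε‖) ∂(π.prod π) := by
          refine integral_mono (hprod ε).norm
            (((hsgn ε).comp_fst π).norm.add ((hsgn ε).comp_snd π).norm) fun x => norm_sub_le _ _
      _ = _ := by
          rw [integral_add ((hsgn ε).comp_fst π).norm ((hsgn ε).comp_snd π).norm,
            integral_fun_fst (fun β : κ → S => ‖signSum (fun i => f (β i)) ε‖),
            integral_fun_snd (fun β : κ → S => ‖signSum (fun i => f (β i)) ε‖)]
          simp [two_mul]
  refine h1.trans ?_
  calc _ = signAvg (fun _ : κ → Bool =>
        ∫ x : (κ → S) × (κ → S), ‖∑ i, f (x.1 i) - ∑ i, f (x.2 i)‖ ∂(π.prod π)) :=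
        (signAvg_const _).symm
    _ ≤ signAvg fun ε : κ → Bool => 2 * ∫ β, ‖signSum (fun i => f (β i)) ε‖ ∂π :=
        signAvg_mono h2
    _ = _ := by
        simp only [signAvg]
        rw [integral_finsetSum _ fun ε _ => ((hsgn ε).norm.const_mul _), Finset.mul_sum]
        refine Finset.sum_congr rfl fun ε _ => ?_
        rw [integral_const_mul]
        ring

theorem integral_sqrt_le_sqrt_integral {Ω : Type*} [MeasurableSpace Ω] {π : Measure Ω}
    [IsProbabilityMeasure π] {f : Ω → ℝ} (hf : Integrable f π) (h0 : ∀ x, 0 ≤ f x)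
    (hs : Integrable (fun x => √(f x)) π) :
    ∫ x, √(f x) ∂π ≤ √(∫ x, f x ∂π) :=
  Real.strictConcaveOn_sqrt.concaveOn.le_map_integral Real.continuous_sqrt.continuousOn
    isClosed_Ici (Filter.Eventually.of_forall h0) hf hs

theorem integrable_sqrt {Ω : Type*} [MeasurableSpace Ω] {π : Measure Ω}
    [IsProbabilityMeasure π] {f : Ω → ℝ} (hf : Integrable f π) (h0 : ∀ x, 0 ≤ f x) :
    Integrable (fun x => √(f x)) π := by
  refine ((integrable_const (1 : ℝ)).add hf).mono'
    (Real.continuous_sqrt.comp_aestronglyMeasurable hf.1) (Filter.Eventually.of_forall fun x => ?_)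
  rw [Real.norm_eq_abs, abs_of_nonneg (Real.sqrt_nonneg _)]
  simp only [Pi.add_apply]
  nlinarith [Real.sq_sqrt (h0 x), sq_nonneg (√(f x) - 1), Real.sqrt_nonneg (f x), h0 x]

end Symmetrization

open scoped Matrix.Norms.L2Operator MatrixOrder

/-! ### Expected deviation of sums of independent matrices. -/

section MatrixConcentration

variable {S ι κ : Type*} [MeasurableSpace S] [Fintype ι] [DecidableEq ι] [Fintype κ]
  [DecidableEq κ] {μ : Measure S} [IsProbabilityMeasure μ]

/-- With `T = K† K` one has `T² = K† (K K†) K`, and the middle factor is at most its norm, which is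
that of `T`. -/
theorem sq_le_norm_smul {T : Matrix ι ι ℂ} (hT : T.PosSemidef) : T ^ 2 ≤ ‖T‖ • T := by
  obtain ⟨K, rfl⟩ := CStarAlgebra.nonneg_iff_eq_star_mul_self.1
    (Matrix.nonneg_iff_posSemidef.2 hT)
  have h := CStarAlgebra.star_left_conjugate_le_norm_smul (a := K) (b := K * star K)
    (IsSelfAdjoint.mul_star_self K)
  have hn : ‖K * star K‖ = ‖star K * K‖ := by
    rw [CStarRing.norm_self_mul_star, CStarRing.norm_star_mul_self]
  rw [hn] at h
  rw [sq]
  simpa only [mul_assoc] using h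

theorem norm_sum_sq_le {T : κ → Matrix ι ι ℂ} (hT : ∀ i, (T i).PosSemidef) {b : ℝ}
    (hb : ∀ i, ‖T i‖ ≤ b) : ‖∑ i, T i ^ 2‖ ≤ b * ‖∑ i, T i‖ := by
  rcases isEmpty_or_nonempty κ with h | ⟨⟨i₀⟩⟩
  · simp
  have hb0 : 0 ≤ b := (norm_nonneg _).trans (hb i₀)
  have h0 : ∀ i, 0 ≤ T i := fun i => Matrix.nonneg_iff_posSemidef.2 (hT i)
  have h1 : ∑ i, T i ^ 2 ≤ b • ∑ i, T i := by
    rw [Finset.smul_sum]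
    exact Finset.sum_le_sum fun i _ => (sq_le_norm_smul (hT i)).trans
      (smul_le_smul_of_nonneg_right (hb i) (h0 i))
  have h2 : 0 ≤ ∑ i, T i ^ 2 := Finset.sum_nonneg fun i _ =>
    Matrix.nonneg_iff_posSemidef.2 ((hT i).pow 2)
  refine (CStarAlgebra.norm_le_norm_of_nonneg_of_le h2 h1).trans (le_of_eq ?_)
  rw [norm_smul, Real.norm_of_nonneg hb0]

/-- Concentration of a sum of independent bounded positive semidefinite matrices. -/
theorem integral_norm_sum_sub_le_of_posSemidef {T : S → Matrix ι ι ℂ}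
    (hmeas : AEStronglyMeasurable T μ) (hT : ∀ α, (T α).PosSemidef) {b V : ℝ}
    (hb : ∀ α, ‖T α‖ ≤ b) (hV : ‖(Fintype.card κ : ℝ) • ∫ α, T α ∂μ‖ ≤ V)
    {p : ℕ} (hp : p ≠ 0) (hι : (Fintype.card ι : ℝ) ≤ Real.exp p) :
    ∫ β : κ → S, ‖∑ i, T (β i) - (Fintype.card κ : ℝ) • ∫ α, T α ∂μ‖ ∂(Measure.pi fun _ => μ) ≤
      24 * p * b + 2 * √(6 * p * b * V) := by
  have hS : Nonempty S := by
    by_contra h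
    have := not_nonempty_iff.1 h
    exact IsProbabilityMeasure.ne_zero μ (Measure.eq_zero_of_isEmpty μ)
  have hb0 : 0 ≤ b := (norm_nonneg _).trans (hb hS.some)
  have hV0 : 0 ≤ V := (norm_nonneg _).trans hV
  have hint : Integrable T μ := Integrable.of_bound hmeas b (Filter.Eventually.of_forall hb)
  set π := Measure.pi fun _ : κ => μ with hπ
  set M := (Fintype.card κ : ℝ) • ∫ α, T α ∂μ with hM
  set D := ∫ β : κ → S, ‖∑ i, T (β i) - M‖ ∂π with hD
  have hsum : Integrable (fun β : κ → S => ∑ i, T (β i)) π := by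
    simpa using integrable_sum_comp_eval hint (fun _ : κ => (1 : ℝ))
  have hsub : Integrable (fun β : κ → S => ∑ i, T (β i) - M) π := hsum.sub (integrable_const _)
  have hD0 : 0 ≤ D := integral_nonneg fun _ => norm_nonneg _
  have h1 : D ≤ 2 * ∫ β : κ → S, signAvg (fun ε => ‖signSum (fun i => T (β i)) ε‖) ∂π :=
    integral_norm_sum_sub_le_signAvg hint
  have hy0 : (0 : ℝ) ≤ 6 * p * b := by positivity
  have h2 : ∫ β : κ → S, signAvg (fun ε => ‖signSum (fun i => T (β i)) ε‖) ∂π ≤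
      ∫ β : κ → S, √(6 * p * b * ‖∑ i, T (β i)‖) ∂π := by
    refine integral_mono (integrable_signAvg_norm_signSum hint)
      (integrable_sqrt (hsum.norm.const_mul _) fun _ => by positivity) fun β => ?_
    refine (signAvg_norm_signSum_le (fun i => (hT (β i)).1) hp hι).trans (Real.sqrt_le_sqrt ?_)
    have := norm_sum_sq_le (fun i => hT (β i)) (fun i => hb (β i))
    calc 6 * p * ‖∑ i, T (β i) ^ 2‖ ≤ 6 * p * (b * ‖∑ i, T (β i)‖) :=
          mul_le_mul_of_nonneg_left this (by positivity)
      _ = _ := by ring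
  -- Self-bounding: since `T² ≤ b T`, the random variance is controlled by the sum itself, hence by
  -- `V + D`. The resulting quadratic inequality for the deviation `D` is solved below with `y = 6 p
  -- b`.
  have h3 : ∫ β : κ → S, √(6 * p * b * ‖∑ i, T (β i)‖) ∂π ≤ √(6 * p * b * (V + D)) := by
    refine (integral_sqrt_le_sqrt_integral (hsum.norm.const_mul _) (fun _ => by positivity)
      (integrable_sqrt (hsum.norm.const_mul _) fun _ => by positivity)).trans (Real.sqrt_le_sqrt ?_)
    rw [integral_const_mul]
    refine mul_le_mul_of_nonneg_left ?_ hy0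
    have : ∫ β : κ → S, ‖∑ i, T (β i)‖ ∂π ≤ ∫ β : κ → S, (‖M‖ + ‖∑ i, T (β i) - M‖) ∂π :=
      integral_mono hsum.norm ((integrable_const _).add hsub.norm)
        fun β => by simpa using norm_add_le M (∑ i, T (β i) - M)
    rw [integral_add (integrable_const _) hsub.norm] at this
    simp only [integral_const, probReal_univ, one_smul] at this
    exact this.trans (add_le_add hV le_rfl)
  have h4 : D ≤ 2 * √(6 * p * b * (V + D)) := h1.trans (by linarith [h2.trans h3])
  rw [show 24 * p * b = 4 * (6 * p * b) by ring]
  generalize 6 * p * b = y at *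
  by_contra hcon
  push Not at hcon
  have hs := Real.sqrt_nonneg (y * V)
  have e1 := Real.sq_sqrt (mul_nonneg hy0 hV0)
  have e2 := Real.sq_sqrt (mul_nonneg hy0 (add_nonneg hV0 hD0))
  have e3 : D ^ 2 ≤ (2 * √(y * (V + D))) ^ 2 := pow_le_pow_left₀ hD0 h4 2
  nlinarith [mul_pos (sub_pos.2 hcon) (sub_pos.2 hcon)]

/-- Concentration of a sum of independent bounded Hermitian matrices. -/
theorem integral_norm_sum_sub_le_of_isHermitian {Z : S → Matrix ι ι ℂ}
    (hmeas : AEStronglyMeasurable Z μ) (hZ : ∀ α, (Z α).IsHermitian) {b V : ℝ}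
    (hb : ∀ α, ‖Z α‖ ≤ b) (hV : ‖(Fintype.card κ : ℝ) • ∫ α, Z α ^ 2 ∂μ‖ ≤ V)
    {p : ℕ} (hp : p ≠ 0) (hι : (Fintype.card ι : ℝ) ≤ Real.exp p) :
    ∫ β : κ → S, ‖∑ i, Z (β i) - (Fintype.card κ : ℝ) • ∫ α, Z α ∂μ‖ ∂(Measure.pi fun _ => μ) ≤
      2 * √(6 * p * (2 * V + 30 * p * b ^ 2)) := by
  have hV0 : 0 ≤ V := (norm_nonneg _).trans hV
  have hint : Integrable Z μ := Integrable.of_bound hmeas b (Filter.Eventually.of_forall hb)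
  have hmeas2 : AEStronglyMeasurable (fun α => Z α ^ 2) μ :=
    (continuous_pow 2).comp_aestronglyMeasurable hmeas
  have hb2 : ∀ α, ‖Z α ^ 2‖ ≤ b ^ 2 := fun α =>
    (norm_pow_le' _ (by norm_num)).trans (pow_le_pow_left₀ (norm_nonneg _) (hb α) 2)
  have hpsd : ∀ α, (Z α ^ 2).PosSemidef := fun α => by
    have := Matrix.posSemidef_conjTranspose_mul_self (Z α)
    rwa [(hZ α).eq, ← sq] at this
  have hint2 : Integrable (fun α => Z α ^ 2) μ :=
    Integrable.of_bound hmeas2 (b ^ 2) (Filter.Eventually.of_forall hb2)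
  -- The Khintchine bound involves the random matrix `∑ Z²`. Its summands are positive semidefinite,
  -- so its norm is controlled by the preceding result.
  have hD := integral_norm_sum_sub_le_of_posSemidef (κ := κ) hmeas2 hpsd hb2 hV hp hι
  set π := Measure.pi fun _ : κ => μ with hπ
  set M := (Fintype.card κ : ℝ) • ∫ α, Z α ^ 2 ∂μ with hM
  have hsum : Integrable (fun β : κ → S => ∑ i, Z (β i) ^ 2) π := by
    simpa using integrable_sum_comp_eval hint2 (fun _ : κ => (1 : ℝ))
  have hsub : Integrable (fun β : κ → S => ∑ i, Z (β i) ^ 2 - M) π :=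
    hsum.sub (integrable_const _)
  refine (integral_norm_sum_sub_le_signAvg hint).trans
    (mul_le_mul_of_nonneg_left ?_ (by norm_num))
  have h2 : ∫ β : κ → S, signAvg (fun ε => ‖signSum (fun i => Z (β i)) ε‖) ∂π ≤
      ∫ β : κ → S, √(6 * p * ‖∑ i, Z (β i) ^ 2‖) ∂π :=
    integral_mono (integrable_signAvg_norm_signSum hint)
      (integrable_sqrt (hsum.norm.const_mul _) fun _ => by positivity) fun β =>
      signAvg_norm_signSum_le (fun i => hZ (β i)) hp hι
  refine h2.trans ((integral_sqrt_le_sqrt_integral (hsum.norm.const_mul _)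
    (fun _ => by positivity) (integrable_sqrt (hsum.norm.const_mul _)
      fun _ => by positivity)).trans (Real.sqrt_le_sqrt ?_))
  rw [integral_const_mul]
  refine mul_le_mul_of_nonneg_left ?_ (by positivity)
  have : ∫ β : κ → S, ‖∑ i, Z (β i) ^ 2‖ ∂π ≤ ∫ β : κ → S, (‖M‖ + ‖∑ i, Z (β i) ^ 2 - M‖) ∂π :=
    integral_mono hsum.norm ((integrable_const _).add hsub.norm)
      fun β => by simpa using norm_add_le M (∑ i, Z (β i) ^ 2 - M)
  rw [integral_add (integrable_const _) hsub.norm] at this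
  simp only [integral_const, probReal_univ, one_smul] at this
  have hs := Real.sq_sqrt (show 0 ≤ 6 * p * b ^ 2 * V by positivity)
  have h6 : 2 * √(6 * p * b ^ 2 * V) ≤ V + 6 * p * b ^ 2 := by
    have h0 : (0 : ℝ) ≤ 6 * p * b ^ 2 := by positivity
    refine le_of_sq_le_sq ?_ (by positivity)
    nlinarith [sq_nonneg (V - 6 * p * b ^ 2)]
  linarith

end MatrixConcentration

/-! ### Second moments in a Hilbert space. -/

section Hilbert

variable {S κ E : Type*} [MeasurableSpace S] [Fintype κ] [DecidableEq κ] [NormedAddCommGroup E]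
  [InnerProductSpace ℝ E] {μ : Measure S} [IsProbabilityMeasure μ]

theorem signAvg_norm_signSum_sq (x : κ → E) :
    signAvg (fun ε => ‖signSum x ε‖ ^ 2) = ∑ i, ‖x i‖ ^ 2 := by
  have h1 : ∀ i j, i ≠ j → ∑ ε : κ → Bool, sgn (ε i) * sgn (ε j) = 0 := by
    intro i j hij
    have := sum_flipAt i fun ε : κ → Bool => sgn (ε i) * sgn (ε j)
    simp only [flipAt_same, flipAt_of_ne hij.symm, sgn_not, neg_mul, Finset.sum_neg_distrib] at this
    linarith
  have h2 : ∀ ε, ‖signSum x ε‖ ^ 2 =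
      ∑ i, ∑ j, sgn (ε i) * sgn (ε j) * inner ℝ (x i) (x j) := by
    intro ε
    rw [← real_inner_self_eq_norm_sq, signSum, sum_inner]
    refine Finset.sum_congr rfl fun i _ => ?_
    rw [inner_sum]
    refine Finset.sum_congr rfl fun j _ => ?_
    rw [real_inner_smul_left, real_inner_smul_right]
    ring
  have h3 : ∑ ε, ‖signSum x ε‖ ^ 2 = Fintype.card (κ → Bool) * ∑ i, ‖x i‖ ^ 2 := by
    simp only [h2]
    rw [Finset.sum_comm, Finset.mul_sum]
    refine Finset.sum_congr rfl fun i _ => ?_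
    rw [Finset.sum_comm, Finset.sum_eq_single i]
    · simp
    · intro j _ hj
      rw [← Finset.sum_mul, h1 i j hj.symm, zero_mul]
    · simp
  rw [signAvg, ← Finset.mul_sum, h3, ← mul_assoc, inv_mul_cancel₀, one_mul]
  exact Nat.cast_ne_zero.2 Fintype.card_ne_zero

/-- The expected deviation of a sum of independent vectors of a Hilbert space. -/
theorem integral_norm_sum_sub_le_of_inner [CompleteSpace E] {f : S → E}
    (hf : Integrable f μ) (hf2 : Integrable (fun α => ‖f α‖ ^ 2) μ) :
    ∫ β : κ → S, ‖∑ i, f (β i) - (Fintype.card κ : ℝ) • ∫ α, f α ∂μ‖ ∂(Measure.pi fun _ => μ) ≤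
      2 * √(Fintype.card κ * ∫ α, ‖f α‖ ^ 2 ∂μ) := by
  refine (integral_norm_sum_sub_le_signAvg hf).trans (mul_le_mul_of_nonneg_left ?_ (by norm_num))
  have hsum : Integrable (fun β : κ → S => ∑ i, ‖f (β i)‖ ^ 2) (Measure.pi fun _ => μ) := by
    simpa using integrable_sum_comp_eval hf2 (fun _ : κ => (1 : ℝ))
  have h0 : ∀ β : κ → S, 0 ≤ ∑ i, ‖f (β i)‖ ^ 2 := fun β => Finset.sum_nonneg fun i _ => sq_nonneg _
  calc _ ≤ ∫ β : κ → S, √(∑ i, ‖f (β i)‖ ^ 2) ∂(Measure.pi fun _ => μ) := by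
        refine integral_mono (integrable_signAvg_norm_signSum hf) (integrable_sqrt hsum h0)
          fun β => ?_
        refine signAvg_le_of_pow_le (fun _ => norm_nonneg _) two_ne_zero (Real.sqrt_nonneg _) ?_
        rw [signAvg_norm_signSum_sq, Real.sq_sqrt (h0 β)]
    _ ≤ √(∫ β : κ → S, ∑ i, ‖f (β i)‖ ^ 2 ∂(Measure.pi fun _ => μ)) :=
        integral_sqrt_le_sqrt_integral hsum h0 (integrable_sqrt hsum h0)
    _ = _ := by
        rw [integral_finsetSum _ fun i _ =>
          integrable_comp_eval (μ := fun _ : κ => μ) (i := i) hf2]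
        have : ∀ i : κ, ∫ β : κ → S, ‖f (β i)‖ ^ 2 ∂(Measure.pi fun _ => μ) =
            ∫ α, ‖f α‖ ^ 2 ∂μ := fun i =>
          integral_comp_eval (μ := fun _ : κ => μ) (i := i) hf2.1
        simp [this]

end Hilbert

end CompressedSensing

namespace CompressedSensing

set_option linter.unusedSectionVars false

/-! ### Bernstein's inequality. -/

section Bernstein

variable {S κ : Type*} [MeasurableSpace S] [Fintype κ] [DecidableEq κ] {μ : Measure S} [IsProbabilityMeasure μ]

theorem integral_exp_mul_le {ζ : S → ℝ} (hmeas : AEStronglyMeasurable ζ μ) {v θ : ℝ}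
    (hb : ∀ α, |θ * ζ α| ≤ 1) (hmean : ∫ α, ζ α ∂μ = 0) (hint : Integrable ζ μ)
    (hint2 : Integrable (fun α => ζ α ^ 2) μ) (hv : ∫ α, ζ α ^ 2 ∂μ ≤ v) :
    ∫ α, Real.exp (θ * ζ α) ∂μ ≤ Real.exp (θ ^ 2 * v) := by
  -- The bound `exp y ≤ 1 + y + y²` for `|y| ≤ 1`; the linear term has mean zero.
  have h1 : ∀ α, Real.exp (θ * ζ α) ≤ 1 + θ * ζ α + θ ^ 2 * ζ α ^ 2 := fun α => by
    have := (abs_le.1 (Real.abs_exp_sub_one_sub_id_le (hb α))).2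
    nlinarith
  have hi : Integrable (fun α => 1 + θ * ζ α + θ ^ 2 * ζ α ^ 2) μ :=
    ((integrable_const _).add (hint.const_mul _)).add (hint2.const_mul _)
  have hexp : Integrable (fun α => Real.exp (θ * ζ α)) μ := by
    refine Integrable.of_bound (Real.continuous_exp.comp_aestronglyMeasurable (hmeas.const_mul θ))
      (Real.exp 1) (Filter.Eventually.of_forall fun α => ?_)
    rw [Real.norm_eq_abs, Real.abs_exp]
    exact Real.exp_le_exp.2 ((le_abs_self _).trans (hb α))
  calc _ ≤ ∫ α, (1 + θ * ζ α + θ ^ 2 * ζ α ^ 2) ∂μ := integral_mono hexp hi h1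
    _ = 1 + θ ^ 2 * ∫ α, ζ α ^ 2 ∂μ := by
        have e1 : Integrable (fun α => 1 + θ * ζ α) μ :=
          (integrable_const _).add (hint.const_mul _)
        rw [integral_add e1 (hint2.const_mul _), integral_add (integrable_const _)
          (hint.const_mul _), integral_const_mul, integral_const_mul, hmean]
        simp
    _ ≤ θ ^ 2 * v + 1 := by nlinarith [sq_nonneg θ]
    _ ≤ _ := Real.add_one_le_exp _

theorem measureReal_le_sum_sub_le {ξ : S → ℝ} (hmeas : AEStronglyMeasurable ξ μ) {b v θ x : ℝ}
    (hb : ∀ α, |ξ α| ≤ b) (hv : ∫ α, ξ α ^ 2 ∂μ ≤ v) (hθ : 0 ≤ θ) (hθb : 2 * b * θ ≤ 1) :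
    (Measure.pi fun _ : κ => μ).real {β | x ≤ ∑ i, ξ (β i) - Fintype.card κ * ∫ α, ξ α ∂μ} ≤
      Real.exp (-θ * x + Fintype.card κ * (θ ^ 2 * v)) := by
  set e := ∫ α, ξ α ∂μ with he
  have hint : Integrable ξ μ := Integrable.of_bound hmeas b (Filter.Eventually.of_forall hb)
  have hint2 : Integrable (fun α => ξ α ^ 2) μ := by
    refine Integrable.of_bound ((continuous_pow 2).comp_aestronglyMeasurable hmeas) (b ^ 2)
      (Filter.Eventually.of_forall fun α => ?_)
    rw [norm_pow, Real.norm_eq_abs]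
    exact pow_le_pow_left₀ (abs_nonneg _) (hb α) 2
  have hcint : Integrable (fun α => ξ α - e) μ := hint.sub (integrable_const _)
  have hcint2 : Integrable (fun α => (ξ α - e) ^ 2) μ := by
    have : (fun α => (ξ α - e) ^ 2) = fun α => ξ α ^ 2 - 2 * e * ξ α + e ^ 2 := by
      funext α; ring
    rw [this]
    exact (hint2.sub (hint.const_mul _)).add (integrable_const _)
  have heb : |e| ≤ b := by
    refine (norm_integral_le_of_norm_le_const (f := ξ) (Filter.Eventually.of_forall hb)).trans ?_
    simp
  have hcv : ∫ α, (ξ α - e) ^ 2 ∂μ ≤ v := by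
    have : (fun α => (ξ α - e) ^ 2) = fun α => (ξ α ^ 2 - 2 * e * ξ α) + e ^ 2 := by
      funext α; ring
    rw [this]
    have i1 : Integrable (fun α => ξ α ^ 2 - 2 * e * ξ α) μ := hint2.sub (hint.const_mul _)
    rw [integral_add i1 (integrable_const _), integral_sub hint2 (hint.const_mul _),
      integral_const_mul, ← he]
    simp only [integral_const, probReal_univ, one_smul]
    nlinarith [sq_nonneg e]
  have hone : ∀ α, |θ * (ξ α - e)| ≤ 1 := fun α => by
    rw [abs_mul, abs_of_nonneg hθ]
    -- Centering may double the bound, which is why `2 b θ ≤ 1` is required.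
    have : |ξ α - e| ≤ 2 * b := by
      have := abs_sub (ξ α) e
      linarith [hb α]
    nlinarith
  have hmgf := integral_exp_mul_le hcint.1 hone
    (by rw [integral_sub hint (integrable_const _), ← he]; simp) hcint hcint2 hcv
  have hX : ∀ β : κ → S, ∑ i, ξ (β i) - Fintype.card κ * e = ∑ i, (ξ (β i) - e) := fun β => by
    simp [Finset.sum_sub_distrib]
  have hprod : ∀ β : κ → S, Real.exp (θ * ∑ i, (ξ (β i) - e)) =
      ∏ i, Real.exp (θ * (ξ (β i) - e)) := fun β => by
    rw [Finset.mul_sum, Real.exp_sum]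
  have hsumm : AEStronglyMeasurable (fun β : κ → S => ∑ i, (ξ (β i) - e))
      (Measure.pi fun _ : κ => μ) := by
    simpa using (integrable_sum_comp_eval hcint (fun _ : κ => (1 : ℝ))).1
  have hexp : Integrable (fun β : κ → S => Real.exp (θ * ∑ i, (ξ (β i) - e)))
      (Measure.pi fun _ : κ => μ) := by
    refine Integrable.of_bound (Real.continuous_exp.comp_aestronglyMeasurable
      (hsumm.const_mul θ)) (Real.exp (Fintype.card κ)) (Filter.Eventually.of_forall fun β => ?_)
    rw [Real.norm_eq_abs, Real.abs_exp, Finset.mul_sum]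
    refine Real.exp_le_exp.2 ((Finset.sum_le_sum fun i _ =>
      (le_abs_self _).trans (hone (β i))).trans ?_)
    simp
  have h := ProbabilityTheory.measure_ge_le_exp_mul_mgf (μ := Measure.pi fun _ : κ => μ)
    (X := fun β : κ → S => ∑ i, (ξ (β i) - e)) x hθ hexp
  simp only [hX]
  refine h.trans ?_
  rw [ProbabilityTheory.mgf, Real.exp_add]
  refine mul_le_mul_of_nonneg_left ?_ (Real.exp_pos _).le
  simp only [hprod]
  rw [integral_fintype_prod_eq_pow (fun α => Real.exp (θ * (ξ α - e))), ← nsmul_eq_mul,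
    Real.exp_nsmul]
  exact pow_le_pow_left₀ (integral_nonneg fun _ => (Real.exp_pos _).le) hmgf _

/-- **Bernstein's inequality** for a sum of bounded independent random variables. -/
theorem measureReal_le_abs_sum_sub_le {ξ : S → ℝ} (hmeas : AEStronglyMeasurable ξ μ) {b v θ x : ℝ}
    (hb : ∀ α, |ξ α| ≤ b) (hv : ∫ α, ξ α ^ 2 ∂μ ≤ v) (hθ : 0 ≤ θ) (hθb : 2 * b * θ ≤ 1) :
    (Measure.pi fun _ : κ => μ).real {β | x ≤ |∑ i, ξ (β i) - Fintype.card κ * ∫ α, ξ α ∂μ|} ≤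
      2 * Real.exp (-θ * x + Fintype.card κ * (θ ^ 2 * v)) := by
  have h1 := measureReal_le_sum_sub_le (κ := κ) (x := x) hmeas hb hv hθ hθb
  have h2 := measureReal_le_sum_sub_le (κ := κ) (ξ := fun α => -ξ α) (x := x) hmeas.neg
    (by simpa using hb) (by simpa using hv) hθ hθb
  have hsub : {β : κ → S | x ≤ |∑ i, ξ (β i) - Fintype.card κ * ∫ α, ξ α ∂μ|} ⊆
      {β | x ≤ ∑ i, ξ (β i) - Fintype.card κ * ∫ α, ξ α ∂μ} ∪
      {β | x ≤ ∑ i, -ξ (β i) - Fintype.card κ * ∫ α, -ξ α ∂μ} := by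
    intro β hβ
    rcases le_abs.1 (show x ≤ |_| from hβ) with h | h
    · exact Or.inl h
    · refine Or.inr ?_
      rw [Set.mem_ofPred_eq, Finset.sum_neg_distrib, integral_neg]
      linarith
  refine (measureReal_mono hsub).trans ((measureReal_union_le _ _).trans ?_)
  linarith

end Bernstein

/-! ### Quadratic forms in random signs. -/

section Chaos

variable {κ : Type*} [Fintype κ] [DecidableEq κ]

/-- The quadratic form of `a` at a vector of signs. -/
noncomputable def signQuad (a : Matrix κ κ ℝ) (ε : κ → Bool) : ℝ :=
  ∑ i, ∑ j, a i j * (sgn (ε i) * sgn (ε j))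

/-- The part of `∑ j, a i j ε j` that does not contain the sign `ε i`. -/
noncomputable def signGrad (a : Matrix κ κ ℝ) (i : κ) (ε : κ → Bool) : ℝ :=
  ∑ j, a i j * sgn (ε j) - a i i * sgn (ε i)

theorem sgn_flipAt (i j : κ) (ε : κ → Bool) :
    sgn (flipAt i ε j) = sgn (ε j) - if j = i then 2 * sgn (ε i) else 0 := by
  split_ifs with h
  · subst h; rw [flipAt_same, sgn_not]; ring
  · rw [flipAt_of_ne h, sub_zero]

theorem signGrad_flipAt (a : Matrix κ κ ℝ) (i : κ) (ε : κ → Bool) :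
    signGrad a i (flipAt i ε) = signGrad a i ε := by
  simp only [signGrad, sgn_flipAt, mul_sub, mul_ite, mul_zero, Finset.sum_sub_distrib,
    Finset.sum_ite_eq', Finset.mem_univ, if_true]
  ring

theorem signQuad_sub_flipAt {a : Matrix κ κ ℝ} (ha : a.IsSymm) (i : κ) (ε : κ → Bool) :
    signQuad a ε - signQuad a (flipAt i ε) = 4 * (sgn (ε i) * signGrad a i ε) := by
  have h1 : ∑ j, a j i * sgn (ε j) = ∑ j, a i j * sgn (ε j) :=
    Finset.sum_congr rfl fun j _ => by rw [ha.apply]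
  have h2 : signQuad a (flipAt i ε) = signQuad a ε - 2 * sgn (ε i) * ∑ j, a i j * sgn (ε j)
      - 2 * sgn (ε i) * ∑ j, a j i * sgn (ε j) + 4 * (sgn (ε i) * sgn (ε i)) * a i i := by
    simp only [signQuad, sgn_flipAt]
    have : ∀ j k, a j k * ((sgn (ε j) - if j = i then 2 * sgn (ε i) else 0) *
        (sgn (ε k) - if k = i then 2 * sgn (ε i) else 0)) = a j k * (sgn (ε j) * sgn (ε k))
        - (if j = i then 2 * sgn (ε i) * (a j k * sgn (ε k)) else 0)
        - (if k = i then 2 * sgn (ε i) * (a j k * sgn (ε j)) else 0)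
        + (if j = i then if k = i then 4 * (sgn (ε i) * sgn (ε i)) * a j k else 0 else 0) := by
      intro j k; split_ifs <;> ring
    simp only [this, Finset.sum_add_distrib, Finset.sum_sub_distrib, Finset.sum_ite_eq',
      Finset.mem_univ, if_true, Finset.mul_sum]
    congr 1
    · congr 1
      congr 1
      rw [Finset.sum_comm]
      simp
    · rw [Finset.sum_comm]
      simp
  rw [h2, h1, signGrad, sgn_mul_self]
  linear_combination 4 * a i i * sgn_mul_self (ε i)

variable {a : Matrix κ κ ℝ}

theorem signQuad_sub_trace (ε : κ → Bool) :
    signQuad a ε - ∑ i, a i i = ∑ i, sgn (ε i) * signGrad a i ε := by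
  simp only [signQuad, signGrad, mul_sub, Finset.sum_sub_distrib, Finset.mul_sum]
  congr 1
  · exact Finset.sum_congr rfl fun i _ => Finset.sum_congr rfl fun j _ => by ring
  · exact Finset.sum_congr rfl fun i _ => by linear_combination -a i i * sgn_mul_self (ε i)

/-- The hypothesis says that the form of `a² ` is at most that of `a`, as for a projection. It
bounds the squared gradient by the quadratic form itself, which closes the moment recursion without
any information on `a` beyond its trace. -/
theorem sum_signGrad_sq_le
    (h : ∀ x : κ → ℝ, ∑ i, (∑ j, a i j * x j) ^ 2 ≤ ∑ i, ∑ j, a i j * (x i * x j))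
    (ε : κ → Bool) :
    ∑ i, signGrad a i ε ^ 2 ≤ 4 * ∑ i, a i i + 2 * (signQuad a ε - ∑ i, a i i) := by
  have h1 := h fun j => sgn (ε j)
  -- The hypothesis is tested on a coordinate vector.
  have h2 : ∀ i, a i i ^ 2 ≤ a i i := by
    intro i
    have := h (Pi.single i 1)
    simp only [Pi.single_apply, mul_ite, mul_one, mul_zero,
      Finset.sum_ite_eq', Finset.mem_univ, if_true] at this
    refine (Finset.single_le_sum (f := fun k => a k i ^ 2) (fun k _ => sq_nonneg _)
      (Finset.mem_univ i)).trans this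
  have h3 : ∑ i, signGrad a i ε ^ 2 ≤
      ∑ i, (2 * (∑ j, a i j * sgn (ε j)) ^ 2 + 2 * a i i) := by
    refine Finset.sum_le_sum fun i _ => ?_
    have e : (a i i * sgn (ε i)) ^ 2 = a i i ^ 2 := by rw [mul_pow, sq (sgn _), sgn_mul_self, mul_one]
    rw [signGrad]
    nlinarith [h2 i, sq_nonneg (∑ j, a i j * sgn (ε j) + a i i * sgn (ε i))]
  rw [Finset.sum_add_distrib, ← Finset.mul_sum, ← Finset.mul_sum] at h3
  rw [signQuad]
  linarith

/-- The scalar analogue of the exchangeable-pair recursion. Flipping sign `i` changes the form by `4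
ε i` times a gradient that does not involve `ε i`. -/
theorem sum_signQuad_sub_pow_le (ha : a.IsSymm)
    (h : ∀ x : κ → ℝ, ∑ i, (∑ j, a i j * x j) ^ 2 ≤ ∑ i, ∑ j, a i j * (x i * x j)) (p : ℕ) :
    ∑ ε, (signQuad a ε - ∑ i, a i i) ^ (2 * p + 2) ≤
      (16 * (2 * p + 1) * (∑ i, a i i) + 16 * (2 * p + 1) ^ 2) *
        ∑ ε, (signQuad a ε - ∑ i, a i i) ^ (2 * p) := by
  set r := ∑ i, a i i with hr
  set Q : (κ → Bool) → ℝ := fun ε => signQuad a ε - r with hQ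
  have hQf : ∀ i ε, Q ε - Q (flipAt i ε) = 4 * (sgn (ε i) * signGrad a i ε) := fun i ε => by
    rw [← signQuad_sub_flipAt ha]; simp [hQ]
  have h1 : ∀ i, ∑ ε, sgn (ε i) * signGrad a i ε * Q ε ^ (2 * p + 1) ≤
      2 * (2 * (p : ℝ) + 1) * ∑ ε, signGrad a i ε ^ 2 * Q ε ^ (2 * p) := by
    intro i
    have e1 : 2 * ∑ ε, sgn (ε i) * signGrad a i ε * Q ε ^ (2 * p + 1) =
        ∑ ε, (1 / 4) * ((Q ε - Q (flipAt i ε)) *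
          (Q ε ^ (2 * p + 1) - Q (flipAt i ε) ^ (2 * p + 1))) := by
      rw [two_mul]
      nth_rewrite 2 [← sum_flipAt i]
      rw [← Finset.sum_add_distrib]
      refine Finset.sum_congr rfl fun ε _ => ?_
      rw [hQf, flipAt_same, sgn_not, signGrad_flipAt]
      ring
    have e2 : ∑ ε, signGrad a i ε ^ 2 * Q (flipAt i ε) ^ (2 * p) =
        ∑ ε, signGrad a i ε ^ 2 * Q ε ^ (2 * p) := by
      rw [← sum_flipAt i fun ε => signGrad a i ε ^ 2 * Q ε ^ (2 * p)]
      exact Finset.sum_congr rfl fun ε _ => by rw [signGrad_flipAt]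
    have e3 : 2 * ∑ ε, sgn (ε i) * signGrad a i ε * Q ε ^ (2 * p + 1) ≤
        ∑ ε, 2 * (2 * (p : ℝ) + 1) * (signGrad a i ε ^ 2 * Q ε ^ (2 * p) +
          signGrad a i ε ^ 2 * Q (flipAt i ε) ^ (2 * p)) := by
      rw [e1]
      refine Finset.sum_le_sum fun ε _ => ?_
      have := sub_mul_pow_sub_pow_le (Q ε) (Q (flipAt i ε)) (even_two_mul p)
      have e4 : (Q ε - Q (flipAt i ε)) ^ 2 = 16 * signGrad a i ε ^ 2 := by
        rw [hQf, mul_pow, mul_pow, sq (sgn _), sgn_mul_self]; ring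
      rw [e4] at this
      push_cast at this
      linarith
    rw [← Finset.mul_sum, Finset.sum_add_distrib, e2] at e3
    linarith
  have h2 : ∑ ε, Q ε ^ (2 * p + 2) ≤
      ∑ ε, 2 * (2 * (p : ℝ) + 1) * ((4 * r + 2 * Q ε) * Q ε ^ (2 * p)) := by
    calc ∑ ε, Q ε ^ (2 * p + 2)
        = ∑ i, ∑ ε, sgn (ε i) * signGrad a i ε * Q ε ^ (2 * p + 1) := by
          rw [Finset.sum_comm]
          refine Finset.sum_congr rfl fun ε _ => ?_
          rw [← Finset.sum_mul, ← signQuad_sub_trace, pow_succ' _ (2 * p + 1)]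
      _ ≤ ∑ i, 2 * (2 * (p : ℝ) + 1) * ∑ ε, signGrad a i ε ^ 2 * Q ε ^ (2 * p) :=
          Finset.sum_le_sum fun i _ => h1 i
      _ = ∑ ε, 2 * (2 * (p : ℝ) + 1) * ((∑ i, signGrad a i ε ^ 2) * Q ε ^ (2 * p)) := by
          rw [← Finset.mul_sum, Finset.sum_comm, Finset.mul_sum]
          exact Finset.sum_congr rfl fun ε _ => by rw [← Finset.sum_mul]
      _ ≤ _ := by
          refine Finset.sum_le_sum fun ε _ => mul_le_mul_of_nonneg_left
            (mul_le_mul_of_nonneg_right (sum_signGrad_sq_le h ε)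
              ((even_two_mul p).pow_nonneg _)) (by positivity)
  -- The term linear in `Q` is split by the arithmetic-geometric mean inequality, so that half of
  -- the left-hand side can be absorbed.
  have h3 : ∑ ε, 2 * (2 * (p : ℝ) + 1) * ((4 * r + 2 * Q ε) * Q ε ^ (2 * p)) ≤
      ∑ ε, ((8 * (2 * (p : ℝ) + 1) * r + 8 * (2 * (p : ℝ) + 1) ^ 2) * Q ε ^ (2 * p) +
        1 / 2 * Q ε ^ (2 * p + 2)) := by
    refine Finset.sum_le_sum fun ε _ => ?_
    have h0 : 0 ≤ Q ε ^ (2 * p) := (even_two_mul p).pow_nonneg _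
    have := mul_nonneg (sq_nonneg (Q ε - 4 * (2 * (p : ℝ) + 1))) h0
    rw [pow_add _ (2 * p) 2]
    nlinarith
  have h4 := h2.trans h3
  rw [Finset.sum_add_distrib, ← Finset.mul_sum, ← Finset.mul_sum] at h4
  simp only [hQ] at h4
  linarith

/-- Moments of the Rademacher chaos of a projection. -/
theorem signAvg_signQuad_sub_pow_le (ha : a.IsSymm)
    (h : ∀ x : κ → ℝ, ∑ i, (∑ j, a i j * x j) ^ 2 ≤ ∑ i, ∑ j, a i j * (x i * x j))
    (hr : 1 ≤ ∑ i, a i i) (q p : ℕ) (hp : p ≤ q) :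
    signAvg (fun ε => (signQuad a ε - ∑ i, a i i) ^ (2 * p)) ≤
      (128 * q ^ 2 * ∑ i, a i i) ^ p := by
  induction p with
  | zero => simp [signAvg_const]
  | succ p ih =>
    have ih := ih (by omega)
    have h1 : signAvg (fun ε => (signQuad a ε - ∑ i, a i i) ^ (2 * (p + 1))) ≤
        (16 * (2 * p + 1) * (∑ i, a i i) + 16 * (2 * p + 1) ^ 2) *
          signAvg (fun ε => (signQuad a ε - ∑ i, a i i) ^ (2 * p)) := by
      rw [signAvg, signAvg, ← Finset.mul_sum, ← Finset.mul_sum, mul_left_comm]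
      exact mul_le_mul_of_nonneg_left (sum_signQuad_sub_pow_le ha h p) (by positivity)
    have h0 : 0 ≤ signAvg (fun ε => (signQuad a ε - ∑ i, a i i) ^ (2 * p)) :=
      Finset.sum_nonneg fun ε _ => mul_nonneg (by positivity) ((even_two_mul p).pow_nonneg _)
    have hpq : (p + 1 : ℝ) ≤ q := by exact_mod_cast hp
    have hp0 : (0 : ℝ) ≤ p := p.cast_nonneg
    have h2 : 16 * (2 * p + 1) * (∑ i, a i i) + 16 * (2 * p + 1) ^ 2 ≤
        128 * (q : ℝ) ^ 2 * ∑ i, a i i := by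
      have e1 : (2 * p + 1 : ℝ) ≤ 2 * q := by linarith
      have e2 : (2 * p + 1 : ℝ) ^ 2 ≤ (2 * q) ^ 2 := pow_le_pow_left₀ (by positivity) e1 2
      have e3 : (2 * p + 1 : ℝ) ≤ 4 * q ^ 2 := by nlinarith
      nlinarith [mul_le_mul_of_nonneg_right e3 (by linarith : (0 : ℝ) ≤ ∑ i, a i i),
        mul_le_mul_of_nonneg_left hr (by positivity : (0 : ℝ) ≤ 64 * (q : ℝ) ^ 2)]
    calc _ ≤ _ := h1
      _ ≤ _ := mul_le_mul h2 ih h0 (by positivity)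
      _ = _ := by ring

/-- Markov's inequality for the moment of order `2 p`. The threshold squares to `400 p² r`, the
moment bound has `128 p² r`, and `128 / 400 < 1 / e`. -/
theorem signAvg_indicator_le (ha : a.IsSymm)
    (h : ∀ x : κ → ℝ, ∑ i, (∑ j, a i j * x j) ^ 2 ≤ ∑ i, ∑ j, a i j * (x i * x j))
    (hr : 1 ≤ ∑ i, a i i) {p : ℕ} (hp : p ≠ 0) :
    signAvg (fun ε => if 20 * p * √(∑ i, a i i) ≤ |signQuad a ε - ∑ i, a i i| then 1 else 0) ≤
      Real.exp (-p) := by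
  set r := ∑ i, a i i with hr'
  have hr0 : 0 < r := by linarith
  have hp0 : (0 : ℝ) < p := by exact_mod_cast Nat.pos_of_ne_zero hp
  have h1 : signAvg (fun ε => if 20 * p * √r ≤ |signQuad a ε - r| then 1 else 0) ≤
      signAvg fun ε => (400 * p ^ 2 * r)⁻¹ ^ p * (signQuad a ε - r) ^ (2 * p) := by
    refine signAvg_mono fun ε => ?_
    split_ifs with hε
    · have : (400 * (p : ℝ) ^ 2 * r) ^ p ≤ (signQuad a ε - r) ^ (2 * p) := by
        rw [← (even_two_mul p).pow_abs, pow_mul]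
        refine pow_le_pow_left₀ (by positivity) ?_ p
        calc 400 * (p : ℝ) ^ 2 * r = (20 * p * √r) ^ 2 := by
              rw [mul_pow, Real.sq_sqrt hr0.le]; ring
          _ ≤ _ := pow_le_pow_left₀ (by positivity) hε 2
      rw [inv_pow, inv_mul_eq_div, le_div_iff₀ (by positivity), one_mul]
      exact this
    · exact mul_nonneg (by positivity) ((even_two_mul p).pow_nonneg _)
  refine h1.trans ?_
  have h2 := signAvg_signQuad_sub_pow_le ha h hr p p le_rfl
  rw [← hr'] at h2
  clear_value r
  have h3 : signAvg (fun ε => (400 * p ^ 2 * r)⁻¹ ^ p * (signQuad a ε - r) ^ (2 * p)) =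
      (400 * p ^ 2 * r)⁻¹ ^ p * signAvg fun ε => (signQuad a ε - r) ^ (2 * p) := by
    rw [signAvg, signAvg, Finset.mul_sum]
    exact Finset.sum_congr rfl fun ε _ => by ring
  rw [h3]
  calc _ ≤ (400 * p ^ 2 * r)⁻¹ ^ p * (128 * p ^ 2 * r) ^ p :=
        mul_le_mul_of_nonneg_left h2 (by positivity)
    _ = (128 / 400) ^ p := by
        rw [← mul_pow]; congr 1; field_simp
    _ ≤ (Real.exp (-1)) ^ p := by
        refine pow_le_pow_left₀ (by norm_num) ?_ p
        rw [Real.exp_neg, le_inv_comm₀ (by norm_num) (Real.exp_pos 1)]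
        linarith [Real.exp_one_lt_d9]
    _ = _ := by rw [← Real.exp_nat_mul]; ring_nf

end Chaos

end CompressedSensing

namespace CompressedSensing

open scoped Matrix.Norms.L2Operator

/-! ### Hilbert-Schmidt, operator and trace norms. -/

section MatrixNorms

variable {n : ℕ}

/-- A matrix as a vector of the Hilbert space with the Hilbert-Schmidt scalar product. -/
noncomputable def hsVec : Matrix (Fin n) (Fin n) ℂ →ₗ[ℂ] EuclideanSpace ℂ (Fin n × Fin n) where
  toFun A := WithLp.toLp 2 fun p => A p.1 p.2
  map_add' _ _ := rfl
  map_smul' _ _ := rfl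

@[simp] theorem hsVec_apply (A : Matrix (Fin n) (Fin n) ℂ) (p : Fin n × Fin n) : hsVec A p = A p.1 p.2 := rfl

theorem inner_hsVec (A B : Matrix (Fin n) (Fin n) ℂ) : inner ℂ (hsVec A) (hsVec B) = hsInner A B := by
  rw [PiLp.inner_apply, hsInner, Matrix.trace, Fintype.sum_prod_type, Finset.sum_comm]
  refine Finset.sum_congr rfl fun j _ => ?_
  rw [Matrix.diag, Matrix.mul_apply]
  refine Finset.sum_congr rfl fun i _ => ?_
  simp [Matrix.conjTranspose_apply, mul_comm]

/-- The Hilbert-Schmidt norm. -/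
noncomputable def hsNorm (A : Matrix (Fin n) (Fin n) ℂ) : ℝ := ‖hsVec A‖

/-- The real part of the Hilbert-Schmidt scalar product. -/
noncomputable def ip (A B : Matrix (Fin n) (Fin n) ℂ) : ℝ := (hsInner A B).re

theorem ip_eq_inner (A B : Matrix (Fin n) (Fin n) ℂ) : ip A B = (inner ℂ (hsVec A) (hsVec B)).re := by
  rw [inner_hsVec, ip]

theorem ip_comm (A B : Matrix (Fin n) (Fin n) ℂ) : ip A B = ip B A := by
  rw [ip_eq_inner, ip_eq_inner, ← inner_conj_symm, Complex.conj_re]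

theorem ip_self (A : Matrix (Fin n) (Fin n) ℂ) : ip A A = hsNorm A ^ 2 := by
  rw [ip_eq_inner, hsNorm, inner_self_eq_norm_sq_to_K]
  norm_cast

theorem abs_ip_le (A B : Matrix (Fin n) (Fin n) ℂ) : |ip A B| ≤ hsNorm A * hsNorm B := by
  rw [ip_eq_inner]
  exact (Complex.abs_re_le_norm _).trans (norm_inner_le_norm _ _)

theorem ip_add_right (A B C : Matrix (Fin n) (Fin n) ℂ) : ip A (B + C) = ip A B + ip A C := by
  simp [ip, hsInner, Matrix.mul_add]

theorem ip_sub_right (A B C : Matrix (Fin n) (Fin n) ℂ) : ip A (B - C) = ip A B - ip A C := by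
  simp [ip, hsInner, Matrix.mul_sub]

theorem ip_smul_right (c : ℝ) (A B : Matrix (Fin n) (Fin n) ℂ) : ip A (c • B) = c * ip A B := by
  simp [ip, hsInner]

theorem ip_sum_right {κ : Type*} (s : Finset κ) (A : Matrix (Fin n) (Fin n) ℂ) (B : κ → Matrix (Fin n) (Fin n) ℂ) :
    ip A (∑ i ∈ s, B i) = ∑ i ∈ s, ip A (B i) := by
  simp [ip, hsInner, Matrix.mul_sum, Matrix.trace_sum]

theorem hsNorm_nonneg (A : Matrix (Fin n) (Fin n) ℂ) : 0 ≤ hsNorm A := norm_nonneg _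

theorem hsNorm_add_le (A B : Matrix (Fin n) (Fin n) ℂ) : hsNorm (A + B) ≤ hsNorm A + hsNorm B := by
  simpa [hsNorm] using norm_add_le (hsVec A) (hsVec B)

theorem hsNorm_smul (c : ℝ) (A : Matrix (Fin n) (Fin n) ℂ) : hsNorm (c • A) = |c| * hsNorm A := by
  have : c • A = (c : ℂ) • A := by ext; simp
  rw [hsNorm, this, map_smul, norm_smul, Complex.norm_real, Real.norm_eq_abs, hsNorm]

theorem hsVec_injective : Function.Injective (hsVec (n := n)) := by
  intro A B h
  ext i j
  exact congrArg (fun v => v.ofLp (i, j)) h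

theorem hsNorm_eq_zero {A : Matrix (Fin n) (Fin n) ℂ} : hsNorm A = 0 ↔ A = 0 := by
  rw [hsNorm, norm_eq_zero, ← map_zero hsVec, hsVec_injective.eq_iff]

theorem hsNorm_sq_eq_sum (A : Matrix (Fin n) (Fin n) ℂ) : hsNorm A ^ 2 = ∑ i, ∑ j, ‖A i j‖ ^ 2 := by
  rw [hsNorm, EuclideanSpace.norm_sq_eq, Fintype.sum_prod_type]
  rfl

theorem norm_entry_le_hsNorm (A : Matrix (Fin n) (Fin n) ℂ) (i j : Fin n) : ‖A i j‖ ≤ hsNorm A :=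
  PiLp.norm_apply_le (hsVec A) (i, j)

theorem hsInner_eq_ip {A B : Matrix (Fin n) (Fin n) ℂ} (hA : A.IsHermitian) (hB : B.IsHermitian) :
    hsInner A B = (ip A B : ℂ) := by
  refine (Complex.conj_eq_iff_re.1 ?_).symm
  rw [hsInner, ← Complex.star_def, ← Matrix.trace_conjTranspose, Matrix.conjTranspose_mul, hA.eq,
    hB.eq, hA.eq, Matrix.trace_mul_comm]

theorem ip_eq_re_trace {A : Matrix (Fin n) (Fin n) ℂ} (hA : A.IsHermitian) (B : Matrix (Fin n) (Fin n) ℂ) :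
    ip A B = (Matrix.trace (A * B)).re := by
  rw [ip, hsInner, hA.eq]

theorem l2norm_le_hsNorm (A : Matrix (Fin n) (Fin n) ℂ) : ‖A‖ ≤ hsNorm A := by
  rw [Matrix.l2_opNorm_def]
  refine ContinuousLinearMap.opNorm_le_bound _ (hsNorm_nonneg _) fun x => ?_
  refine le_of_sq_le_sq ?_ (mul_nonneg (hsNorm_nonneg _) (norm_nonneg _))
  rw [mul_pow, hsNorm_sq_eq_sum, EuclideanSpace.norm_sq_eq, EuclideanSpace.norm_sq_eq,
    Finset.sum_mul]
  refine Finset.sum_le_sum fun i _ => ?_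
  have h := norm_sum_le Finset.univ fun j => A i j * x j
  simp only [norm_mul] at h
  have h2 := pow_le_pow_left₀ (norm_nonneg _) h 2
  refine h2.trans ?_
  exact Finset.sum_mul_sq_le_sq_mul_sq _ _ _

/-- For Hermitian `A` one has `A† A = A²`, so the squared singular values and the squared
eigenvalues are the roots of one characteristic polynomial. Comparing multisets avoids matching the
two orderings. -/
theorem traceNorm_eq_sum_abs {A : Matrix (Fin n) (Fin n) ℂ} (hA : A.IsHermitian) :
    traceNorm A = ∑ i, |hA.eigenvalues i| := by
  set T := Matrix.toEuclideanLin A with hT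
  have hfin : Module.finrank ℂ (EuclideanSpace ℂ (Fin n)) = n := by simp
  have h1 : traceNorm A = ∑ i : Fin n, √(T.isSymmetric_adjoint_comp_self.eigenvalues hfin i) :=
    Finset.sum_congr rfl fun i _ => T.singularValues_fin hfin i
  have h2 : LinearMap.adjoint T ∘ₗ T = Matrix.toEuclideanLin (A ^ 2) := by
    rw [hT, ← Matrix.toEuclideanLin_conjTranspose_eq_adjoint, hA.eq, sq, Matrix.toLpLin_mul_same]
  have h3 : (LinearMap.adjoint T ∘ₗ T).charpoly = (A ^ 2).charpoly := by
    rw [h2, Matrix.toEuclideanLin_eq_toLin_orthonormal, ← LinearMap.charpoly_toMatrix _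
      (EuclideanSpace.basisFun (Fin n) ℂ).toBasis, LinearMap.toMatrix_toLin]
  have h4 := T.isSymmetric_adjoint_comp_self.roots_charpoly_eq_eigenvalues hfin
  have h5 : (A ^ 2).charpoly.roots =
      Multiset.map (fun i => ((hA.eigenvalues i ^ 2 : ℝ) : ℂ)) Finset.univ.val := by
    obtain ⟨U, hU, hAU⟩ := exists_unitary_diagonal hA
    have h6 := pow_unitary_diagonal hU (fun i => (hA.eigenvalues i : ℂ)) 2
    rw [← hAU] at h6
    simp only [← Complex.ofReal_pow] at h6
    rw [h6, Matrix.charpoly_mul_comm, ← mul_assoc, Matrix.mem_unitaryGroup_iff'.1 hU, one_mul,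
      Matrix.charpoly_diagonal, Polynomial.roots_prod]
    · simp only [Polynomial.roots_X_sub_C, Multiset.bind_singleton]
    · exact Finset.prod_ne_zero_iff.2 fun i _ => Polynomial.X_sub_C_ne_zero _
  rw [h3, h5] at h4
  have h7 := congrArg (fun s => (Multiset.map (fun z : ℂ => √z.re) s).sum) h4
  simp only [Multiset.map_map, Function.comp_def, Complex.ofReal_re, Real.sqrt_sq_eq_abs] at h7
  rw [h1]
  exact h7.symm

theorem norm_entry_le_l2norm (M : Matrix (Fin n) (Fin n) ℂ) (i j : Fin n) : ‖M i j‖ ≤ ‖M‖ := by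
  have h := norm_star_dotProduct_mulVec_le M (EuclideanSpace.single i 1) (EuclideanSpace.single j 1)
  simpa using h

theorem norm_unitary_conj {U : Matrix (Fin n) (Fin n) ℂ} (hU : U ∈ Matrix.unitaryGroup (Fin n) ℂ) (D : Matrix (Fin n) (Fin n) ℂ) :
    ‖U * D * star U‖ = ‖D‖ := by
  have e1 := CStarRing.norm_coe_unitary_mul (⟨U, hU⟩ : Matrix.unitaryGroup (Fin n) ℂ) (D * star U)
  have e2 := CStarRing.norm_mul_coe_unitary D (star (⟨U, hU⟩ : Matrix.unitaryGroup (Fin n) ℂ))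
  simp only [Unitary.coe_star] at e1 e2
  rw [mul_assoc, e1, e2]

theorem abs_re_trace_mul_le (V : Matrix (Fin n) (Fin n) ℂ) {A : Matrix (Fin n) (Fin n) ℂ} (hA : A.IsHermitian) :
    |(Matrix.trace (V * A)).re| ≤ ‖V‖ * traceNorm A := by
  obtain ⟨U, hU, hAU⟩ := exists_unitary_diagonal hA
  have hU' : star U ∈ Matrix.unitaryGroup (Fin n) ℂ := Unitary.star_mem hU
  have h1 : Matrix.trace (V * A) = ∑ i, (star U * V * star (star U)) i i * hA.eigenvalues i := by
    conv_lhs => rw [hAU]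
    rw [← mul_assoc, ← mul_assoc, Matrix.trace_mul_comm, ← mul_assoc, ← mul_assoc, star_star,
      Matrix.trace]
    simp [Matrix.mul_diagonal]
  rw [h1, traceNorm_eq_sum_abs hA, Finset.mul_sum]
  refine (Complex.abs_re_le_norm _).trans ((norm_sum_le _ _).trans
    (Finset.sum_le_sum fun i _ => ?_))
  rw [norm_mul, Complex.norm_real, Real.norm_eq_abs]
  refine mul_le_mul_of_nonneg_right ((norm_entry_le_l2norm _ i i).trans ?_) (abs_nonneg _)
  rw [norm_unitary_conj hU']

theorem traceNorm_nonneg {A : Matrix (Fin n) (Fin n) ℂ} (hA : A.IsHermitian) : 0 ≤ traceNorm A := by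
  rw [traceNorm_eq_sum_abs hA]
  exact Finset.sum_nonneg fun i _ => abs_nonneg _

theorem hsNorm_le_traceNorm {A : Matrix (Fin n) (Fin n) ℂ} (hA : A.IsHermitian) : hsNorm A ≤ traceNorm A := by
  rcases (hsNorm_nonneg A).eq_or_lt with h | h
  · rw [← h]; exact traceNorm_nonneg hA
  · have h1 : hsNorm A ^ 2 ≤ hsNorm A * traceNorm A := by
      rw [← ip_self, ip_eq_re_trace hA]
      exact (le_abs_self _).trans ((abs_re_trace_mul_le A hA).trans
        (mul_le_mul_of_nonneg_right (l2norm_le_hsNorm A) (traceNorm_nonneg hA)))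
    nlinarith

theorem traceNorm_of_posSemidef {A : Matrix (Fin n) (Fin n) ℂ} (hA : A.PosSemidef) : traceNorm A = (A.trace).re := by
  rw [traceNorm_eq_sum_abs hA.1, hA.1.trace_eq_sum_eigenvalues, Complex.re_sum]
  refine Finset.sum_congr rfl fun i _ => ?_
  rw [abs_of_nonneg (hA.eigenvalues_nonneg i)]
  rfl

theorem exists_norm_le_one_trace_eq {A : Matrix (Fin n) (Fin n) ℂ} (hA : A.IsHermitian) :
    ∃ V : Matrix (Fin n) (Fin n) ℂ, ‖V‖ ≤ 1 ∧ (Matrix.trace (V * A)).re = traceNorm A := by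
  obtain ⟨U, hU, hAU⟩ := exists_unitary_diagonal hA
  -- The witness is the sign of `A` in the functional calculus.
  refine ⟨U * Matrix.diagonal (fun i => ((SignType.sign (hA.eigenvalues i) : ℝ) : ℂ)) * star U,
    ?_, ?_⟩
  · rw [norm_unitary_conj hU, Matrix.l2_opNorm_diagonal]
    refine (pi_norm_le_iff_of_nonneg zero_le_one).2 fun i => ?_
    rcases lt_trichotomy (hA.eigenvalues i) 0 with h | h | h <;> simp [h]
  · have : U * Matrix.diagonal (fun i => ((SignType.sign (hA.eigenvalues i) : ℝ) : ℂ)) * star U *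
        (U * Matrix.diagonal (fun i => (hA.eigenvalues i : ℂ)) * star U) =
        U * Matrix.diagonal (fun i => ((|hA.eigenvalues i| : ℝ) : ℂ)) * star U := by
      simp only [mul_assoc]
      rw [← mul_assoc (star U) U, Matrix.mem_unitaryGroup_iff'.1 hU, one_mul,
        ← mul_assoc (Matrix.diagonal _) (Matrix.diagonal _), Matrix.diagonal_mul_diagonal]
      simp only [← Complex.ofReal_mul, sign_mul_self]
    rw [← hAU] at this
    rw [this, Matrix.trace_mul_comm, ← mul_assoc, Matrix.mem_unitaryGroup_iff'.1 hU, one_mul,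
      Matrix.trace_diagonal, Complex.re_sum, traceNorm_eq_sum_abs hA]
    simp

end MatrixNorms

/-! ### Tangent space at a projection and dual certificates. -/

section Tangent

variable {n : ℕ}

/-- An orthogonal projection. -/
structure IsProj (P : Matrix (Fin n) (Fin n) ℂ) : Prop where
  herm : P.IsHermitian
  idem : P * P = P

/-- The projection onto the tangent space at `P`. -/
def tang (P X : Matrix (Fin n) (Fin n) ℂ) : Matrix (Fin n) (Fin n) ℂ := P * X + X * P - P * X * P

/-- The compression to the orthogonal complement of the range of `P`. -/
def perp (P X : Matrix (Fin n) (Fin n) ℂ) : Matrix (Fin n) (Fin n) ℂ := (1 - P) * X * (1 - P)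

variable {P : Matrix (Fin n) (Fin n) ℂ}

theorem tang_add_perp (P X : Matrix (Fin n) (Fin n) ℂ) : tang P X + perp P X = X := by
  simp only [tang, perp]; noncomm_ring

theorem tang_add (P X Y : Matrix (Fin n) (Fin n) ℂ) : tang P (X + Y) = tang P X + tang P Y := by
  simp only [tang]; noncomm_ring

theorem tang_sub (P X Y : Matrix (Fin n) (Fin n) ℂ) : tang P (X - Y) = tang P X - tang P Y := by
  simp only [tang]; noncomm_ring

theorem perp_add (P X Y : Matrix (Fin n) (Fin n) ℂ) : perp P (X + Y) = perp P X + perp P Y := by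
  simp only [perp]; noncomm_ring

theorem perp_sub (P X Y : Matrix (Fin n) (Fin n) ℂ) : perp P (X - Y) = perp P X - perp P Y := by
  simp only [perp]; noncomm_ring

theorem tang_smul (c : ℝ) (P X : Matrix (Fin n) (Fin n) ℂ) : tang P (c • X) = c • tang P X := by
  simp [tang, smul_add, smul_sub]

theorem IsProj.compl (hP : IsProj P) : IsProj (1 - P) where
  herm := Matrix.isHermitian_one.sub hP.herm
  idem := by rw [mul_sub, sub_mul, sub_mul, hP.idem]; simp

theorem IsProj.tang_tang (hP : IsProj P) (X : Matrix (Fin n) (Fin n) ℂ) : tang P (tang P X) = tang P X := by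
  have h1 : ∀ Z : Matrix (Fin n) (Fin n) ℂ, P * (P * Z) = P * Z := fun Z => by rw [← mul_assoc, hP.idem]
  simp only [tang, mul_add, add_mul, mul_sub, sub_mul, mul_assoc, hP.idem, h1]
  abel

theorem IsProj.perp_tang (hP : IsProj P) (X : Matrix (Fin n) (Fin n) ℂ) : perp P (tang P X) = 0 := by
  have h := tang_add_perp P (tang P X)
  rw [hP.tang_tang] at h
  exact left_eq_add.1 h.symm

theorem IsProj.tang_perp (hP : IsProj P) (X : Matrix (Fin n) (Fin n) ℂ) : tang P (perp P X) = 0 := by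
  have h := congrArg (tang P) (tang_add_perp P X)
  rw [tang_add, hP.tang_tang] at h
  exact left_eq_add.1 h.symm

theorem IsProj.perp_perp (hP : IsProj P) (X : Matrix (Fin n) (Fin n) ℂ) : perp P (perp P X) = perp P X := by
  have h := tang_add_perp P (perp P X)
  rwa [hP.tang_perp, zero_add] at h

theorem IsProj.isHermitian_perp (hP : IsProj P) {X : Matrix (Fin n) (Fin n) ℂ} (hX : X.IsHermitian) :
    (perp P X).IsHermitian := by
  have := Matrix.isHermitian_mul_mul_conjTranspose (1 - P) hX
  rwa [hP.compl.herm.eq] at this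

theorem IsProj.isHermitian_tang (hP : IsProj P) {X : Matrix (Fin n) (Fin n) ℂ} (hX : X.IsHermitian) :
    (tang P X).IsHermitian := by
  rw [eq_sub_of_add_eq (tang_add_perp P X)]
  exact hX.sub (hP.isHermitian_perp hX)

theorem IsProj.ip_perp_left (hP : IsProj P) (X Y : Matrix (Fin n) (Fin n) ℂ) : ip (perp P X) Y = ip X (perp P Y) := by
  simp only [ip, hsInner, perp, Matrix.conjTranspose_mul, hP.compl.herm.eq]
  rw [← mul_assoc, mul_assoc (_ * _) (1 - P) Y, mul_assoc, Matrix.trace_mul_comm]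
  simp only [mul_assoc]

theorem ip_sub_left (A B C : Matrix (Fin n) (Fin n) ℂ) : ip (A - B) C = ip A C - ip B C := by
  rw [ip_comm, ip_sub_right, ip_comm C A, ip_comm C B]

theorem IsProj.ip_tang_left (hP : IsProj P) (X Y : Matrix (Fin n) (Fin n) ℂ) : ip (tang P X) Y = ip X (tang P Y) := by
  rw [eq_sub_of_add_eq (tang_add_perp P X), eq_sub_of_add_eq (tang_add_perp P Y), ip_sub_left,
    ip_sub_right, hP.ip_perp_left]

theorem IsProj.hsNorm_tang_le (hP : IsProj P) (X : Matrix (Fin n) (Fin n) ℂ) : hsNorm (tang P X) ≤ hsNorm X := by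
  have h1 : hsNorm (tang P X) ^ 2 ≤ hsNorm X * hsNorm (tang P X) := by
    rw [← ip_self, hP.ip_tang_left, hP.tang_tang]
    exact (le_abs_self _).trans (abs_ip_le _ _)
  nlinarith [hsNorm_nonneg X, hsNorm_nonneg (tang P X)]

theorem IsProj.norm_le_one (hP : IsProj P) : ‖P‖ ≤ 1 := by
  have h : ‖P‖ = ‖P‖ * ‖P‖ := by
    conv_lhs => rw [← hP.idem]
    have := CStarRing.norm_star_mul_self (x := P)
    rwa [Matrix.star_eq_conjTranspose, hP.herm.eq] at this
  nlinarith [norm_nonneg P]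

theorem IsProj.norm_perp_le (hP : IsProj P) (X : Matrix (Fin n) (Fin n) ℂ) : ‖perp P X‖ ≤ ‖X‖ := by
  have h1 := hP.compl.norm_le_one
  calc ‖perp P X‖ ≤ ‖1 - P‖ * ‖X‖ * ‖1 - P‖ := norm_mul₃_le
    _ ≤ 1 * ‖X‖ * 1 := by gcongr
    _ = _ := by ring

-- `P + perp P V` is block diagonal for the range of `P` and its complement, with blocks the
-- identity and a contraction. It serves as the dual witness for the trace norm.
open scoped MatrixOrder in
theorem IsProj.norm_add_perp_le (hP : IsProj P) {V : Matrix (Fin n) (Fin n) ℂ} (hV : ‖V‖ ≤ 1) : ‖P + perp P V‖ ≤ 1 := by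
  set Q := 1 - P with hQ
  have hQp : IsProj Q := hP.compl
  have hPQ : P * Q = 0 := by rw [hQ, mul_sub, hP.idem, mul_one, sub_self]
  have hQP : Q * P = 0 := by rw [hQ, sub_mul, hP.idem, one_mul, sub_self]
  set B := star V * Q * V with hB
  have hBs : IsSelfAdjoint B := by
    rw [hB, IsSelfAdjoint, star_mul, star_mul, star_star, mul_assoc]
    congr 2
    exact hQp.herm
  have e1 : star (P + perp P V) * (P + perp P V) = P + star Q * B * Q := by
    have hs : star P = P := hP.herm
    have hs' : star Q = Q := hQp.herm
    have h1 : ∀ Z : Matrix (Fin n) (Fin n) ℂ, P * (Q * Z) = 0 := fun Z => by rw [← mul_assoc, hPQ, zero_mul]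
    have h2 : ∀ Z : Matrix (Fin n) (Fin n) ℂ, Q * (Q * Z) = Q * Z := fun Z => by rw [← mul_assoc, hQp.idem]
    rw [perp, ← hQ, star_add, star_mul, star_mul, hs, hs', hB]
    simp only [mul_add, add_mul, mul_assoc, hP.idem, hQP, h1, h2, mul_zero, add_zero, zero_add]
  have h2 : ‖B‖ ≤ 1 := by
    have := hQp.norm_le_one
    calc ‖B‖ ≤ ‖star V‖ * ‖Q‖ * ‖V‖ := norm_mul₃_le
      _ ≤ 1 * 1 * 1 := by rw [norm_star]; gcongr
      _ = 1 := by norm_num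
  have h3 : star Q * B * Q ≤ Q := by
    refine (CStarAlgebra.star_left_conjugate_le_norm_smul (a := Q) hBs).trans ?_
    have hs : star Q * Q = Q := by rw [Matrix.star_eq_conjTranspose, hQp.herm.eq, hQp.idem]
    have h0 : 0 ≤ star Q * Q := star_mul_self_nonneg Q
    rw [hs] at h0 ⊢
    simpa using smul_le_smul_of_nonneg_right h2 h0
  have h4 : star (P + perp P V) * (P + perp P V) ≤ 1 := by
    rw [e1]
    calc P + star Q * B * Q ≤ P + Q := by gcongr
      _ = 1 := by rw [hQ]; abel
  have h5 := CStarAlgebra.norm_le_norm_of_nonneg_of_le (star_mul_self_nonneg _) h4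
  rw [CStarRing.norm_star_mul_self] at h5
  -- Only an inequality, so that dimension zero is included.
  have h6 : ‖(1 : Matrix (Fin n) (Fin n) ℂ)‖ ≤ 1 := IsProj.norm_le_one ⟨Matrix.isHermitian_one, one_mul 1⟩
  nlinarith [norm_nonneg (P + perp P V)]

/-- Pairing the equality of the data with `σ - ρ` gives a vanishing sum of squares of the individual
outcomes. -/
theorem ip_eq_zero_of_samplingOp_eq {m : ℕ} {v : Fin m → Matrix (Fin n) (Fin n) ℂ} (hv : ∀ i, (v i).IsHermitian)
    (hn : n ≠ 0) (hm : m ≠ 0) {σ ρ : Matrix (Fin n) (Fin n) ℂ} (hσ : σ.IsHermitian) (hρ : ρ.IsHermitian)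
    (h : samplingOp v σ = samplingOp v ρ) (i : Fin m) : ip (v i) (σ - ρ) = 0 := by
  have hδ := hσ.sub hρ
  have hc : ((n : ℂ) ^ 2 / (m : ℂ)) ≠ 0 := by
    refine div_ne_zero (pow_ne_zero _ ?_) ?_ <;> exact_mod_cast ‹_›
  have h1 : ∑ i, ip (v i) (σ - ρ) • v i = 0 := by
    have h2 : ∑ i, hsInner (v i) σ • v i = ∑ i, hsInner (v i) ρ • v i :=
      smul_right_injective _ hc h
    rw [← sub_eq_zero, ← Finset.sum_sub_distrib] at h2
    rw [← h2]
    refine Finset.sum_congr rfl fun i _ => ?_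
    rw [hsInner_eq_ip (hv i) hσ, hsInner_eq_ip (hv i) hρ, ip_sub_right, sub_smul]
    ext; simp
  have h3 := congrArg (ip (σ - ρ)) h1
  rw [ip_sum_right] at h3
  have h4 : ∑ i, ip (v i) (σ - ρ) ^ 2 = 0 := by
    have : ip (σ - ρ) 0 = 0 := by simp [ip, hsInner]
    rw [← this, ← h3]
    refine Finset.sum_congr rfl fun i _ => ?_
    rw [ip_smul_right, ip_comm (σ - ρ), sq]
  exact pow_eq_zero_iff two_ne_zero |>.1
    ((Finset.sum_eq_zero_iff_of_nonneg fun i _ => sq_nonneg _).1 h4 i (Finset.mem_univ i))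

theorem isReconstructed_of_injective {m : ℕ} {v : Fin m → Matrix (Fin n) (Fin n) ℂ} (hv : ∀ i, (v i).IsHermitian)
    (hn : n ≠ 0) (hm : m ≠ 0) {ρ : Matrix (Fin n) (Fin n) ℂ} (hρ : ρ.IsHermitian)
    (h : ∀ δ : Matrix (Fin n) (Fin n) ℂ, δ.IsHermitian → (∀ i, ip (v i) δ = 0) → δ = 0) : IsReconstructed v ρ :=
  fun σ hσ hR hne => absurd (sub_eq_zero.1 (h (σ - ρ) (hσ.sub hρ)
    (ip_eq_zero_of_samplingOp_eq hv hn hm hσ hρ hR))) hne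

/-- An approximate dual certificate guarantees the reconstruction. -/
theorem isReconstructed_of_certificate {m : ℕ} {v : Fin m → Matrix (Fin n) (Fin n) ℂ} (hv : ∀ i, (v i).IsHermitian)
    (hn : n ≠ 0) (hm : m ≠ 0) {ρ : Matrix (Fin n) (Fin n) ℂ} (hρ : ρ.PosSemidef) (hP : IsProj P) (hPρ : P * ρ = ρ)
    (c : Fin m → ℝ) {η κ : ℝ} (hη : hsNorm (P - tang P (∑ i, c i • v i)) ≤ η)
    (hperp : ‖perp P (∑ i, c i • v i)‖ ≤ 1 / 2)
    (hinj : ∀ δ : Matrix (Fin n) (Fin n) ℂ, δ.IsHermitian → (∀ i, ip (v i) δ = 0) →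
      hsNorm (tang P δ) ≤ κ * hsNorm (perp P δ)) (hκ : η * κ < 1 / 2) :
    IsReconstructed v ρ := by
  intro σ hσ hR hne
  have hz := ip_eq_zero_of_samplingOp_eq hv hn hm hσ hρ.1 hR
  set δ := σ - ρ with hδ
  have hδh : δ.IsHermitian := hσ.sub hρ.1
  set Y := ∑ i, c i • v i with hY
  have hYδ : ip Y δ = 0 := by
    rw [ip_comm, hY, ip_sum_right]
    refine Finset.sum_eq_zero fun i _ => ?_
    rw [ip_smul_right, ip_comm, hz, mul_zero]
  obtain ⟨V, hV1, hV⟩ := exists_norm_le_one_trace_eq (hP.isHermitian_perp hδh)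
  have hi := hinj δ hδh hz
  have hη0 : 0 ≤ η := (hsNorm_nonneg _).trans hη
  -- The certificate `Y` is orthogonal to `δ`, so subtracting it from `P` costs nothing.
  have hP1 : ip P δ = ip (P - tang P Y) (tang P δ) - ip (perp P Y) (perp P δ) := by
    have e1 : ip Y δ = ip (tang P Y) (tang P δ) + ip (perp P Y) (perp P δ) := by
      rw [hP.ip_tang_left, hP.tang_tang, hP.ip_perp_left, hP.perp_perp, ← ip_add_right,
        tang_add_perp]
    have e2 : tang P P = P := by simp [tang, hP.idem]
    have e3 : ip P δ = ip P (tang P δ) := by rw [← hP.ip_tang_left, e2]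
    rw [ip_sub_left]
    linarith
  have h1 : -(η * (κ * hsNorm (perp P δ))) ≤ ip (P - tang P Y) (tang P δ) := by
    refine (abs_le.1 ((abs_ip_le _ _).trans ?_)).1
    exact mul_le_mul hη hi (hsNorm_nonneg _) hη0
  have h2 : ip (perp P Y) (perp P δ) ≤ 1 / 2 * traceNorm (perp P δ) := by
    have e := abs_re_trace_mul_le (perp P Y).conjTranspose (hP.isHermitian_perp hδh)
    rw [Matrix.l2_opNorm_conjTranspose] at e
    exact (le_abs_self _).trans (e.trans (mul_le_mul_of_nonneg_right hperp
      (traceNorm_nonneg (hP.isHermitian_perp hδh))))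
  -- `σ` is tested against the contraction `P + perp P V`, where `V` is dual to the complementary
  -- part of `δ`.
  have h3 : traceNorm ρ + ip P δ + traceNorm (perp P δ) ≤ traceNorm σ := by
    have e := abs_re_trace_mul_le (P + perp P V) hσ
    have e1 : (Matrix.trace ((P + perp P V) * σ)).re =
        traceNorm ρ + ip P δ + traceNorm (perp P δ) := by
      have hσ' : σ = ρ + δ := by rw [hδ]; abel
      have hQρ : (1 - P) * ρ = 0 := by rw [sub_mul, hPρ, one_mul, sub_self]
      have e2 : Matrix.trace (perp P V * ρ) = 0 := by
        rw [perp, mul_assoc, hQρ, mul_zero, Matrix.trace_zero]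
      have e3 : Matrix.trace (perp P V * δ) = Matrix.trace (V * perp P δ) := by
        rw [perp, perp, mul_assoc, mul_assoc, Matrix.trace_mul_comm]
        simp only [mul_assoc]
      rw [hσ', mul_add, add_mul, add_mul, hPρ, Matrix.trace_add, Matrix.trace_add,
        Matrix.trace_add, e2, e3, Complex.add_re, Complex.add_re, Complex.add_re, hV,
        traceNorm_of_posSemidef hρ, ip_eq_re_trace hP.herm]
      simp; ring
    rw [e1] at e
    refine (le_abs_self _).trans (e.trans ?_)
    have := hP.norm_add_perp_le hV1
    nlinarith [traceNorm_nonneg hσ]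
  have h4 := hsNorm_le_traceNorm (hP.isHermitian_perp hδh)
  -- If the complementary part vanishes, so does the tangential one and `δ = 0`. Otherwise the gain
  -- exceeds the losses, which are at most half the trace norm and strictly less than half the
  -- Hilbert-Schmidt norm of `perp P δ`.
  rcases (hsNorm_nonneg (perp P δ)).eq_or_lt with h | h
  · exfalso
    rw [← h, mul_zero] at hi
    have h5 : tang P δ = 0 := hsNorm_eq_zero.1 (le_antisymm hi (hsNorm_nonneg _))
    have h6 : perp P δ = 0 := hsNorm_eq_zero.1 h.symm
    have h7 := tang_add_perp P δ
    rw [h5, h6, add_zero] at h7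
    exact hne (sub_eq_zero.1 h7.symm)
  · nlinarith

end Tangent

end CompressedSensing

namespace CompressedSensing

set_option linter.unusedSectionVars false

open scoped Matrix.Norms.L2Operator

/-! ### Matrix-valued integrals and empirical second moments. -/

section MatrixIntegral

variable {S ι : Type*} [MeasurableSpace S] [Fintype ι] [DecidableEq ι] {μ : Measure S}

theorem stronglyMeasurable_matrix {T : S → Matrix ι ι ℂ}
    (h : ∀ i j, Measurable fun α => T α i j) : StronglyMeasurable T := by
  have : T = fun α => ∑ i, ∑ j, T α i j • Matrix.single i j (1 : ℂ) := by
    funext α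
    conv_lhs => rw [Matrix.matrix_eq_sum_single (T α)]
    simp [Matrix.smul_single]
  rw [this]
  refine Finset.stronglyMeasurable_fun_sum _ fun i _ => Finset.stronglyMeasurable_fun_sum _ fun j _ => ?_
  exact (h i j).stronglyMeasurable.smul_const _

/-- The quadratic form of a matrix. -/
noncomputable def quadForm (x : EuclideanSpace ℂ ι) : Matrix ι ι ℂ →ₗ[ℝ] ℝ where
  toFun M := (star x.ofLp ⬝ᵥ (M.mulVec x.ofLp)).re
  map_add' M N := by simp [Matrix.add_mulVec]
  map_smul' c M := by simp [Matrix.smul_mulVec]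

/-- A real-linear functional commutes with the integral of a matrix. -/
theorem map_integral_matrix {F : Type*} [NormedAddCommGroup F] [NormedSpace ℝ F] [CompleteSpace F]
    (l : Matrix ι ι ℂ →ₗ[ℝ] F) {T : S → Matrix ι ι ℂ} (hT : Integrable T μ) :
    l (∫ α, T α ∂μ) = ∫ α, l (T α) ∂μ :=
  ((LinearMap.toContinuousLinearMap l).integral_comp_comm hT).symm

theorem integrable_map_matrix {F : Type*} [NormedAddCommGroup F] [NormedSpace ℝ F]
    (l : Matrix ι ι ℂ →ₗ[ℝ] F) {T : S → Matrix ι ι ℂ} (hT : Integrable T μ) :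
    Integrable (fun α => l (T α)) μ :=
  (LinearMap.toContinuousLinearMap l).integrable_comp hT

theorem integral_matrix_apply {T : S → Matrix ι ι ℂ} (hT : Integrable T μ) (i j : ι) :
    (∫ α, T α ∂μ) i j = ∫ α, T α i j ∂μ :=
  map_integral_matrix (Matrix.entryLinearMap ℝ ℂ i j) hT

theorem isHermitian_integral {T : S → Matrix ι ι ℂ} (hT : Integrable T μ)
    (h : ∀ α, (T α).IsHermitian) : (∫ α, T α ∂μ).IsHermitian := by
  ext i j
  rw [Matrix.conjTranspose_apply, integral_matrix_apply hT, integral_matrix_apply hT,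
    Complex.star_def, ← integral_conj]
  congr 1
  funext α
  exact (h α).apply i j

open scoped MatrixOrder in
theorem l2norm_le_of_quadForm_le {M : Matrix ι ι ℂ} (hM : M.PosSemidef) {C : ℝ} (hC : 0 ≤ C)
    (h : ∀ x, quadForm x M ≤ C * ‖x‖ ^ 2) : ‖M‖ ≤ C := by
  rw [CStarAlgebra.norm_le_iff_le_algebraMap M hC (Matrix.nonneg_iff_posSemidef.2 hM),
    Matrix.le_iff, Algebra.algebraMap_eq_smul_one]
  have hh : (C • (1 : Matrix ι ι ℂ) - M).IsHermitian := by
    refine Matrix.IsHermitian.sub ?_ hM.1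
    rw [Matrix.IsHermitian, Matrix.conjTranspose_smul, Matrix.conjTranspose_one, star_trivial]
  refine Matrix.PosSemidef.of_dotProduct_mulVec_nonneg hh fun x => ?_
  refine Complex.nonneg_iff.2 ⟨?_, (hh.im_star_dotProduct_mulVec_self x).symm⟩
  have e := h (WithLp.toLp 2 x)
  have e1 : (star x ⬝ᵥ x).re = ‖WithLp.toLp 2 x‖ ^ 2 := by
    rw [EuclideanSpace.norm_sq_eq, dotProduct, Complex.re_sum]
    refine Finset.sum_congr rfl fun i _ => ?_
    rw [Pi.star_apply, Complex.star_def, ← Complex.normSq_eq_conj_mul_self, Complex.ofReal_re,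
      Complex.normSq_eq_norm_sq]
  rw [Matrix.sub_mulVec, Matrix.smul_mulVec, Matrix.one_mulVec, dotProduct_sub, dotProduct_smul,
    Complex.sub_re, Complex.smul_re, e1]
  simpa [quadForm] using e

theorem quadForm_nonneg {M : Matrix ι ι ℂ} (hM : M.PosSemidef) (x : EuclideanSpace ℂ ι) :
    0 ≤ quadForm x M := (Complex.nonneg_iff.1 (hM.dotProduct_mulVec_nonneg x.ofLp)).1

theorem abs_quadForm_le (M : Matrix ι ι ℂ) (x : EuclideanSpace ℂ ι) :
    |quadForm x M| ≤ ‖M‖ * ‖x‖ ^ 2 := by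
  rw [sq]
  exact (Complex.abs_re_le_norm _).trans (norm_star_dotProduct_mulVec_le M x x)

theorem l2norm_integral_le {T : S → Matrix ι ι ℂ} (hT : Integrable T μ)
    (h : ∀ α, (T α).PosSemidef) {C : ℝ} (hC : 0 ≤ C)
    (hq : ∀ x, ∫ α, quadForm x (T α) ∂μ ≤ C * ‖x‖ ^ 2) : ‖∫ α, T α ∂μ‖ ≤ C := by
  have hh := isHermitian_integral hT fun α => (h α).1
  have hx : ∀ x, quadForm x (∫ α, T α ∂μ) = ∫ α, quadForm x (T α) ∂μ := fun x =>
    map_integral_matrix (quadForm x) hT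
  refine l2norm_le_of_quadForm_le (Matrix.PosSemidef.of_dotProduct_mulVec_nonneg hh fun x => ?_) hC
    fun x => (hx x).trans_le (hq x)
  refine Complex.nonneg_iff.2 ⟨?_, (hh.im_star_dotProduct_mulVec_self x).symm⟩
  have := hx (WithLp.toLp 2 x)
  have h0 : 0 ≤ ∫ α, quadForm (WithLp.toLp 2 x) (T α) ∂μ :=
    integral_nonneg fun α => quadForm_nonneg (h α) _
  rw [← this] at h0
  exact h0

/-- The rank-one matrix of a vector. -/
noncomputable def rankOne (u : EuclideanSpace ℂ ι) : Matrix ι ι ℂ :=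
  Matrix.vecMulVec u.ofLp (star u.ofLp)

theorem posSemidef_rankOne (u : EuclideanSpace ℂ ι) : (rankOne u).PosSemidef :=
  Matrix.posSemidef_vecMulVec_self_star _

theorem quadForm_rankOne (u x : EuclideanSpace ℂ ι) :
    quadForm x (rankOne u) = ‖(inner ℂ u x : ℂ)‖ ^ 2 := by
  have h1 : star x.ofLp ⬝ᵥ u.ofLp = inner ℂ x u := by
    rw [EuclideanSpace.inner_eq_star_dotProduct, dotProduct_comm]
  have h2 : star u.ofLp ⬝ᵥ x.ofLp = inner ℂ u x := by
    rw [EuclideanSpace.inner_eq_star_dotProduct, dotProduct_comm]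
  show (star x.ofLp ⬝ᵥ ((Matrix.vecMulVec u.ofLp (star u.ofLp)).mulVec x.ofLp)).re = _
  rw [Matrix.vecMulVec_mulVec, h2, op_smul_eq_smul, dotProduct_smul, h1, smul_eq_mul,
    ← inner_conj_symm x u, Complex.mul_conj, Complex.ofReal_re, Complex.normSq_eq_norm_sq]

theorem norm_rankOne_le (u : EuclideanSpace ℂ ι) : ‖rankOne u‖ ≤ ‖u‖ ^ 2 := by
  refine l2norm_le_of_quadForm_le (posSemidef_rankOne u) (sq_nonneg _) fun x => ?_
  rw [quadForm_rankOne, ← mul_pow]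
  exact pow_le_pow_left₀ (norm_nonneg _) (norm_inner_le_norm u x) 2

/-- The empirical second moments of a bounded isotropic random vector are bounded below. -/
theorem measureReal_exists_sum_inner_lt_le [IsProbabilityMeasure μ] {κ : Type*} [Fintype κ]
    [DecidableEq κ] [Nonempty κ] {u : S → EuclideanSpace ℂ ι} (hu : Measurable u) {θ s : ℝ}
    (hs : 0 < s) (hθ : ∀ α, ‖u α‖ ^ 2 ≤ θ)
    (h2 : ∀ x, ∫ α, ‖(inner ℂ (u α) x : ℂ)‖ ^ 2 ∂μ ≤ ‖x‖ ^ 2 / s) {p : ℕ} (hp : p ≠ 0)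
    (hι : (Fintype.card ι : ℝ) ≤ Real.exp p)
    (hm : 2 ^ 15 * (6 * p * (s * θ)) ≤ Fintype.card κ) :
    (Measure.pi fun _ : κ => μ).real {β | ∃ x, ∑ i, s / Fintype.card κ *
        ‖(inner ℂ (u (β i)) x : ℂ)‖ ^ 2 <
      s * ∫ α, ‖(inner ℂ (u α) x : ℂ)‖ ^ 2 ∂μ - 1 / 4 * ‖x‖ ^ 2} ≤ 1 / 8 := by
  set m : ℝ := (Fintype.card κ : ℝ) with hmdef
  have hm0 : 0 < m := by rw [hmdef]; exact_mod_cast Fintype.card_pos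
  set T : S → Matrix ι ι ℂ := fun α => (s / m) • rankOne (u α) with hT
  have hsm : 0 ≤ s / m := by positivity
  have hmeas : StronglyMeasurable T := by
    refine stronglyMeasurable_matrix fun i j => ?_
    have h1 : ∀ i, Measurable fun α => u α i := fun i => by fun_prop
    have : (fun α => T α i j) = fun α => ((s / m : ℝ) : ℂ) * (u α i * star (u α j)) := by
      funext α; simp [hT, rankOne, Matrix.vecMulVec_apply]
    rw [this]
    exact ((h1 i).mul (continuous_star.measurable.comp (h1 j))).const_mul _
  have hpsd : ∀ α, (T α).PosSemidef := fun α => (posSemidef_rankOne (u α)).smul hsm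
  have hb : ∀ α, ‖T α‖ ≤ s * θ / m := fun α => by
    rw [hT, norm_smul, Real.norm_of_nonneg hsm]
    calc s / m * ‖rankOne (u α)‖ ≤ s / m * θ :=
          mul_le_mul_of_nonneg_left ((norm_rankOne_le _).trans (hθ α)) hsm
      _ = _ := by ring
  have hint : Integrable T μ := Integrable.of_bound hmeas.aestronglyMeasurable _
    (Filter.Eventually.of_forall hb)
  have hquad : ∀ α x, quadForm x (T α) = s / m * ‖(inner ℂ (u α) x : ℂ)‖ ^ 2 := fun α x => by
    rw [hT, map_smul, quadForm_rankOne, smul_eq_mul]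
  have hV : ‖m • ∫ α, T α ∂μ‖ ≤ 1 := by
    rw [norm_smul, Real.norm_of_nonneg hm0.le]
    have : ‖∫ α, T α ∂μ‖ ≤ 1 / m := by
      refine l2norm_integral_le hint hpsd (by positivity) fun x => ?_
      simp only [hquad]
      rw [integral_const_mul]
      calc s / m * _ ≤ s / m * (‖x‖ ^ 2 / s) := mul_le_mul_of_nonneg_left (h2 x) hsm
        _ = _ := by field_simp
    calc m * _ ≤ m * (1 / m) := mul_le_mul_of_nonneg_left this hm0.le
      _ = 1 := by field_simp
  have hD := integral_norm_sum_sub_le_of_posSemidef (κ := κ) hmeas.aestronglyMeasurable hpsd hb hV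
    hp hι
  rw [← hmdef] at hD
  set π := Measure.pi fun _ : κ => μ with hπ
  have hx0 : 6 * p * (s * θ / m) ≤ 1 / 2 ^ 15 := by
    rw [← mul_div_assoc, div_le_iff₀ hm0]
    linarith
  -- The value `1 / 32` makes Markov's inequality at level `1 / 4` give `1 / 8`.
  have hD' : ∫ β : κ → S, ‖∑ i, T (β i) - m • ∫ α, T α ∂μ‖ ∂π ≤ 1 / 32 := by
    refine hD.trans ?_
    have h3 : √(6 * p * (s * θ / m) * 1) ≤ 1 / 2 ^ 7 := by
      rw [Real.sqrt_le_left (by norm_num)]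
      refine (mul_one (6 * p * (s * θ / m))).le.trans (hx0.trans (by norm_num))
    have : 24 * p * (s * θ / m) = 4 * (6 * p * (s * θ / m)) := by ring
    rw [this]
    norm_num at h3 hx0 ⊢
    linarith
  have hI : Integrable (fun β : κ → S => ‖∑ i, T (β i) - m • ∫ α, T α ∂μ‖) π := by
    have := integrable_sum_comp_eval hint (fun _ : κ => (1 : ℝ))
    simp only [one_smul] at this
    exact (this.sub (integrable_const _)).norm
  have hM := mul_meas_ge_le_integral_of_nonneg (μ := π)
    (Filter.Eventually.of_forall fun β => norm_nonneg _) hI (1 / 4)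
  refine le_trans (measureReal_mono ?_) (show π.real
    {β : κ → S | 1 / 4 ≤ ‖∑ i, T (β i) - m • ∫ α, T α ∂μ‖} ≤ 1 / 8 by linarith)
  -- A deviation below `1 / 4` in operator norm bounds the quadratic forms at all `x` at once.
  rintro β ⟨x, hx⟩
  show 1 / 4 ≤ ‖_‖
  have hq := abs_quadForm_le (∑ i, T (β i) - m • ∫ α, T α ∂μ) x
  rw [map_sub, map_sum, map_smul, map_integral_matrix (quadForm x) hint] at hq
  simp only [hquad] at hq
  rw [integral_const_mul, smul_eq_mul, ← mul_assoc, mul_div_cancel₀ _ hm0.ne'] at hq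
  have h4 := (abs_le.1 hq).1
  by_contra hcon
  push Not at hcon
  nlinarith [sq_nonneg ‖x‖]

end MatrixIntegral

end CompressedSensing

namespace CompressedSensing

set_option linter.unusedSectionVars false

/-! ### Measurability of the matrix functionals. -/

section Measurability

variable {n : ℕ}

noncomputable instance : BorelSpace (Matrix (Fin n) (Fin n) ℂ) :=
  inferInstanceAs (BorelSpace (Fin n → Fin n → ℂ))

instance : SecondCountableTopology (Matrix (Fin n) (Fin n) ℂ) :=
  inferInstanceAs (SecondCountableTopology (Fin n → Fin n → ℂ))

theorem continuous_ip : Continuous fun p : Matrix (Fin n) (Fin n) ℂ × Matrix (Fin n) (Fin n) ℂ =>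
    ip p.1 p.2 := by
  unfold ip hsInner
  fun_prop

theorem continuous_hsNorm : Continuous fun A : Matrix (Fin n) (Fin n) ℂ => hsNorm A := by
  have : (fun A : Matrix (Fin n) (Fin n) ℂ => hsNorm A) = fun A => √(ip A A) := by
    funext A; rw [ip_self, Real.sqrt_sq (hsNorm_nonneg A)]
  rw [this]
  have h : Continuous fun A : Matrix (Fin n) (Fin n) ℂ => ip A A := by
    unfold ip hsInner
    fun_prop
  exact h.sqrt

theorem continuous_tang (P : Matrix (Fin n) (Fin n) ℂ) : Continuous (tang P) := by
  unfold tang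
  fun_prop

theorem continuous_perp (P : Matrix (Fin n) (Fin n) ℂ) : Continuous (perp P) := by
  unfold perp
  fun_prop

open scoped Matrix.Norms.L2Operator in
theorem measurable_l2norm : Measurable fun A : Matrix (Fin n) (Fin n) ℂ => ‖A‖ :=
  Continuous.measurable continuous_norm

theorem measurable_ip_prod : Measurable fun p : Matrix (Fin n) (Fin n) ℂ × Matrix (Fin n) (Fin n) ℂ =>
    ip p.1 p.2 :=
  continuous_ip.measurable

theorem measurable_ip_comp {Ω : Type*} [MeasurableSpace Ω] {f g : Ω → Matrix (Fin n) (Fin n) ℂ}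
    (hf : Measurable f) (hg : Measurable g) : Measurable fun x => ip (f x) (g x) := by
  have h : Measurable fun x => (f x, g x) := hf.prodMk hg
  intro s hs
  exact h (measurable_ip_prod hs)

theorem measurable_matrix {Ω : Type*} [MeasurableSpace Ω] {f : Ω → Matrix (Fin n) (Fin n) ℂ}
    (h : ∀ i j, Measurable fun x => f x i j) : Measurable f :=
  measurable_pi_lambda _ fun i => measurable_pi_lambda _ fun j => h i j

end Measurability

open scoped Matrix.Norms.L2Operator

/-! ### Moments of a tight frame. -/

section Frame

variable {S : Type*} [MeasurableSpace S] {n : ℕ} {μ : Measure S}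
  {w : S → Matrix (Fin n) (Fin n) ℂ} {B : ℝ}

theorem IsTightFrame.measurable_frame (hw : IsTightFrame μ w) : Measurable w :=
  measurable_matrix hw.measurable

theorem IsTightFrame.hsNorm_le (hw : IsTightFrame μ w) (hB : ∀ α, traceNorm (w α) ≤ B) (α : S) :
    hsNorm (w α) ≤ B := (hsNorm_le_traceNorm (hw.hermitian α)).trans (hB α)

theorem hsInner_add_right (A X Y : Matrix (Fin n) (Fin n) ℂ) :
    hsInner A (X + Y) = hsInner A X + hsInner A Y := by simp [hsInner, Matrix.mul_add]

theorem hsInner_smul_right (c : ℂ) (A X : Matrix (Fin n) (Fin n) ℂ) :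
    hsInner A (c • X) = c * hsInner A X := by simp [hsInner]

theorem IsProj.hsInner_perp_left {P : Matrix (Fin n) (Fin n) ℂ} (hP : IsProj P)
    (X Y : Matrix (Fin n) (Fin n) ℂ) : hsInner (perp P X) Y = hsInner X (perp P Y) := by
  simp only [hsInner, perp, Matrix.conjTranspose_mul, hP.compl.herm.eq]
  rw [← mul_assoc, mul_assoc (_ * _) (1 - P) Y, mul_assoc, Matrix.trace_mul_comm]
  simp only [mul_assoc]

theorem IsProj.hsInner_tang_left {P : Matrix (Fin n) (Fin n) ℂ} (hP : IsProj P)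
    (X Y : Matrix (Fin n) (Fin n) ℂ) : hsInner (tang P X) Y = hsInner X (tang P Y) := by
  have h : ∀ A C D : Matrix (Fin n) (Fin n) ℂ, hsInner (A - C) D = hsInner A D - hsInner C D := by
    intro A C D; simp [hsInner, Matrix.sub_mul]
  have h' : ∀ A C D : Matrix (Fin n) (Fin n) ℂ, hsInner A (C - D) = hsInner A C - hsInner A D := by
    intro A C D; simp [hsInner, Matrix.mul_sub]
  rw [eq_sub_of_add_eq (tang_add_perp P X), eq_sub_of_add_eq (tang_add_perp P Y), h, h',
    hP.hsInner_perp_left]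

theorem exists_hermitian_parts (X : Matrix (Fin n) (Fin n) ℂ) :
    ∃ H K : Matrix (Fin n) (Fin n) ℂ, H.IsHermitian ∧ K.IsHermitian ∧ X = H + Complex.I • K := by
  refine ⟨(1 / 2 : ℝ) • (X + X.conjTranspose),
    (-(Complex.I / 2)) • (X - X.conjTranspose), ?_, ?_, ?_⟩
  · simp [Matrix.IsHermitian, Matrix.conjTranspose_smul, add_comm]
  · rw [Matrix.IsHermitian, Matrix.conjTranspose_smul, Matrix.conjTranspose_sub,
      Matrix.conjTranspose_conjTranspose, ← neg_sub X, smul_neg, ← neg_smul]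
    congr 1
    simp [neg_div]
  · rw [smul_smul]
    ext i j
    simp only [Matrix.add_apply, Matrix.smul_apply, Matrix.sub_apply, Complex.real_smul,
      smul_eq_mul]
    push_cast
    linear_combination (X i j - X.conjTranspose i j) / 2 * Complex.I_mul_I

theorem IsTightFrame.norm_entry_le (hw : IsTightFrame μ w) (hB : ∀ α, traceNorm (w α) ≤ B)
    (α : S) (i j : Fin n) : ‖w α i j‖ ≤ B :=
  (norm_entry_le_hsNorm _ i j).trans (hw.hsNorm_le hB α)

/-- The extension to non-Hermitian matrices allows matrix units to be inserted when computing the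
mean of `w α ^ 2`. -/
theorem IsTightFrame.integral_hsInner_mul (hw : IsTightFrame μ w)
    (X : Matrix (Fin n) (Fin n) ℂ) (i j : Fin n) :
    ∫ α, hsInner (w α) X * w α i j ∂μ = X i j / (n : ℂ) ^ 2 := by
  obtain ⟨H, K, hH, hK, rfl⟩ := exists_hermitian_parts X
  have h : ∀ α, hsInner (w α) (H + Complex.I • K) * w α i j =
      hsInner (w α) H * w α i j + Complex.I * (hsInner (w α) K * w α i j) := fun α => by
    rw [hsInner_add_right, hsInner_smul_right]; ring
  simp only [h]
  rw [integral_add (hw.integrable H hH i j) ((hw.integrable K hK i j).const_mul _),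
    integral_const_mul, hw.resolution H hH, hw.resolution K hK]
  simp only [Matrix.add_apply, Matrix.smul_apply, smul_eq_mul]
  ring

/-- The real linear functional `ip X`. -/
noncomputable def ipLin (X : Matrix (Fin n) (Fin n) ℂ) : Matrix (Fin n) (Fin n) ℂ →ₗ[ℝ] ℝ where
  toFun := ip X
  map_add' := ip_add_right X
  map_smul' c A := ip_smul_right c X A

theorem IsTightFrame.abs_ip_le (hw : IsTightFrame μ w) (hB : ∀ α, traceNorm (w α) ≤ B) (α : S)
    (X : Matrix (Fin n) (Fin n) ℂ) : |ip (w α) X| ≤ B * hsNorm X :=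
  (CompressedSensing.abs_ip_le _ _).trans
    (mul_le_mul_of_nonneg_right (hw.hsNorm_le hB α) (hsNorm_nonneg X))

theorem IsTightFrame.measurable_ip (hw : IsTightFrame μ w) (X : Matrix (Fin n) (Fin n) ℂ) :
    Measurable fun α => ip (w α) X := measurable_ip_comp hw.measurable_frame measurable_const

theorem IsTightFrame.norm_le (hw : IsTightFrame μ w) (hB : ∀ α, traceNorm (w α) ≤ B) (α : S) :
    ‖w α‖ ≤ B := (l2norm_le_hsNorm _).trans (hw.hsNorm_le hB α)

theorem IsTightFrame.integrable_smul (hw : IsTightFrame μ w) (hB : ∀ α, traceNorm (w α) ≤ B)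
    {c : S → ℝ} (hc : Measurable c) {C : ℝ} (hC : ∀ α, |c α| ≤ C) :
    Integrable (fun α => c α • w α) μ := by
  have := hw.prob
  have hm : StronglyMeasurable fun α => c α • w α := by
    refine stronglyMeasurable_matrix fun i j => ?_
    simp only [Matrix.smul_apply, Complex.real_smul]
    exact (Complex.measurable_ofReal.comp hc).mul (hw.measurable i j)
  refine Integrable.of_bound hm.aestronglyMeasurable (C * B) (Filter.Eventually.of_forall fun α => ?_)
  rw [norm_smul, Real.norm_eq_abs]
  exact mul_le_mul (hC α) (hw.norm_le hB α) (norm_nonneg _) ((abs_nonneg _).trans (hC α))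

theorem IsTightFrame.integral_ip_smul (hw : IsTightFrame μ w) (hB : ∀ α, traceNorm (w α) ≤ B)
    {X : Matrix (Fin n) (Fin n) ℂ} (hX : X.IsHermitian) :
    ∫ α, ip (w α) X • w α ∂μ = ((n : ℝ) ^ 2)⁻¹ • X := by
  have hi := hw.integrable_smul hB (hw.measurable_ip X) fun α => hw.abs_ip_le hB α X
  ext i j
  rw [integral_matrix_apply hi, Matrix.smul_apply, Complex.real_smul]
  have := hw.resolution X hX i j
  simp only [hsInner_eq_ip (hw.hermitian _) hX] at this
  simp only [Matrix.smul_apply, Complex.real_smul]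
  rw [this]
  push_cast
  ring

theorem IsTightFrame.integral_ip_mul_ip (hw : IsTightFrame μ w) (hB : ∀ α, traceNorm (w α) ≤ B)
    {X : Matrix (Fin n) (Fin n) ℂ} (hX : X.IsHermitian) (Y : Matrix (Fin n) (Fin n) ℂ) :
    ∫ α, ip (w α) X * ip (w α) Y ∂μ = ip X Y / (n : ℝ) ^ 2 := by
  have hi := hw.integrable_smul hB (hw.measurable_ip X) fun α => hw.abs_ip_le hB α X
  have h := map_integral_matrix (ipLin Y) hi
  rw [hw.integral_ip_smul hB hX] at h
  simp only [map_smul, smul_eq_mul] at h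
  simp only [ipLin, LinearMap.coe_mk, AddHom.coe_mk] at h
  simp only [ip_comm Y] at h
  rw [← h]; ring

theorem IsTightFrame.integral_ip_sq (hw : IsTightFrame μ w) (hB : ∀ α, traceNorm (w α) ≤ B)
    {X : Matrix (Fin n) (Fin n) ℂ} (hX : X.IsHermitian) :
    ∫ α, ip (w α) X ^ 2 ∂μ = hsNorm X ^ 2 / (n : ℝ) ^ 2 := by
  simp only [sq (ip _ _)]
  rw [hw.integral_ip_mul_ip hB hX, ip_self]

theorem IsTightFrame.integrable_ip_sq (hw : IsTightFrame μ w) (hB : ∀ α, traceNorm (w α) ≤ B)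
    (X : Matrix (Fin n) (Fin n) ℂ) : Integrable (fun α => ip (w α) X ^ 2) μ := by
  have := hw.prob
  refine Integrable.of_bound ((hw.measurable_ip X).pow_const 2).aestronglyMeasurable
    ((B * hsNorm X) ^ 2) (Filter.Eventually.of_forall fun α => ?_)
  rw [norm_pow, Real.norm_eq_abs]
  exact pow_le_pow_left₀ (abs_nonneg _) (hw.abs_ip_le hB α X) 2

/-- Arbitrary `X` are needed because the empirical second moments are tested on all complex vectors.
The Hermitian and anti-Hermitian parts contribute separately. -/
theorem IsTightFrame.integral_norm_hsInner_sq (hw : IsTightFrame μ w)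
    (hB : ∀ α, traceNorm (w α) ≤ B) (X : Matrix (Fin n) (Fin n) ℂ) :
    ∫ α, ‖hsInner (w α) X‖ ^ 2 ∂μ = hsNorm X ^ 2 / (n : ℝ) ^ 2 := by
  obtain ⟨H, K, hH, hK, rfl⟩ := exists_hermitian_parts X
  have h1 : ∀ α, ‖hsInner (w α) (H + Complex.I • K)‖ ^ 2 = ip (w α) H ^ 2 + ip (w α) K ^ 2 := by
    intro α
    rw [hsInner_add_right, hsInner_smul_right, hsInner_eq_ip (hw.hermitian α) hH,
      hsInner_eq_ip (hw.hermitian α) hK, mul_comm Complex.I, Complex.sq_norm,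
      Complex.normSq_add_mul_I]
  have h2 : hsNorm (H + Complex.I • K) ^ 2 = hsNorm H ^ 2 + hsNorm K ^ 2 := by
    have e : hsInner (H + Complex.I • K) (H + Complex.I • K) =
        (ip H H + ip K K : ℝ) := by
      have : hsInner (H + Complex.I • K) (H + Complex.I • K) = hsInner H H + Complex.I * hsInner H K
          - Complex.I * hsInner K H - Complex.I * Complex.I * hsInner K K := by
        simp [hsInner, Matrix.add_mul, Matrix.mul_add]
        ring_nf
        simp [Complex.I_sq]
      rw [this, hsInner_eq_ip hH hH, hsInner_eq_ip hH hK, hsInner_eq_ip hK hH,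
        hsInner_eq_ip hK hK, ip_comm K H, Complex.I_mul_I]
      push_cast; ring
    rw [← ip_self, ip, e, Complex.ofReal_re, ip_self, ip_self]
  simp only [h1]
  rw [integral_add (hw.integrable_ip_sq hB H) (hw.integrable_ip_sq hB K), hw.integral_ip_sq hB hH,
    hw.integral_ip_sq hB hK, h2]
  ring

theorem IsTightFrame.integrable_sq (hw : IsTightFrame μ w) (hB : ∀ α, traceNorm (w α) ≤ B) :
    Integrable (fun α => w α ^ 2) μ := by
  have := hw.prob
  refine Integrable.of_bound ((continuous_pow 2).comp_stronglyMeasurable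
    (stronglyMeasurable_matrix hw.measurable)).aestronglyMeasurable (B ^ 2)
    (Filter.Eventually.of_forall fun α => ?_)
  exact (norm_pow_le' _ (by norm_num)).trans
    (pow_le_pow_left₀ (norm_nonneg _) (hw.norm_le hB α) 2)

theorem IsTightFrame.integral_sq (hw : IsTightFrame μ w) (hB : ∀ α, traceNorm (w α) ≤ B) :
    ∫ α, w α ^ 2 ∂μ = (n : ℝ)⁻¹ • (1 : Matrix (Fin n) (Fin n) ℂ) := by
  have := hw.prob
  ext i j
  rw [integral_matrix_apply (hw.integrable_sq hB)]
  -- The entry `(i, k)` of `w α` is its scalar product with a matrix unit. The `n` terms then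
  -- contribute `1 / n²` each on the diagonal.
  have h1 : ∀ α, (w α ^ 2) i j = ∑ k, hsInner (w α) (Matrix.single k i 1) * w α k j := by
    intro α
    rw [sq, Matrix.mul_apply]
    refine Finset.sum_congr rfl fun k _ => ?_
    rw [hsInner, Matrix.trace_mul_single, (hw.hermitian α).eq]
    simp
  simp only [h1]
  have hi : ∀ k, Integrable (fun α => hsInner (w α) (Matrix.single k i 1) * w α k j) μ := by
    intro k
    refine Integrable.of_bound (C := B * B) ?_ (Filter.Eventually.of_forall fun α => ?_)
    · refine Measurable.aestronglyMeasurable ?_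
      simp only [hsInner, Matrix.trace_mul_single, (hw.hermitian _).eq]
      exact ((hw.measurable i k).mul_const _).mul (hw.measurable k j)
    · rw [norm_mul]
      have := hw.norm_entry_le hB α
      refine mul_le_mul ?_ (this k j) (norm_nonneg _) ((norm_nonneg _).trans (this k j))
      rw [hsInner, Matrix.trace_mul_single, (hw.hermitian α).eq]
      simpa using this i k
  rw [integral_finsetSum _ fun k _ => hi k]
  simp only [hw.integral_hsInner_mul]
  rw [← Finset.sum_div]
  by_cases hij : i = j
  · subst hij
    simp
    field_simp
  · simp [hij]

end Frame

end CompressedSensing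

/-! ### One batch of truncated samples. -/

namespace CompressedSensing

set_option linter.unusedSectionVars false

open scoped Matrix.Norms.L2Operator

/-- Fubini and Markov: an event that is unlikely for each fixed observable affects, with high
probability, only a small fraction of the observables. It is used both for the random samples and
for the random projection. -/
theorem measureReal_lt_measureReal_le {Ω S : Type*} [MeasurableSpace Ω] [MeasurableSpace S]
    {π : Measure Ω} [IsProbabilityMeasure π] {μ : Measure S} [IsProbabilityMeasure μ]
    {D : Set (Ω × S)} (hD : MeasurableSet D) {δ ε : ℝ} (hε : 0 < ε)
    (h : ∀ α, π.real {ω | (ω, α) ∈ D} ≤ δ) :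
    π.real {ω | ε < μ.real {α | (ω, α) ∈ D}} ≤ δ / ε := by
  have h1 : (π.prod μ).real D ≤ δ := by
    rw [Measure.real, Measure.prod_apply_symm hD]
    obtain ⟨α⟩ := μ.nonempty_of_neZero
    have hδ : 0 ≤ δ := measureReal_nonneg.trans (h α)
    refine ENNReal.toReal_le_of_le_ofReal hδ ?_
    calc ∫⁻ y, π ((fun x => (x, y)) ⁻¹' D) ∂μ ≤ ∫⁻ _, ENNReal.ofReal δ ∂μ := by
          refine lintegral_mono fun y => ?_
          rw [← ofReal_measureReal]
          exact ENNReal.ofReal_le_ofReal (h y)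
      _ = ENNReal.ofReal δ := by simp
  have h2 : ∫ ω, μ.real {α | (ω, α) ∈ D} ∂π = (π.prod μ).real D := by
    rw [Measure.real, Measure.prod_apply hD]
    simp only [Measure.real]
    rw [integral_toReal]
    · rfl
    · exact (measurable_measure_prodMk_left hD).aemeasurable
    · exact Filter.Eventually.of_forall fun ω => measure_lt_top _ _
  have h3 : Integrable (fun ω => μ.real {α | (ω, α) ∈ D}) π := by
    refine Integrable.of_bound (C := 1)
      (measurable_measure_prodMk_left hD).ennreal_toReal.aestronglyMeasurable
      (Filter.Eventually.of_forall fun ω => ?_)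
    rw [Real.norm_of_nonneg measureReal_nonneg]
    exact measureReal_le_one
  have h4 := mul_meas_ge_le_integral_of_nonneg
    (Filter.Eventually.of_forall fun ω => (measureReal_nonneg : 0 ≤ μ.real {α | (ω, α) ∈ D})) h3 ε
  rw [h2] at h4
  rw [le_div_iff₀ hε, mul_comm]
  refine le_trans (mul_le_mul_of_nonneg_left ?_ hε.le) (h4.trans h1)
  exact measureReal_mono fun ω (hω : ε < _) => hω.le

section Step

variable {S : Type*} [MeasurableSpace S] {n : ℕ} {μ : Measure S}
  {w : S → Matrix (Fin n) (Fin n) ℂ} {B : ℝ} {Gd : Set S} {m : ℕ}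

open scoped Classical in
/-- The scalar product of `w α` and `X`, cut off outside `Gd` and above `t`. -/
noncomputable def coef (w : S → Matrix (Fin n) (Fin n) ℂ) (Gd : Set S) (t : ℝ)
    (X : Matrix (Fin n) (Fin n) ℂ) (α : S) : ℝ :=
  if α ∈ Gd ∧ |ip (w α) X| ≤ t then ip (w α) X else 0

/-- The truncated sampling operator. -/
noncomputable def golfStep (w : S → Matrix (Fin n) (Fin n) ℂ) (Gd : Set S) (t : ℝ)
    (X : Matrix (Fin n) (Fin n) ℂ) (β : Fin m → S) : Matrix (Fin n) (Fin n) ℂ :=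
  ((n : ℝ) ^ 2 / m) • ∑ i, coef w Gd t X (β i) • w (β i)

/-- The expectation of the truncated sampling operator. -/
noncomputable def golfMean (μ : Measure S) (w : S → Matrix (Fin n) (Fin n) ℂ) (Gd : Set S) (t : ℝ)
    (X : Matrix (Fin n) (Fin n) ℂ) : Matrix (Fin n) (Fin n) ℂ :=
  (n : ℝ) ^ 2 • ∫ α, coef w Gd t X α • w α ∂μ

theorem measurable_coef_comp (hw : IsTightFrame μ w) (hG : MeasurableSet Gd) (t : ℝ) {Ω : Type*}
    [MeasurableSpace Ω] {f : Ω → Matrix (Fin n) (Fin n) ℂ} {g : Ω → S} (hf : Measurable f)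
    (hg : Measurable g) : Measurable fun x => coef w Gd t (f x) (g x) := by
  unfold coef
  have h := measurable_ip_comp (hw.measurable_frame.comp hg) hf
  simp only [Function.comp_apply] at h
  refine Measurable.ite ?_ h measurable_const
  exact (hg hG).inter (measurableSet_le (measurable_norm.comp h) measurable_const)

theorem measurable_coef (hw : IsTightFrame μ w) (hG : MeasurableSet Gd) (t : ℝ)
    (X : Matrix (Fin n) (Fin n) ℂ) : Measurable (coef w Gd t X) :=
  measurable_coef_comp hw hG t measurable_const measurable_id

theorem measurable_golfStep_comp (hw : IsTightFrame μ w) (hG : MeasurableSet Gd) (t : ℝ)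
    {Ω : Type*} [MeasurableSpace Ω] {f : Ω → Matrix (Fin n) (Fin n) ℂ} {g : Ω → Fin m → S}
    (hf : Measurable f) (hg : Measurable g) :
    Measurable fun x => golfStep w Gd t (f x) (g x) := by
  refine measurable_matrix fun i j => ?_
  simp only [golfStep, Matrix.smul_apply, Matrix.sum_apply, Complex.real_smul]
  refine (Finset.measurable_sum _ fun k _ => ?_).const_mul _
  have hk : Measurable fun x => g x k := (measurable_pi_apply k).comp hg
  exact (Complex.measurable_ofReal.comp (measurable_coef_comp hw hG t hf hk)).mul
    ((hw.measurable i j).comp hk)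

theorem abs_coef_le_abs (t : ℝ) (X : Matrix (Fin n) (Fin n) ℂ) (α : S) :
    |coef w Gd t X α| ≤ |ip (w α) X| := by
  unfold coef; split_ifs <;> simp

theorem abs_coef_le {t : ℝ} (ht : 0 ≤ t) (X : Matrix (Fin n) (Fin n) ℂ) (α : S) :
    |coef w Gd t X α| ≤ t := by
  unfold coef; split_ifs with h
  · exact h.2
  · simpa using ht

theorem coef_eq_zero_of_notMem {t : ℝ} {X : Matrix (Fin n) (Fin n) ℂ} {α : S} (h : α ∉ Gd) :
    coef w Gd t X α = 0 := by
  unfold coef; rw [if_neg]; exact fun h' => h h'.1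

theorem integrable_coef_smul (hw : IsTightFrame μ w) (hB : ∀ α, traceNorm (w α) ≤ B)
    (hG : MeasurableSet Gd) (t : ℝ) (X : Matrix (Fin n) (Fin n) ℂ) :
    Integrable (fun α => coef w Gd t X α • w α) μ :=
  hw.integrable_smul hB (measurable_coef hw hG t X)
    fun α => (abs_coef_le_abs t X α).trans (hw.abs_ip_le hB α X)

theorem isHermitian_real_smul {X : Matrix (Fin n) (Fin n) ℂ} (hX : X.IsHermitian) (c : ℝ) :
    (c • X).IsHermitian := by
  rw [Matrix.IsHermitian, Matrix.conjTranspose_smul, hX.eq, star_trivial]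

theorem isHermitian_golfStep (hw : IsTightFrame μ w) (t : ℝ) (X : Matrix (Fin n) (Fin n) ℂ)
    (β : Fin m → S) : (golfStep w Gd t X β).IsHermitian := by
  refine isHermitian_real_smul ?_ _
  rw [Matrix.IsHermitian, Matrix.conjTranspose_sum]
  exact Finset.sum_congr rfl fun i _ => (isHermitian_real_smul (hw.hermitian _) _).eq

/-- Linear functions of the deviation of a truncated sampling operator from its mean. -/
theorem map_golfStep_sub_golfMean {F : Type*} [NormedAddCommGroup F] [NormedSpace ℝ F]
    [CompleteSpace F] (l : Matrix (Fin n) (Fin n) ℂ →ₗ[ℝ] F) (hw : IsTightFrame μ w)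
    (hB : ∀ α, traceNorm (w α) ≤ B) (hG : MeasurableSet Gd) (hm : m ≠ 0) (t : ℝ)
    (X : Matrix (Fin n) (Fin n) ℂ) (β : Fin m → S) :
    l (golfStep w Gd t X β - golfMean μ w Gd t X) = ((n : ℝ) ^ 2 / m) •
      (∑ i, l (coef w Gd t X (β i) • w (β i)) -
        (Fintype.card (Fin m) : ℝ) • ∫ α, l (coef w Gd t X α • w α) ∂μ) := by
  have hm' : (m : ℝ) ≠ 0 := Nat.cast_ne_zero.2 hm
  rw [← map_integral_matrix l (integrable_coef_smul hw hB hG t X), ← map_sum, ← map_smul, ← map_sub,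
    ← map_smul, golfStep, golfMean, smul_sub, smul_smul, Fintype.card_fin, div_mul_cancel₀ _ hm']

/-- Without truncation the mean is exactly `X`. The bias is thus an integral over the truncated set,
where the integrand has norm at most `B² ‖X‖`. -/
theorem hsNorm_sub_golfMean_le (hw : IsTightFrame μ w) (hB : ∀ α, traceNorm (w α) ≤ B)
    (hB0 : 0 ≤ B) (hn : n ≠ 0) (hG : MeasurableSet Gd) {t ε : ℝ} {X : Matrix (Fin n) (Fin n) ℂ}
    (hX : X.IsHermitian) (hbad : μ.real {α | ¬ (α ∈ Gd ∧ |ip (w α) X| ≤ t)} ≤ ε) :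
    hsNorm (X - golfMean μ w Gd t X) ≤ n ^ 2 * ε * B ^ 2 * hsNorm X := by
  have := hw.prob
  have hn' : (n : ℝ) ≠ 0 := Nat.cast_ne_zero.2 hn
  set bad : Set S := {α | ¬ (α ∈ Gd ∧ |ip (w α) X| ≤ t)} with hbaddef
  have hmb : MeasurableSet bad := (hG.inter (measurableSet_le
    (measurable_norm.comp (hw.measurable_ip X)) measurable_const)).compl
  have hi := hw.integrable_smul hB (hw.measurable_ip X) fun α => hw.abs_ip_le hB α X
  have hc := integrable_coef_smul hw hB hG t X
  have h1 : X - golfMean μ w Gd t X =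
      (n : ℝ) ^ 2 • ∫ α, (ip (w α) X • w α - coef w Gd t X α • w α) ∂μ := by
    rw [integral_sub hi hc, smul_sub, hw.integral_ip_smul hB hX, smul_smul,
      mul_inv_cancel₀ (pow_ne_zero 2 hn'), one_smul, golfMean]
  rw [h1, hsNorm_smul, abs_of_nonneg (by positivity)]
  have h2 : hsNorm (∫ α, (ip (w α) X • w α - coef w Gd t X α • w α) ∂μ) ≤
      ε * (B ^ 2 * hsNorm X) := by
    have e := map_integral_matrix (hsVec.restrictScalars ℝ) (hi.sub hc)
    simp only [LinearMap.coe_restrictScalars, Pi.sub_apply] at e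
    rw [hsNorm, e]
    calc ‖∫ α, hsVec (ip (w α) X • w α - coef w Gd t X α • w α) ∂μ‖
        ≤ ∫ α, bad.indicator (fun _ => B ^ 2 * hsNorm X) α ∂μ := by
          refine norm_integral_le_of_norm_le ((integrable_const _).indicator hmb)
            (Filter.Eventually.of_forall fun α => ?_)
          by_cases hα : α ∈ bad
          · rw [Set.indicator_of_mem hα, coef, if_neg hα, zero_smul, sub_zero]
            change hsNorm _ ≤ _
            rw [hsNorm_smul, sq, mul_right_comm]
            exact mul_le_mul (hw.abs_ip_le hB α X) (hw.hsNorm_le hB α) (hsNorm_nonneg _)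
              (mul_nonneg hB0 (hsNorm_nonneg _))
          · rw [Set.indicator_of_notMem hα, coef, if_pos (not_not.1 hα), sub_self, map_zero,
              norm_zero]
      _ = μ.real bad * (B ^ 2 * hsNorm X) := by
          rw [integral_indicator hmb, setIntegral_const, smul_eq_mul]
      _ ≤ ε * (B ^ 2 * hsNorm X) := mul_le_mul_of_nonneg_right hbad
          (mul_nonneg (sq_nonneg _) (hsNorm_nonneg _))
  calc (n : ℝ) ^ 2 * _ ≤ n ^ 2 * (ε * (B ^ 2 * hsNorm X)) :=
        mul_le_mul_of_nonneg_left h2 (by positivity)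
    _ = _ := by ring

/-- The real linear map `X ↦ tang P X`. -/
def tangLin (P : Matrix (Fin n) (Fin n) ℂ) :
    Matrix (Fin n) (Fin n) ℂ →ₗ[ℝ] Matrix (Fin n) (Fin n) ℂ where
  toFun := tang P
  map_add' := tang_add P
  map_smul' c X := tang_smul c P X

variable {P : Matrix (Fin n) (Fin n) ℂ} {θ : ℝ}

/-- Incoherence bounds the squared tangential part of a sample by `θ` times its squared coefficient,
whose mean is at most `‖X‖² / n²`. -/
theorem integral_hsNorm_tang_golfStep_le (hw : IsTightFrame μ w) (hB : ∀ α, traceNorm (w α) ≤ B)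
    (hG : MeasurableSet Gd) (hm : m ≠ 0) (hn : n ≠ 0) (hθ0 : 0 ≤ θ)
    (hθ : ∀ α ∈ Gd, hsNorm (tang P (w α)) ^ 2 ≤ θ)
    {X : Matrix (Fin n) (Fin n) ℂ} (hX : X.IsHermitian) (t : ℝ) :
    Integrable (fun β : Fin m → S => hsNorm (tang P (golfStep w Gd t X β - golfMean μ w Gd t X)))
      (Measure.pi fun _ => μ) ∧
    ∫ β : Fin m → S, hsNorm (tang P (golfStep w Gd t X β - golfMean μ w Gd t X))
      ∂(Measure.pi fun _ => μ) ≤ 2 * √(n ^ 2 * θ / m) * hsNorm X := by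
  have := hw.prob
  have hm' : (0 : ℝ) < m := Nat.cast_pos.2 (Nat.pos_of_ne_zero hm)
  have hn' : (0 : ℝ) < n := Nat.cast_pos.2 (Nat.pos_of_ne_zero hn)
  set l : Matrix (Fin n) (Fin n) ℂ →ₗ[ℝ] EuclideanSpace ℂ (Fin n × Fin n) :=
    (hsVec.restrictScalars ℝ).comp (tangLin P) with hl
  set f : S → EuclideanSpace ℂ (Fin n × Fin n) := fun α => l (coef w Gd t X α • w α) with hf
  have hfi : Integrable f μ := integrable_map_matrix l (integrable_coef_smul hw hB hG t X)
  have hfn : ∀ α, ‖f α‖ ^ 2 ≤ θ * ip (w α) X ^ 2 := by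
    intro α
    have e : ‖f α‖ = |coef w Gd t X α| * hsNorm (tang P (w α)) := by
      rw [hf, ← hsNorm_smul, ← tang_smul]; rfl
    rw [e, mul_pow, sq_abs, mul_comm]
    by_cases hα : α ∈ Gd
    · exact mul_le_mul (hθ α hα) (sq_le_sq.2 (abs_coef_le_abs t X α)) (sq_nonneg _) hθ0
    · rw [coef_eq_zero_of_notMem hα]; simp; positivity
  have hint := (hw.integrable_ip_sq hB X).const_mul θ
  have hf2 : Integrable (fun α => ‖f α‖ ^ 2) μ := hint.mono'
    (hfi.aestronglyMeasurable.norm.pow 2)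
    (Filter.Eventually.of_forall fun α => by rw [Real.norm_of_nonneg (sq_nonneg _)]; exact hfn α)
  have hint2 : ∫ α, ‖f α‖ ^ 2 ∂μ ≤ θ * (hsNorm X ^ 2 / n ^ 2) := by
    rw [← hw.integral_ip_sq hB hX, ← integral_const_mul]
    exact integral_mono hf2 hint hfn
  have key : ∀ β : Fin m → S, hsNorm (tang P (golfStep w Gd t X β - golfMean μ w Gd t X)) =
      (n : ℝ) ^ 2 / m * ‖∑ i, f (β i) - (Fintype.card (Fin m) : ℝ) • ∫ α, f α ∂μ‖ := by
    intro β
    have := map_golfStep_sub_golfMean l hw hB hG hm t X β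
    rw [hsNorm]
    change ‖l _‖ = _
    rw [this, norm_smul, Real.norm_of_nonneg (by positivity)]
  simp only [key]
  constructor
  · refine Integrable.const_mul (Integrable.norm (Integrable.sub ?_ (integrable_const _))) _
    simpa using integrable_sum_comp_eval (κ := Fin m) hfi fun _ => 1
  rw [integral_const_mul]
  calc (n : ℝ) ^ 2 / m * _ ≤ n ^ 2 / m * (2 * √(m * (θ * (hsNorm X ^ 2 / n ^ 2)))) := by
        refine mul_le_mul_of_nonneg_left ?_ (by positivity)
        refine (integral_norm_sum_sub_le_of_inner (κ := Fin m) hfi hf2).trans ?_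
        rw [Fintype.card_fin]
        gcongr
    _ = 2 * √(n ^ 2 * θ / m) * hsNorm X := by
        have e1 : (m : ℝ) * (θ * (hsNorm X ^ 2 / n ^ 2)) =
            (n ^ 2 * θ / m) * (m * hsNorm X / n ^ 2) ^ 2 := by field_simp
        rw [e1, Real.sqrt_mul (by positivity),
          Real.sqrt_sq (div_nonneg (mul_nonneg hm'.le (hsNorm_nonneg _)) (by positivity))]
        field_simp

/-- Here the cut-off at `t` matters: the squared samples are at most `t² w²`, and the mean of `w²`
is `1 / n` times the identity. The bound is proportional to `t` instead of the norm of `X`. -/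
theorem integral_norm_golfStep_le (hw : IsTightFrame μ w) (hB : ∀ α, traceNorm (w α) ≤ B)
    (hG : MeasurableSet Gd) (hm : m ≠ 0) (X : Matrix (Fin n) (Fin n) ℂ)
    {t : ℝ} (ht : 0 ≤ t) {p : ℕ} (hp : p ≠ 0) (hnp : (n : ℝ) ≤ Real.exp p) :
    Integrable (fun β : Fin m → S => ‖golfStep w Gd t X β - golfMean μ w Gd t X‖)
      (Measure.pi fun _ => μ) ∧
    ∫ β : Fin m → S, ‖golfStep w Gd t X β - golfMean μ w Gd t X‖ ∂(Measure.pi fun _ => μ) ≤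
      n ^ 2 / m * (2 * √(6 * p * (2 * (m / n) + 30 * p * B ^ 2))) * t := by
  have := hw.prob
  set f : S → Matrix (Fin n) (Fin n) ℂ := fun α => coef w Gd t X α • w α with hf
  have hfi : Integrable f μ := integrable_coef_smul hw hB hG t X
  have hfH : ∀ α, (f α).IsHermitian := fun α => isHermitian_real_smul (hw.hermitian α) _
  have hfb : ∀ α, ‖f α‖ ≤ t * B := fun α => by
    rw [hf, norm_smul, Real.norm_eq_abs]
    exact mul_le_mul (abs_coef_le ht X α) (hw.norm_le hB α) (norm_nonneg _) ht
  have hf2i : Integrable (fun α => f α ^ 2) μ := by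
    refine Integrable.of_bound ((continuous_pow 2).comp_aestronglyMeasurable hfi.aestronglyMeasurable)
      ((t * B) ^ 2) (Filter.Eventually.of_forall fun α => ?_)
    exact (norm_pow_le' _ (by norm_num)).trans (pow_le_pow_left₀ (norm_nonneg _) (hfb α) 2)
  have hsq : ∀ {A : Matrix (Fin n) (Fin n) ℂ}, A.IsHermitian → (A ^ 2).PosSemidef := by
    intro A hA
    have := Matrix.posSemidef_conjTranspose_mul_self A
    rwa [hA.eq, ← sq] at this
  have hV0 : ‖∫ α, f α ^ 2 ∂μ‖ ≤ t ^ 2 * (n : ℝ)⁻¹ := by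
    refine l2norm_integral_le hf2i (fun α => hsq (hfH α)) (by positivity) fun x => ?_
    have h1 : ∀ α, quadForm x (f α ^ 2) ≤ t ^ 2 * quadForm x (w α ^ 2) := by
      intro α
      have e : f α ^ 2 = (coef w Gd t X α) ^ 2 • w α ^ 2 := by rw [hf, smul_pow]
      rw [e, map_smul, smul_eq_mul]
      refine mul_le_mul_of_nonneg_right ?_ (quadForm_nonneg (hsq (hw.hermitian α)) x)
      rw [← sq_abs]
      exact pow_le_pow_left₀ (abs_nonneg _) (abs_coef_le ht X α) 2
    calc ∫ α, quadForm x (f α ^ 2) ∂μ ≤ ∫ α, t ^ 2 * quadForm x (w α ^ 2) ∂μ :=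
          integral_mono (integrable_map_matrix _ hf2i)
            ((integrable_map_matrix _ (hw.integrable_sq hB)).const_mul _) h1
      _ = t ^ 2 * ((n : ℝ)⁻¹ * quadForm x 1) := by
          rw [integral_const_mul, ← map_integral_matrix _ (hw.integrable_sq hB), hw.integral_sq hB,
            map_smul, smul_eq_mul]
      _ ≤ t ^ 2 * ((n : ℝ)⁻¹ * ‖x‖ ^ 2) := by
          gcongr
          refine (le_abs_self _).trans ((abs_quadForm_le 1 x).trans ?_)
          have : ‖(1 : Matrix (Fin n) (Fin n) ℂ)‖ ≤ 1 := by
            have h : IsProj (1 : Matrix (Fin n) (Fin n) ℂ) :=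
              ⟨Matrix.isHermitian_one, mul_one 1⟩
            exact h.norm_le_one
          exact (mul_le_mul_of_nonneg_right this (by positivity)).trans (one_mul _).le
      _ = _ := by ring
  have hV : ‖(Fintype.card (Fin m) : ℝ) • ∫ α, f α ^ 2 ∂μ‖ ≤ m * (t ^ 2 * (n : ℝ)⁻¹) := by
    rw [norm_smul, Fintype.card_fin, Real.norm_of_nonneg (Nat.cast_nonneg _)]
    exact mul_le_mul_of_nonneg_left hV0 (Nat.cast_nonneg _)
  have key : ∀ β : Fin m → S, ‖golfStep w Gd t X β - golfMean μ w Gd t X‖ =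
      (n : ℝ) ^ 2 / m * ‖∑ i, f (β i) - (Fintype.card (Fin m) : ℝ) • ∫ α, f α ∂μ‖ := by
    intro β
    have := map_golfStep_sub_golfMean LinearMap.id hw hB hG hm t X β
    simp only [LinearMap.id_apply] at this
    rw [this, norm_smul, Real.norm_of_nonneg (by positivity)]
  simp only [key]
  constructor
  · refine Integrable.const_mul (Integrable.norm (Integrable.sub ?_ (integrable_const _))) _
    simpa using integrable_sum_comp_eval (κ := Fin m) hfi fun _ => 1
  rw [integral_const_mul, mul_assoc]
  refine mul_le_mul_of_nonneg_left ?_ (by positivity)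
  refine (integral_norm_sum_sub_le_of_isHermitian (κ := Fin m) hfi.aestronglyMeasurable hfH hfb hV hp
    (by simpa using hnp)).trans (le_of_eq ?_)
  have : 6 * (p : ℝ) * (2 * (m * (t ^ 2 * (n : ℝ)⁻¹)) + 30 * p * (t * B) ^ 2) =
      6 * p * (2 * (m / n) + 30 * p * B ^ 2) * t ^ 2 := by
    rw [div_eq_mul_inv]; ring
  rw [this, Real.sqrt_mul' _ (sq_nonneg t), Real.sqrt_sq ht, ← mul_assoc]

theorem measureReal_le_abs_ip_tang_golfStep_le (hw : IsTightFrame μ w)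
    (hB : ∀ α, traceNorm (w α) ≤ B) (hG : MeasurableSet Gd) (hm : m ≠ 0) (hn : n ≠ 0)
    (hP : IsProj P) (hθ : ∀ α ∈ Gd, hsNorm (tang P (w α)) ^ 2 ≤ θ) {L : ℝ} (hL : 0 < L)
    (hmL : n ^ 2 * θ * L ≤ m) (X : Matrix (Fin n) (Fin n) ℂ) {t : ℝ} (ht : 0 < t) {α₀ : S}
    (hα₀ : α₀ ∈ Gd) :
    (Measure.pi fun _ : Fin m => μ).real
      {β | t / 4 ≤ |ip (w α₀) (tang P (golfStep w Gd t X β - golfMean μ w Gd t X))|} ≤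
      2 * Real.exp (-L / 64) := by
  have := hw.prob
  have hm' : (0 : ℝ) < m := Nat.cast_pos.2 (Nat.pos_of_ne_zero hm)
  have hn' : (0 : ℝ) < n := Nat.cast_pos.2 (Nat.pos_of_ne_zero hn)
  have hθ0 : 0 ≤ θ := (sq_nonneg _).trans (hθ α₀ hα₀)
  set Z := tang P (w α₀) with hZ
  have hZH : Z.IsHermitian := hP.isHermitian_tang (hw.hermitian α₀)
  have hq : n ^ 2 / m * θ ≤ 1 / L := by
    rw [div_mul_eq_mul_div, div_le_div_iff₀ hm' hL, one_mul]; exact hmL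
  set ξ : S → ℝ := fun α => (n : ℝ) ^ 2 / m * (coef w Gd t X α * ip (w α) Z) with hξ
  have hmeas : Measurable ξ :=
    ((measurable_coef hw hG t X).mul (hw.measurable_ip Z)).const_mul _
  have hb : ∀ α, |ξ α| ≤ t / L := by
    intro α
    rw [hξ, abs_mul, abs_mul, abs_of_nonneg (by positivity : (0 : ℝ) ≤ n ^ 2 / m)]
    by_cases hα : α ∈ Gd
    -- Moving the tangential projection onto `w α` as well gives one factor `√θ` from each side.
    · have h1 : |ip (w α) Z| ≤ θ := by
        rw [hZ, ← hP.tang_tang, ← hP.ip_tang_left]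
        refine (abs_ip_le _ _).trans ?_
        have := mul_le_mul (Real.le_sqrt_of_sq_le (hθ α hα)) (Real.le_sqrt_of_sq_le (hθ α₀ hα₀))
          (hsNorm_nonneg _) (Real.sqrt_nonneg _)
        rwa [Real.mul_self_sqrt hθ0] at this
      calc (n : ℝ) ^ 2 / m * (|coef w Gd t X α| * |ip (w α) Z|) ≤ n ^ 2 / m * (t * θ) := by
            refine mul_le_mul_of_nonneg_left ?_ (by positivity)
            exact mul_le_mul (abs_coef_le ht.le X α) h1 (abs_nonneg _) ht.le
        _ = t * (n ^ 2 / m * θ) := by ring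
        _ ≤ t * (1 / L) := mul_le_mul_of_nonneg_left hq ht.le
        _ = t / L := by ring
    · rw [coef_eq_zero_of_notMem hα]; simp; positivity
  have hξ2 : ∀ α, ξ α ^ 2 ≤ (n ^ 2 / m * t) ^ 2 * ip (w α) Z ^ 2 := by
    intro α
    change (_ * (_ * _)) ^ 2 ≤ _
    rw [← mul_assoc, mul_pow]
    refine mul_le_mul_of_nonneg_right ?_ (sq_nonneg _)
    rw [mul_pow, mul_pow]
    refine mul_le_mul_of_nonneg_left ?_ (sq_nonneg _)
    rw [← sq_abs]
    exact pow_le_pow_left₀ (abs_nonneg _) (abs_coef_le ht.le X α) 2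
  have hv : ∫ α, ξ α ^ 2 ∂μ ≤ t ^ 2 / (L * m) := by
    calc ∫ α, ξ α ^ 2 ∂μ ≤ ∫ α, (n ^ 2 / m * t) ^ 2 * ip (w α) Z ^ 2 ∂μ := by
          refine integral_mono ?_ ((hw.integrable_ip_sq hB Z).const_mul _) hξ2
          refine Integrable.of_bound (hmeas.pow_const 2).aestronglyMeasurable ((t / L) ^ 2)
            (Filter.Eventually.of_forall fun α => ?_)
          rw [norm_pow]
          exact pow_le_pow_left₀ (norm_nonneg _) (hb α) 2
      _ = (n ^ 2 / m * t) ^ 2 * (hsNorm Z ^ 2 / n ^ 2) := by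
          rw [integral_const_mul, hw.integral_ip_sq hB hZH]
      _ ≤ (n ^ 2 / m * t) ^ 2 * (θ / n ^ 2) := by gcongr; exact hθ α₀ hα₀
      _ = (n ^ 2 / m * θ) * (t ^ 2 / m) := by field_simp
      _ ≤ (1 / L) * (t ^ 2 / m) := by gcongr
      _ = t ^ 2 / (L * m) := by field_simp
  -- With bound `t / L` and variance `t² / (L m)` per sample, this choice gives the exponent `-L /
  -- 32 + L / 64`.
  have hbern := measureReal_le_abs_sum_sub_le (κ := Fin m) (x := t / 4) (θ := L / (8 * t))
    hmeas.aestronglyMeasurable hb hv (by positivity) (by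
      have : 2 * (t / L) * (L / (8 * t)) = 1 / 4 := by field_simp; norm_num
      rw [this]; norm_num)
  have hexp : -(L / (8 * t)) * (t / 4) + (Fintype.card (Fin m) : ℝ) *
      ((L / (8 * t)) ^ 2 * (t ^ 2 / (L * m))) = -L / 64 := by
    rw [Fintype.card_fin]; field_simp; norm_num
  rw [hexp] at hbern
  have key : ∀ β : Fin m → S, ip (w α₀) (tang P (golfStep w Gd t X β - golfMean μ w Gd t X)) =
      ∑ i, ξ (β i) - (Fintype.card (Fin m) : ℝ) * ∫ α, ξ α ∂μ := by
    intro β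
    have := map_golfStep_sub_golfMean (ipLin Z) hw hB hG hm t X β
    rw [← hP.ip_tang_left]
    change ipLin Z _ = _
    rw [this]
    have e : ∀ α, ξ α = n ^ 2 / m * ipLin Z (coef w Gd t X α • w α) := by
      intro α
      rw [map_smul, smul_eq_mul]
      change _ = _ * (_ * ip Z (w α))
      rw [ip_comm]
    simp only [e]
    rw [integral_const_mul, ← Finset.mul_sum, smul_eq_mul, smul_eq_mul]
    ring
  simp only [key]
  exact hbern

end Step

end CompressedSensing

/-! ### The golfing scheme. -/

namespace CompressedSensing

set_option linter.unusedSectionVars false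

open scoped Matrix.Norms.L2Operator

theorem measureReal_pi_succ_le {Ω : Type*} [MeasurableSpace Ω] (ν : Measure Ω)
    [IsProbabilityMeasure ν] {l : ℕ} {E : Set (Ω × (Fin l → Ω))} (hE : MeasurableSet E)
    {D : Set Ω} {a b : ℝ} (hD : ν.real D ≤ a) (hb : 0 ≤ b)
    (h : ∀ x ∉ D, (Measure.pi fun _ : Fin l => ν).real {y | (x, y) ∈ E} ≤ b) :
    (Measure.pi fun _ : Fin (l + 1) => ν).real {ω | (ω 0, fun i => ω (Fin.succ i)) ∈ E} ≤ a + b := by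
  have h1 := measurePreserving_piFinSuccAbove (fun _ : Fin (l + 1) => ν) 0
  have h2 : (Measure.pi fun _ : Fin (l + 1) => ν).real {ω | (ω 0, fun i => ω (Fin.succ i)) ∈ E} =
      (ν.prod (Measure.pi fun _ : Fin l => ν)).real E := by
    rw [Measure.real, Measure.real, ← h1.measure_preimage hE.nullMeasurableSet]
    rfl
  rw [h2, Measure.real, Measure.prod_apply hE]
  have ha : 0 ≤ a := measureReal_nonneg.trans hD
  refine ENNReal.toReal_le_of_le_ofReal (by positivity) ?_
  calc ∫⁻ x, (Measure.pi fun _ : Fin l => ν) (Prod.mk x ⁻¹' E) ∂ν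
      ≤ ∫⁻ x, ((toMeasurable ν D).indicator 1 x + ENNReal.ofReal b) ∂ν := by
        -- The exceptional set `D` is replaced by a measurable hull, since it need not be measurable
        -- itself.
        refine lintegral_mono fun x => ?_
        by_cases hx : x ∈ D
        · rw [Set.indicator_of_mem (subset_toMeasurable _ _ hx)]
          exact prob_le_one.trans (le_add_of_nonneg_right zero_le)
        · refine le_trans ?_ (le_add_of_nonneg_left zero_le)
          rw [← ofReal_measureReal]
          exact ENNReal.ofReal_le_ofReal (h x hx)
    _ = ν D + ENNReal.ofReal b := by
        rw [lintegral_add_right _ measurable_const, lintegral_indicator_one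
          (measurableSet_toMeasurable _ _), measure_toMeasurable]
        simp
    _ ≤ ENNReal.ofReal (a + b) := by
        rw [ENNReal.ofReal_add ha hb, ← ofReal_measureReal]
        gcongr

/-- The parameters of a golfing scheme. -/
structure IsGolfScheme {S : Type*} [MeasurableSpace S] {n : ℕ} (μ : Measure S)
    (w : S → Matrix (Fin n) (Fin n) ℂ) (P : Matrix (Fin n) (Fin n) ℂ) (Gd : Set S) (m p : ℕ)
    (B θ L ε γ δ q : ℝ) : Prop where
  frame : IsTightFrame μ w
  traceNorm_le : ∀ α, traceNorm (w α) ≤ B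
  nonneg : 0 ≤ B
  dim : n ≠ 0
  card : m ≠ 0
  proj : IsProj P
  measurableSet : MeasurableSet Gd
  exponent : p ≠ 0
  dim_le : (n : ℝ) ≤ Real.exp p
  pos_L : 0 < L
  pos_ε : 0 < ε
  pos_γ : 0 < γ
  pos_q : 0 < q
  nonneg_δ : 0 ≤ δ
  nonneg_θ : 0 ≤ θ
  incoherent : ∀ α ∈ Gd, hsNorm (tang P (w α)) ^ 2 ≤ θ
  compl : μ.real Gdᶜ ≤ ε / 2
  card_ge : n ^ 2 * θ * L ≤ m
  -- At scale `t` the residual has Hilbert-Schmidt norm at most `q t`, and the batch may err by `γ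
  -- t` in operator norm. Half of each error budget is for the truncation bias and half for the
  -- fluctuations. Each of three types of fluctuation has failure probability at most `δ`.
  bias_ip : 4 * (n ^ 2 * ε * B ^ 3) * q ≤ 1
  bias_hs : 4 * (n ^ 2 * ε * B ^ 2) ≤ 1
  bias_op : 2 * (n ^ 2 * ε * B ^ 2) * q ≤ γ
  fluct_hs : 8 * √(n ^ 2 * θ / m) ≤ δ
  fluct_ip : 4 / ε * Real.exp (-L / 64) ≤ δ
  fluct_op : 2 * (n ^ 2 / m * (2 * √(6 * p * (2 * (m / n) + 30 * p * B ^ 2)))) ≤ δ * γ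

section

variable {S : Type*} [MeasurableSpace S] {n : ℕ} {μ : Measure S}
  {w : S → Matrix (Fin n) (Fin n) ℂ} {P : Matrix (Fin n) (Fin n) ℂ} {Gd : Set S} {m p : ℕ}
  {B θ L ε γ δ q : ℝ}

/-- The loop invariant of golfing: the norm bound and the bound on the overlaps with most good
observables pass to the new residual with `t / 2` in place of `t`. Requiring the overlap bound for
all but a small fraction of the observables, instead of all, avoids a union bound over the frame,
which may be infinite. -/
theorem IsGolfScheme.measureReal_step_le (h : IsGolfScheme μ w P Gd m p B θ L ε γ δ q)
    {X : Matrix (Fin n) (Fin n) ℂ} (hX : X.IsHermitian) {t : ℝ} (ht : 0 < t)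
    (hXσ : hsNorm X ≤ q * t) (hXt : μ.real {α | α ∈ Gd ∧ t < |ip (w α) X|} ≤ ε / 2) :
    (Measure.pi fun _ : Fin m => μ).real {β |
      ¬ (hsNorm (tang P (X - golfStep w Gd t X β)) ≤ q * (t / 2) ∧
        μ.real {α | α ∈ Gd ∧ t / 2 < |ip (w α) (tang P (X - golfStep w Gd t X β))|} ≤ ε / 2 ∧
        ‖golfStep w Gd t X β - X‖ ≤ γ * t)} ≤ 3 * δ := by
  have := h.frame.prob
  have hq := h.pos_q
  have hγ := h.pos_γ
  have hε := h.pos_ε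
  have hn' : (0 : ℝ) < n := Nat.cast_pos.2 (Nat.pos_of_ne_zero h.dim)
  have hB0 := h.nonneg
  set M := golfMean μ w Gd t X with hM
  have hbad : μ.real {α | ¬ (α ∈ Gd ∧ |ip (w α) X| ≤ t)} ≤ ε := by
    have hsub : {α | ¬ (α ∈ Gd ∧ |ip (w α) X| ≤ t)} ⊆ Gdᶜ ∪ {α | α ∈ Gd ∧ t < |ip (w α) X|} := by
      intro α hα
      by_cases hg : α ∈ Gd
      · exact Or.inr ⟨hg, not_le.1 fun h' => hα ⟨hg, h'⟩⟩
      · exact Or.inl hg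
    refine (measureReal_mono hsub).trans ((measureReal_union_le _ _).trans ?_)
    linarith [h.compl]
  have hbias : hsNorm (X - M) ≤ n ^ 2 * ε * B ^ 2 * (q * t) :=
    (hsNorm_sub_golfMean_le h.frame h.traceNorm_le hB0 h.dim h.measurableSet hX hbad).trans
      (mul_le_mul_of_nonneg_left hXσ (by positivity))
  have hb1 : B * hsNorm (X - M) ≤ t / 4 := by
    have := mul_le_mul_of_nonneg_left hbias hB0
    have h2 := mul_le_mul_of_nonneg_right h.bias_ip ht.le
    nlinarith
  have hb2 : hsNorm (X - M) ≤ q * t / 4 := by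
    have h2 := mul_le_mul_of_nonneg_right h.bias_hs (mul_pos hq ht).le
    nlinarith
  have hb3 : hsNorm (X - M) ≤ γ * t / 2 := by
    have h2 := mul_le_mul_of_nonneg_right h.bias_op ht.le
    nlinarith
  set A₁ : Set (Fin m → S) := {β | q * t / 4 ≤ hsNorm (tang P (golfStep w Gd t X β - M))} with hA₁
  -- The fluctuations of the overlaps: Bernstein applies for each `α`, and Fubini with Markov passes
  -- to the fraction of bad `α`.
  set A₂ : Set (Fin m → S) := {β | ε / 2 < μ.real {α | (β, α) ∈ {z : (Fin m → S) × S | z.2 ∈ Gd ∧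
    t / 4 ≤ |ip (w z.2) (tang P (golfStep w Gd t X z.1 - M))|}}} with hA₂
  set A₃ : Set (Fin m → S) := {β | γ * t / 2 ≤ ‖golfStep w Gd t X β - M‖} with hA₃
  have hsub : {β : Fin m → S |
      ¬ (hsNorm (tang P (X - golfStep w Gd t X β)) ≤ q * (t / 2) ∧
        μ.real {α | α ∈ Gd ∧ t / 2 < |ip (w α) (tang P (X - golfStep w Gd t X β))|} ≤ ε / 2 ∧
        ‖golfStep w Gd t X β - X‖ ≤ γ * t)} ⊆ A₁ ∪ A₂ ∪ A₃ := by
    intro β hβ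
    by_contra hcon
    simp only [Set.mem_union, not_or] at hcon
    obtain ⟨⟨h1, h2⟩, h3⟩ := hcon
    simp only [hA₁, hA₂, hA₃, Set.mem_ofPred_eq, not_le, not_lt] at h1 h2 h3
    have e : X - golfStep w Gd t X β = (X - M) - (golfStep w Gd t X β - M) := by abel
    refine hβ ⟨?_, ?_, ?_⟩
    · rw [e, tang_sub, sub_eq_add_neg]
      refine (hsNorm_add_le _ _).trans ?_
      have : hsNorm (-tang P (golfStep w Gd t X β - M)) =
        hsNorm (tang P (golfStep w Gd t X β - M)) := by
        rw [hsNorm, map_neg, norm_neg]; rfl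
      rw [this]
      have := h.proj.hsNorm_tang_le (X - M)
      linarith
    · refine (measureReal_mono fun α hα => ?_).trans h2
      refine ⟨hα.1, ?_⟩
      have h4 := hα.2
      rw [e, tang_sub, ip_sub_right] at h4
      have h5 := abs_sub (ip (w α) (tang P (X - M))) (ip (w α) (tang P (golfStep w Gd t X β - M)))
      have h6 := (h.frame.abs_ip_le h.traceNorm_le α (tang P (X - M))).trans
        (mul_le_mul_of_nonneg_left (h.proj.hsNorm_tang_le (X - M)) hB0)
      change t / 4 ≤ |ip (w α) (tang P (golfStep w Gd t X β - M))|
      linarith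
    · have e' : golfStep w Gd t X β - X = (golfStep w Gd t X β - M) - (X - M) := by abel
      rw [e']
      refine (norm_sub_le _ _).trans ?_
      have := l2norm_le_hsNorm (X - M)
      linarith
  have p1 : (Measure.pi fun _ : Fin m => μ).real A₁ ≤ δ := by
    obtain ⟨hi, hle⟩ := integral_hsNorm_tang_golfStep_le (m := m) h.frame h.traceNorm_le
      h.measurableSet h.card h.dim h.nonneg_θ h.incoherent hX t
    have h4 := mul_meas_ge_le_integral_of_nonneg
      (Filter.Eventually.of_forall fun β => hsNorm_nonneg _) hi (q * t / 4)
    have h5 : 2 * √(n ^ 2 * θ / m) * hsNorm X ≤ (q * t / 4) * δ := by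
      have := mul_le_mul_of_nonneg_left hXσ
        (by positivity : 0 ≤ 2 * √((n : ℝ) ^ 2 * θ / m))
      have h6 := mul_le_mul_of_nonneg_right h.fluct_hs (mul_pos hq ht).le
      linarith
    exact le_of_mul_le_mul_left (h4.trans (hle.trans h5)) (by positivity)
  have p2 : (Measure.pi fun _ : Fin m => μ).real A₂ ≤ δ := by
    have hmeas : MeasurableSet {z : (Fin m → S) × S | z.2 ∈ Gd ∧
        t / 4 ≤ |ip (w z.2) (tang P (golfStep w Gd t X z.1 - M))|} := by
      have h1 : Measurable fun z : (Fin m → S) × S =>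
        ip (w z.2) (tang P (golfStep w Gd t X z.1 - M)) := ?_
      · exact (measurable_snd h.measurableSet).inter
          (measurableSet_le measurable_const (measurable_norm.comp h1))
      refine measurable_ip_comp (h.frame.measurable_frame.comp measurable_snd) ?_
      have hg := measurable_golfStep_comp h.frame h.measurableSet t
        (measurable_const (a := X)) (measurable_fst (α := Fin m → S) (β := S))
      exact (continuous_tang P).measurable.comp (hg.sub_const M)
    refine (measureReal_lt_measureReal_le hmeas (δ := 2 * Real.exp (-L / 64)) (half_pos hε)
      fun α => ?_).trans ?_
    · by_cases hα : α ∈ Gd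
      · refine (measureReal_mono fun β hβ => ?_).trans
          (measureReal_le_abs_ip_tang_golfStep_le h.frame h.traceNorm_le h.measurableSet h.card h.dim
            h.proj h.incoherent h.pos_L h.card_ge X ht hα)
        exact hβ.2
      · have : {ω : Fin m → S | (ω, α) ∈ {z : (Fin m → S) × S | z.2 ∈ Gd ∧
            t / 4 ≤ |ip (w z.2) (tang P (golfStep w Gd t X z.1 - M))|}} = ∅ := by
          ext ω; simp [hα]
        rw [this, measureReal_empty]; positivity
    · refine le_trans (le_of_eq ?_) h.fluct_ip
      field_simp; norm_num
  have p3 : (Measure.pi fun _ : Fin m => μ).real A₃ ≤ δ := by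
    obtain ⟨hi, hle⟩ := integral_norm_golfStep_le (m := m) h.frame h.traceNorm_le
      h.measurableSet h.card X ht.le h.exponent h.dim_le
    have h4 := mul_meas_ge_le_integral_of_nonneg
      (Filter.Eventually.of_forall fun β => norm_nonneg _) hi (γ * t / 2)
    have h6 := mul_le_mul_of_nonneg_right h.fluct_op ht.le
    refine le_of_mul_le_mul_left (h4.trans (hle.trans ?_)) (by positivity : 0 < γ * t / 2)
    linarith
  calc _ ≤ (Measure.pi fun _ : Fin m => μ).real (A₁ ∪ A₂ ∪ A₃) := measureReal_mono hsub
    _ ≤ δ + δ + δ := (measureReal_union_le _ _).trans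
        (add_le_add ((measureReal_union_le _ _).trans (add_le_add p1 p2)) p3)
    _ = 3 * δ := by ring

/-- The approximate dual certificate built from `l` independent batches of samples. -/
noncomputable def golf (w : S → Matrix (Fin n) (Fin n) ℂ) (P : Matrix (Fin n) (Fin n) ℂ)
    (Gd : Set S) : (l : ℕ) → ℝ → Matrix (Fin n) (Fin n) ℂ → (Fin l → Fin m → S) →
      Matrix (Fin n) (Fin n) ℂ
  | 0, _, _, _ => 0
  | l + 1, t, X, ω => golfStep w Gd t X (ω 0) +
      golf w P Gd l (t / 2) (tang P (X - golfStep w Gd t X (ω 0))) fun i => ω (Fin.succ i)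

theorem measurable_golf_comp (hw : IsTightFrame μ w) (hG : MeasurableSet Gd) (l : ℕ) (t : ℝ)
    {Ω : Type*} [MeasurableSpace Ω] {f : Ω → Matrix (Fin n) (Fin n) ℂ} {g : Ω → Fin l → Fin m → S}
    (hf : Measurable f) (hg : Measurable g) :
    Measurable fun x => golf w P Gd l t (f x) (g x) := by
  induction l generalizing t f with
  | zero => exact measurable_const
  | succ l ih =>
    have h0 : Measurable fun x => golfStep w Gd t (f x) (g x 0) :=
      measurable_golfStep_comp hw hG t hf ((measurable_pi_apply 0).comp hg)
    exact h0.add (ih (t / 2) ((continuous_tang P).measurable.comp (hf.sub h0))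
      (measurable_pi_lambda _ fun i => (measurable_pi_apply (Fin.succ i)).comp hg))

theorem exists_golf_eq_sum (l : ℕ) (t : ℝ) (X : Matrix (Fin n) (Fin n) ℂ)
    (ω : Fin l → Fin m → S) :
    ∃ c : Fin l → Fin m → ℝ, golf w P Gd l t X ω = ∑ j, ∑ i, c j i • w (ω j i) := by
  induction l generalizing t X with
  | zero => exact ⟨fun _ _ => 0, by simp [golf]⟩
  | succ l ih =>
    obtain ⟨c, hc⟩ := ih (t / 2) (tang P (X - golfStep w Gd t X (ω 0))) fun i => ω (Fin.succ i)
    refine ⟨Fin.cons (fun i => (n : ℝ) ^ 2 / m * coef w Gd t X (ω 0 i)) c, ?_⟩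
    rw [golf, hc, Fin.sum_univ_succ, golfStep, Finset.smul_sum]
    simp [smul_smul]

/-- The tangential error halves at every batch, and the operator-norm errors form a geometric series
with sum below `2 γ t`. Only the initial `X` contributes a complementary part, because later
residuals are tangential. -/
theorem IsGolfScheme.measureReal_golf_le (h : IsGolfScheme μ w P Gd m p B θ L ε γ δ q) (l : ℕ)
    {X : Matrix (Fin n) (Fin n) ℂ} (hX : X.IsHermitian) {t : ℝ} (ht : 0 < t)
    (hXσ : hsNorm X ≤ q * t) (hXt : μ.real {α | α ∈ Gd ∧ t < |ip (w α) X|} ≤ ε / 2) :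
    (Measure.pi fun _ : Fin l => Measure.pi fun _ : Fin m => μ).real {ω |
      ¬ (hsNorm (tang P X - tang P (golf w P Gd l t X ω)) ≤ q * t / 2 ^ l ∧
        ‖perp P (golf w P Gd l t X ω)‖ ≤ 2 * γ * t + ‖perp P X‖)} ≤ 3 * δ * l := by
  have := h.frame.prob
  have hδ := h.nonneg_δ
  have hγ := h.pos_γ
  induction l generalizing t X with
  | zero =>
    have : {ω : Fin 0 → Fin m → S |
      ¬ (hsNorm (tang P X - tang P (golf w P Gd 0 t X ω)) ≤ q * t / 2 ^ 0 ∧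
        ‖perp P (golf w P Gd 0 t X ω)‖ ≤ 2 * γ * t + ‖perp P X‖)} = ∅ := by
      refine Set.eq_empty_of_forall_notMem fun ω hω => hω ⟨?_, ?_⟩
      · have e : tang P (0 : Matrix (Fin n) (Fin n) ℂ) = 0 := by simp [tang]
        rw [golf, e, sub_zero, pow_zero, div_one]
        exact (h.proj.hsNorm_tang_le X).trans hXσ
      · have e : perp P (0 : Matrix (Fin n) (Fin n) ℂ) = 0 := by simp [perp]
        rw [golf, e, norm_zero]; positivity
    rw [this]; simp
  | succ l ih =>
    set E : Set ((Fin m → S) × (Fin l → Fin m → S)) := {z |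
      ¬ (hsNorm (tang P X - tang P (golfStep w Gd t X z.1 +
          golf w P Gd l (t / 2) (tang P (X - golfStep w Gd t X z.1)) z.2)) ≤ q * t / 2 ^ (l + 1) ∧
        ‖perp P (golfStep w Gd t X z.1 +
          golf w P Gd l (t / 2) (tang P (X - golfStep w Gd t X z.1)) z.2)‖ ≤
          2 * γ * t + ‖perp P X‖)} with hE
    have hEm : MeasurableSet E := by
      have h0 := measurable_golfStep_comp h.frame h.measurableSet t
        (measurable_const (a := X)) (measurable_fst (α := Fin m → S) (β := Fin l → Fin m → S))
      have h1 := measurable_golf_comp (P := P) h.frame h.measurableSet l (t / 2)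
        ((continuous_tang P).measurable.comp (h0.const_sub X))
        (measurable_snd (α := Fin m → S) (β := Fin l → Fin m → S))
      have h2 := h0.add h1
      refine MeasurableSet.compl (MeasurableSet.inter ?_ ?_)
      · exact measurableSet_le (continuous_hsNorm.measurable.comp
          (((continuous_tang P).measurable.comp h2).const_sub _)) measurable_const
      · exact measurableSet_le (measurable_l2norm.comp ((continuous_perp P).measurable.comp h2))
          measurable_const
    have key := measureReal_pi_succ_le (Measure.pi fun _ : Fin m => μ) hEm
      (h.measureReal_step_le hX ht hXσ hXt) (b := 3 * δ * l) (by positivity) fun β hβ => by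
        simp only [Set.mem_ofPred_eq, not_not] at hβ
        obtain ⟨h1, h2, h3⟩ := hβ
        set X' := tang P (X - golfStep w Gd t X β) with hX'
        have hH : X'.IsHermitian :=
          h.proj.isHermitian_tang (hX.sub (isHermitian_golfStep h.frame t X β))
        refine (measureReal_mono fun ω hω => ?_).trans (ih hH (half_pos ht) h1 h2)
        intro hcon
        obtain ⟨k1, k2⟩ := hcon
        refine hω ⟨?_, ?_⟩
        · have e : tang P X - tang P (golfStep w Gd t X β + golf w P Gd l (t / 2) X' ω) =
              tang P X' - tang P (golf w P Gd l (t / 2) X' ω) := by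
            rw [hX', h.proj.tang_tang, tang_sub, tang_add]; abel
          change hsNorm (tang P X - tang P (golfStep w Gd t X β + golf w P Gd l (t / 2) X' ω)) ≤ _
          rw [e]
          refine k1.trans (le_of_eq ?_)
          rw [pow_succ]; field_simp
        · change ‖perp P (golfStep w Gd t X β + golf w P Gd l (t / 2) X' ω)‖ ≤ _
          have e0 : perp P X' = 0 := h.proj.perp_tang _
          rw [e0, norm_zero, add_zero] at k2
          have e : perp P (golfStep w Gd t X β + golf w P Gd l (t / 2) X' ω) =
              perp P (golfStep w Gd t X β - X) + perp P X + perp P (golf w P Gd l (t / 2) X' ω) := by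
            rw [perp_sub, perp_add]; abel
          rw [e]
          refine (norm_add_le _ _).trans ?_
          have := norm_add_le (perp P (golfStep w Gd t X β - X)) (perp P X)
          have h4 := (h.proj.norm_perp_le (golfStep w Gd t X β - X)).trans h3
          linarith
    refine le_trans (le_of_eq ?_) (key.trans (le_of_eq ?_))
    · rfl
    · push_cast; ring

theorem map_uncurry_pi_pi {S : Type*} [MeasurableSpace S] (μ : Measure S) [IsProbabilityMeasure μ]
    (l m : ℕ) : (Measure.pi fun _ : Fin l => Measure.pi fun _ : Fin m => μ).map
      (fun ω (i : Fin (l * m)) => ω (finProdFinEquiv.symm i).1 (finProdFinEquiv.symm i).2) =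
      Measure.pi fun _ : Fin (l * m) => μ := by
  symm
  refine Measure.pi_eq fun s hs => ?_
  rw [Measure.map_apply _ (MeasurableSet.univ_pi hs)]
  · have : (fun (ω : Fin l → Fin m → S) (i : Fin (l * m)) =>
        ω (finProdFinEquiv.symm i).1 (finProdFinEquiv.symm i).2) ⁻¹' Set.univ.pi s =
        Set.univ.pi fun j => Set.univ.pi fun i => s (finProdFinEquiv (j, i)) := by
      ext ω
      simp only [Set.mem_preimage, Set.mem_univ_pi]
      constructor
      · intro h j i
        simpa using h (finProdFinEquiv (j, i))
      · intro h i
        have := h (finProdFinEquiv.symm i).1 (finProdFinEquiv.symm i).2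
        rwa [Prod.mk.eta, Equiv.apply_symm_apply] at this
    rw [this, Measure.pi_pi]
    simp only [Measure.pi_pi]
    rw [← Fintype.prod_prod_type', ← finProdFinEquiv.prod_comp]
  · exact measurable_pi_lambda _ fun i => (measurable_pi_apply _).comp (measurable_pi_apply _)

/-- The reindexing is a measurable equivalence, so the comparison holds for every set `F`. This
matters since failure events are not known to be measurable. -/
theorem measureReal_pi_mul {S : Type*} [MeasurableSpace S] (μ : Measure S) [IsProbabilityMeasure μ]
    (l m : ℕ) (F : Set (Fin (l * m) → S)) :
    (Measure.pi fun _ : Fin (l * m) => μ).real F ≤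
      (Measure.pi fun _ : Fin l => Measure.pi fun _ : Fin m => μ).real
        {ω | (fun i : Fin (l * m) => ω (finProdFinEquiv.symm i).1 (finProdFinEquiv.symm i).2) ∈ F} := by
  have h1 : Measurable fun (ω : Fin l → Fin m → S) (i : Fin (l * m)) =>
      ω (finProdFinEquiv.symm i).1 (finProdFinEquiv.symm i).2 :=
    measurable_pi_lambda _ fun i => (measurable_pi_apply _).comp (measurable_pi_apply _)
  have h2 : Measurable fun (x : Fin (l * m) → S) (j : Fin l) (i : Fin m) =>
      x (finProdFinEquiv (j, i)) :=
    measurable_pi_lambda _ fun j => measurable_pi_lambda _ fun i => measurable_pi_apply _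
  set e : (Fin l → Fin m → S) ≃ᵐ (Fin (l * m) → S) :=
    { toFun := fun ω i => ω (finProdFinEquiv.symm i).1 (finProdFinEquiv.symm i).2
      invFun := fun x j i => x (finProdFinEquiv (j, i))
      left_inv := fun ω => by ext j i; simp
      right_inv := fun x => funext fun i => by
        change x (finProdFinEquiv ((finProdFinEquiv.symm i).1, (finProdFinEquiv.symm i).2)) = x i
        rw [Prod.mk.eta, Equiv.apply_symm_apply]
      measurable_toFun := h1
      measurable_invFun := h2 } with he
  rw [← map_uncurry_pi_pi μ l m]
  have := e.map_apply (μ := Measure.pi fun _ : Fin l => Measure.pi fun _ : Fin m => μ) F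
  exact le_of_eq (congrArg ENNReal.toReal this)

end

end CompressedSensing

/-! ### Control of the kernel, and reconstruction for a fixed incoherent state. -/

namespace CompressedSensing

set_option linter.unusedSectionVars false

open scoped Matrix.Norms.L2Operator

section

variable {S : Type*} [MeasurableSpace S] {n : ℕ} {μ : Measure S}
  {w : S → Matrix (Fin n) (Fin n) ℂ} {P : Matrix (Fin n) (Fin n) ℂ} {Gd : Set S} {m p : ℕ}
  {B θ : ℝ}

theorem hsVec_surjective : Function.Surjective (hsVec (n := n)) := fun x =>
  ⟨fun i j => x (i, j), by ext ⟨i, j⟩; rfl⟩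

theorem continuous_hsVec : Continuous (hsVec (n := n)) := LinearMap.continuous_of_finiteDimensional _

/-- On the tangent space the empirical second moments are close to their mean. If all outcomes on
`δ` vanish, its tangential and complementary parts have opposite outcomes, and those of the latter
are at most `B ‖perp P δ‖`. -/
theorem measureReal_not_tang_le_perp_le (hw : IsTightFrame μ w) (hB : ∀ α, traceNorm (w α) ≤ B)
    (hB0 : 0 ≤ B) (hn : n ≠ 0) (hm : m ≠ 0) (hp : p ≠ 0) (hnp : (n : ℝ) ≤ Real.exp p)
    (hP : IsProj P) (hG : MeasurableSet Gd) (hθ0 : 0 ≤ θ)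
    (hθ : ∀ α ∈ Gd, hsNorm (tang P (w α)) ^ 2 ≤ θ)
    (hbad : 4 * (n ^ 2 * μ.real Gdᶜ * B ^ 2) ≤ 1)
    (hmp : 2 ^ 15 * (12 * p * (n ^ 2 * θ)) ≤ m) :
    (Measure.pi fun _ : Fin m => μ).real {β | ¬ ∀ δ : Matrix (Fin n) (Fin n) ℂ, δ.IsHermitian →
      (∀ i, ip (w (β i)) δ = 0) → hsNorm (tang P δ) ≤ 2 * n * B * hsNorm (perp P δ)} ≤ 1 / 8 := by
  have := hw.prob
  have : Nonempty (Fin m) := ⟨⟨0, Nat.pos_of_ne_zero hm⟩⟩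
  have hm' : (0 : ℝ) < m := Nat.cast_pos.2 (Nat.pos_of_ne_zero hm)
  have hn' : (0 : ℝ) < n := Nat.cast_pos.2 (Nat.pos_of_ne_zero hn)
  set u : S → EuclideanSpace ℂ (Fin n × Fin n) := Gd.indicator fun α => hsVec (tang P (w α)) with hu
  have hum : Measurable u := Measurable.indicator (continuous_hsVec.measurable.comp
    ((continuous_tang P).measurable.comp hw.measurable_frame)) hG
  have hin : ∀ α X, ‖(inner ℂ (u α) (hsVec X) : ℂ)‖ ^ 2 =
      Gd.indicator (fun α => ‖hsInner (w α) (tang P X)‖ ^ 2) α := by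
    intro α X
    by_cases hα : α ∈ Gd
    · rw [hu, Set.indicator_of_mem hα, Set.indicator_of_mem hα, inner_hsVec, hP.hsInner_tang_left]
    · rw [hu, Set.indicator_of_notMem hα, Set.indicator_of_notMem hα]; simp
  have hint : ∀ X, Integrable (fun α => ‖hsInner (w α) X‖ ^ 2) μ := by
    intro X
    have hmeas : Measurable fun α => hsInner (w α) X := by
      unfold hsInner
      refine Finset.measurable_sum _ fun i _ => ?_
      simp only [Matrix.diag_apply, Matrix.mul_apply, Matrix.conjTranspose_apply]
      exact Finset.measurable_sum _ fun j _ => ((continuous_star.measurable.comp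
        (hw.measurable j i))).mul_const _
    refine Integrable.of_bound (hmeas.norm.pow_const 2).aestronglyMeasurable
      ((B * hsNorm X) ^ 2) (Filter.Eventually.of_forall fun α => ?_)
    rw [norm_pow, norm_norm, ← inner_hsVec]
    refine pow_le_pow_left₀ (norm_nonneg _) ((norm_inner_le_norm _ _).trans ?_) 2
    exact mul_le_mul_of_nonneg_right (hw.hsNorm_le hB α) (norm_nonneg _)
  have hu2 : ∀ α, ‖u α‖ ^ 2 ≤ θ := by
    intro α
    by_cases hα : α ∈ Gd
    · rw [hu, Set.indicator_of_mem hα]; exact hθ α hα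
    · rw [hu, Set.indicator_of_notMem hα]; simpa using hθ0
  have h2 : ∀ x, ∫ α, ‖(inner ℂ (u α) x : ℂ)‖ ^ 2 ∂μ ≤ ‖x‖ ^ 2 / (n : ℝ) ^ 2 := by
    intro x
    obtain ⟨X, rfl⟩ := hsVec_surjective x
    simp only [hin]
    calc _ ≤ ∫ α, ‖hsInner (w α) (tang P X)‖ ^ 2 ∂μ :=
          integral_mono ((hint _).indicator hG) (hint _)
            fun α => Set.indicator_le_self' (fun _ _ => sq_nonneg _) α
      _ = hsNorm (tang P X) ^ 2 / (n : ℝ) ^ 2 := hw.integral_norm_hsInner_sq hB _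
      _ ≤ hsNorm X ^ 2 / (n : ℝ) ^ 2 := by
          have := hP.hsNorm_tang_le X
          have h0 := hsNorm_nonneg (tang P X)
          gcongr
  -- The vectors live in dimension `n²`, whence the exponent `2 p`.
  refine (measureReal_mono fun β hβ => ?_).trans (measureReal_exists_sum_inner_lt_le (κ := Fin m)
    (s := (n : ℝ) ^ 2) hum (by positivity) hu2 h2 (p := 2 * p) (by omega) ?_ ?_)
  · by_contra hcon
    refine hβ fun δ hδ h0 => ?_
    have h1 := not_lt.1 fun h' => hcon ⟨hsVec (tang P δ), h'⟩
    simp only [hin, hP.tang_tang, Fintype.card_fin] at h1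
    have hT := hP.isHermitian_tang hδ
    have e1 : ∀ α, ‖hsInner (w α) (tang P δ)‖ ^ 2 = ip (w α) (tang P δ) ^ 2 := fun α => by
      rw [hsInner_eq_ip (hw.hermitian α) hT, Complex.norm_real, Real.norm_eq_abs, sq_abs]
    simp only [e1] at h1
    have h3 : hsNorm (tang P δ) ^ 2 / n ^ 2 - μ.real Gdᶜ * (B * hsNorm (tang P δ)) ^ 2 ≤
        ∫ α, Gd.indicator (fun α => ip (w α) (tang P δ) ^ 2) α ∂μ := by
      rw [integral_indicator hG, ← hw.integral_ip_sq hB hT,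
        ← integral_add_compl hG (hw.integrable_ip_sq hB _)]
      have : ∫ α in Gdᶜ, ip (w α) (tang P δ) ^ 2 ∂μ ≤
          ∫ α in Gdᶜ, (B * hsNorm (tang P δ)) ^ 2 ∂μ := by
        refine integral_mono (hw.integrable_ip_sq hB _).integrableOn (integrable_const _) fun α => ?_
        rw [← sq_abs]
        exact pow_le_pow_left₀ (abs_nonneg _) (hw.abs_ip_le hB α _) 2
      rw [setIntegral_const, smul_eq_mul] at this
      linarith
    have h4 : ∑ i, (n : ℝ) ^ 2 / m * Gd.indicator (fun α => ip (w α) (tang P δ) ^ 2) (β i) ≤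
        n ^ 2 * (B * hsNorm (perp P δ)) ^ 2 := by
      calc _ ≤ ∑ _i : Fin m, (n : ℝ) ^ 2 / m * (B * hsNorm (perp P δ)) ^ 2 := by
            refine Finset.sum_le_sum fun i _ => mul_le_mul_of_nonneg_left ?_ (by positivity)
            refine (Set.indicator_le_self' (fun _ _ => sq_nonneg _) _).trans ?_
            have e2 : ip (w (β i)) (tang P δ) = - ip (w (β i)) (perp P δ) := by
              have := h0 i
              rw [← tang_add_perp P δ, ip_add_right] at this
              linarith
            rw [e2, neg_sq, ← sq_abs]
            exact pow_le_pow_left₀ (abs_nonneg _) (hw.abs_ip_le hB _ _) 2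
        _ = _ := by
            rw [Finset.sum_const, Finset.card_univ, Fintype.card_fin, nsmul_eq_mul]
            field_simp
    have h5 := mul_le_mul_of_nonneg_left h3 (by positivity : (0 : ℝ) ≤ n ^ 2)
    have h6 : (n : ℝ) ^ 2 * (hsNorm (tang P δ) ^ 2 / n ^ 2) = hsNorm (tang P δ) ^ 2 := by
      field_simp
    have h7 := mul_le_mul_of_nonneg_right hbad (sq_nonneg (hsNorm (tang P δ)))
    change _ - 1 / 4 * hsNorm (tang P δ) ^ 2 ≤ _ at h1
    -- Quarters of the squared tangential norm are lost to the fluctuation and to the observables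
    -- outside `Gd`; the remaining half suffices.
    refine abs_le_of_sq_le_sq' ?_ (by have := hsNorm_nonneg (perp P δ); positivity) |>.2
    nlinarith
  · rw [Fintype.card_prod, Fintype.card_fin]
    push_cast
    rw [two_mul, Real.exp_add]
    exact mul_le_mul hnp hnp hn'.le (Real.exp_pos _).le
  · rw [Fintype.card_fin]
    push_cast
    linarith

/-- The previous result with `P = 1`: every matrix is tangential, no incoherence is needed, and the
measurements are injective. It serves states of large rank. -/
theorem measureReal_not_isReconstructed_le_of_card_ge (hw : IsTightFrame μ w)
    (hB : ∀ α, traceNorm (w α) ≤ B) (hB0 : 0 ≤ B) (hn : n ≠ 0) (hm : m ≠ 0) (hp : p ≠ 0)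
    (hnp : (n : ℝ) ≤ Real.exp p) (hmp : 2 ^ 15 * (12 * p * (n ^ 2 * B ^ 2)) ≤ m)
    {ρ : Matrix (Fin n) (Fin n) ℂ} (hρ : ρ.IsHermitian) :
    (Measure.pi fun _ : Fin m => μ).real {β | ¬ IsReconstructed (fun i => w (β i)) ρ} ≤ 1 / 8 := by
  have := hw.prob
  have hP : IsProj (1 : Matrix (Fin n) (Fin n) ℂ) := ⟨Matrix.isHermitian_one, mul_one 1⟩
  have ht : ∀ X : Matrix (Fin n) (Fin n) ℂ, tang 1 X = X := fun X => by simp [tang]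
  have hpp : ∀ X : Matrix (Fin n) (Fin n) ℂ, perp 1 X = 0 := fun X => by simp [perp]
  refine (measureReal_mono fun β hβ => ?_).trans (measureReal_not_tang_le_perp_le (Gd := Set.univ)
    hw hB hB0 hn hm hp hnp hP MeasurableSet.univ (sq_nonneg B) (fun α _ => ?_) (by simp) hmp)
  · intro hcon
    refine hβ (isReconstructed_of_injective (fun i => hw.hermitian _) hn hm hρ fun δ hδ h0 => ?_)
    have := hcon δ hδ h0
    rw [ht, hpp, hsNorm_eq_zero.2 rfl, mul_zero] at this
    exact hsNorm_eq_zero.1 (le_antisymm this (hsNorm_nonneg _))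
  · rw [ht]
    exact pow_le_pow_left₀ (hsNorm_nonneg _) (hw.hsNorm_le hB α) 2

/-- The traceless part of a projection, scaled so that its tangential part is the projection. -/
noncomputable def golfStart (P : Matrix (Fin n) (Fin n) ℂ) (s : ℝ) : Matrix (Fin n) (Fin n) ℂ :=
  (1 - s)⁻¹ • (P - s • (1 : Matrix (Fin n) (Fin n) ℂ))

theorem IsProj.isHermitian_golfStart (hP : IsProj P) (s : ℝ) : (golfStart P s).IsHermitian :=
  isHermitian_real_smul (hP.herm.sub (isHermitian_real_smul Matrix.isHermitian_one s)) _

theorem IsProj.tang_golfStart (hP : IsProj P) {s : ℝ} (hs : s < 1) :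
    tang P (golfStart P s) = P := by
  have h1 : tang P P = P := by simp [tang, hP.idem]
  have h2 : tang P 1 = P := by simp [tang, hP.idem]
  rw [golfStart, tang_smul, tang_sub, tang_smul, h1, h2,
    show P - s • P = (1 - s) • P by rw [sub_smul, one_smul], smul_smul, inv_mul_cancel₀ (by linarith), one_smul]

theorem IsProj.norm_perp_golfStart_le (hP : IsProj P) {s : ℝ} (hs0 : 0 ≤ s) (hs : s ≤ 1 / 10) :
    ‖perp P (golfStart P s)‖ ≤ 1 / 9 := by
  have e : perp P (golfStart P s) = (-((1 - s)⁻¹ * s)) • (1 - P) := by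
    have h1 : (1 - P) * P = 0 := by rw [sub_mul, one_mul, hP.idem, sub_self]
    have h2 := hP.compl.idem
    rw [perp, golfStart]
    generalize 1 - P = Q at h1 h2
    rw [Matrix.mul_smul, Matrix.mul_sub, h1, Matrix.mul_smul, mul_one, Matrix.smul_mul, zero_sub,
      Matrix.neg_mul, Matrix.smul_mul, h2, smul_neg, smul_smul, neg_smul]
  rw [e, norm_smul, norm_neg, Real.norm_of_nonneg (mul_nonneg (inv_nonneg.2 (by linarith)) hs0)]
  refine (mul_le_of_le_one_right (mul_nonneg (inv_nonneg.2 (by linarith)) hs0)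
    hP.compl.norm_le_one).trans ?_
  rw [inv_mul_le_iff₀ (by linarith)]
  linarith

/-- For a random projection of rank `r` the mean of `ip A P` is `(r / n) ip A 1`. With `s = r / n`
this mean is removed, and only fluctuations of order `√r / n` remain in the overlap. -/
theorem ip_golfStart (A P : Matrix (Fin n) (Fin n) ℂ) (s : ℝ) :
    ip A (golfStart P s) = (1 - s)⁻¹ * (ip A P - s * ip A 1) := by
  rw [golfStart, ip_smul_right, ip_sub_right, ip_smul_right]

theorem IsProj.hsNorm_golfStart_le (hP : IsProj P) {r : ℝ} (hn : n ≠ 0) (hr0 : 0 ≤ r)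
    (hr : r ≤ n / 10) (htr : P.trace = r) : hsNorm (golfStart P (r / n)) ≤ 2 * √r := by
  have hn' : (0 : ℝ) < n := Nat.cast_pos.2 (Nat.pos_of_ne_zero hn)
  have hs : r / n ≤ 1 / 10 := by rw [div_le_iff₀ hn']; linarith
  have hPP : ip P P = r := by
    rw [ip_eq_re_trace hP.herm, hP.idem, htr, Complex.ofReal_re]
  have hP1 : ip P 1 = r := by
    rw [ip_eq_re_trace hP.herm, mul_one, htr, Complex.ofReal_re]
  have h11 : ip (1 : Matrix (Fin n) (Fin n) ℂ) 1 = n := by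
    rw [ip_eq_re_trace Matrix.isHermitian_one, mul_one, Matrix.trace_one]; simp
  have h : hsNorm (golfStart P (r / n)) ^ 2 = (1 - r / n)⁻¹ * r := by
    have h1s : (1 : ℝ) - r / n ≠ 0 := by linarith
    rw [← ip_self, ip_golfStart, ip_comm _ P, ip_comm _ 1, ip_golfStart, ip_golfStart, ip_comm 1 P,
      hPP, hP1, h11]
    rw [div_mul_cancel₀ _ hn'.ne', sub_self, mul_zero, mul_zero, sub_zero]
    have : r - r / n * r = (1 - r / n) * r := by ring
    rw [this, inv_mul_cancel_left₀ h1s]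
  refine abs_le_of_sq_le_sq' ?_ (by positivity) |>.2
  rw [h, mul_pow, Real.sq_sqrt hr0, inv_mul_le_iff₀ (by linarith)]
  nlinarith

theorem IsGolfScheme.measureReal_not_isReconstructed_le {L ε γ δ q : ℝ}
    (h : IsGolfScheme μ w P Gd m p B θ L ε γ δ q) {l : ℕ} (hl : l ≠ 0)
    {r : ℝ} (hr0 : 0 ≤ r) (hr : r ≤ n / 10) (htr : P.trace = r)
    {ρ : Matrix (Fin n) (Fin n) ℂ} (hρ : ρ.PosSemidef) (hPρ : P * ρ = ρ) {t : ℝ} (ht : 0 < t)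
    (hqt : 2 * √r ≤ q * t) (hγt : 2 * γ * t ≤ 1 / 3)
    (hXt : μ.real {α | α ∈ Gd ∧ t < |ip (w α) (golfStart P (r / n))|} ≤ ε / 2)
    (hηκ : q * t / 2 ^ l * (2 * n * B) < 1 / 2) (hLl : 2 ^ 15 * (12 * p) ≤ L * l) :
    (Measure.pi fun _ : Fin (l * m) => μ).real {β | ¬ IsReconstructed (fun i => w (β i)) ρ} ≤
      3 * δ * l + 1 / 8 := by
  have := h.frame.prob
  have hn' : (0 : ℝ) < n := Nat.cast_pos.2 (Nat.pos_of_ne_zero h.dim)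
  have hs : r / n ≤ 1 / 10 := by rw [div_le_iff₀ hn']; linarith
  have hs0 : 0 ≤ r / n := by positivity
  set X := golfStart P (r / n) with hX
  set A₁ : Set (Fin (l * m) → S) := {β | ¬ ∃ c : Fin (l * m) → ℝ,
    hsNorm (P - tang P (∑ i, c i • w (β i))) ≤ q * t / 2 ^ l ∧
    ‖perp P (∑ i, c i • w (β i))‖ ≤ 1 / 2} with hA₁
  set A₂ : Set (Fin (l * m) → S) := {β | ¬ ∀ δ : Matrix (Fin n) (Fin n) ℂ, δ.IsHermitian →
      (∀ i, ip (w (β i)) δ = 0) → hsNorm (tang P δ) ≤ 2 * n * B * hsNorm (perp P δ)} with hA₂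
  have hlm : l * m ≠ 0 := mul_ne_zero hl h.card
  have p1 : (Measure.pi fun _ : Fin (l * m) => μ).real A₁ ≤ 3 * δ * l := by
    refine (measureReal_pi_mul μ l m A₁).trans ((measureReal_mono fun ω hω => ?_).trans
      (h.measureReal_golf_le l (h.proj.isHermitian_golfStart _) ht
        ((h.proj.hsNorm_golfStart_le h.dim hr0 hr htr).trans hqt) hXt))
    rintro ⟨k1, k2⟩
    obtain ⟨c, hc⟩ := exists_golf_eq_sum (w := w) (P := P) (Gd := Gd) l t X ω
    have e : golf w P Gd l t X ω = ∑ i : Fin (l * m),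
        c (finProdFinEquiv.symm i).1 (finProdFinEquiv.symm i).2 •
          w (ω (finProdFinEquiv.symm i).1 (finProdFinEquiv.symm i).2) := by
      rw [hc, ← Fintype.sum_prod_type', ← finProdFinEquiv.symm.sum_comp]
    refine hω ⟨fun i => c (finProdFinEquiv.symm i).1 (finProdFinEquiv.symm i).2, ?_, ?_⟩
    · rw [← e, ← h.proj.tang_golfStart (s := r / n) (by linarith), h.proj.tang_golfStart (by linarith)]
      rw [h.proj.tang_golfStart (by linarith)] at k1
      exact k1
    -- The complementary norm is at most `1/3` from the batches plus `1/9` from the starting point,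
    -- below `1/2`.
    · rw [← e]
      have := h.proj.norm_perp_golfStart_le hs0 hs
      linarith
  have p2 : (Measure.pi fun _ : Fin (l * m) => μ).real A₂ ≤ 1 / 8 := by
    refine measureReal_not_tang_le_perp_le h.frame h.traceNorm_le h.nonneg h.dim hlm h.exponent
      h.dim_le h.proj h.measurableSet h.nonneg_θ h.incoherent ?_ ?_
    · have h1 := h.compl
      have h2 := h.bias_hs
      have h3 := h.pos_ε
      refine le_trans ?_ h2
      gcongr
      linarith
    · have h1 := mul_le_mul_of_nonneg_right h.card_ge (Nat.cast_nonneg l)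
      have h2 := mul_le_mul_of_nonneg_right hLl (mul_nonneg (sq_nonneg (n : ℝ)) h.nonneg_θ)
      push_cast
      linarith
  refine (measureReal_mono (s₂ := A₁ ∪ A₂) fun β hβ => ?_).trans
    ((measureReal_union_le _ _).trans (add_le_add p1 p2))
  by_contra hcon
  simp only [Set.mem_union, not_or] at hcon
  obtain ⟨c, hc1, hc2⟩ := not_not.1 hcon.1
  have h2 := not_not.1 hcon.2
  exact hβ (isReconstructed_of_certificate (fun i => h.frame.hermitian _) h.dim hlm hρ h.proj hPρ
    c hc1 hc2 h2 hηκ)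

end

end CompressedSensing

/-! ### Incoherence of a random projection. -/

namespace CompressedSensing

set_option linter.unusedSectionVars false

open scoped Matrix.Norms.L2Operator

/-- The law of a random orthogonal projection of rank `r` that is invariant under unitary
conjugation. -/
structure IsInvariantProjLaw {n : ℕ} (r : ℕ) (Λ : Measure (Matrix (Fin n) (Fin n) ℂ)) : Prop where
  prob : IsProbabilityMeasure Λ
  proj : ∀ᵐ P ∂Λ, IsProj P ∧ P.trace = r
  invariant : ∀ U ∈ Matrix.unitaryGroup (Fin n) ℂ,
    Λ.map (fun P => U * P * U.conjTranspose) = Λ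

section

variable {n r : ℕ} {Λ : Measure (Matrix (Fin n) (Fin n) ℂ)}

theorem measurable_conj (U : Matrix (Fin n) (Fin n) ℂ) :
    Measurable fun P : Matrix (Fin n) (Fin n) ℂ => U * P * U.conjTranspose :=
  Continuous.measurable (by fun_prop)

theorem IsInvariantProjLaw.measureReal_conj (h : IsInvariantProjLaw r Λ)
    {U : Matrix (Fin n) (Fin n) ℂ} (hU : U ∈ Matrix.unitaryGroup (Fin n) ℂ)
    {E : Set (Matrix (Fin n) (Fin n) ℂ)} (hE : MeasurableSet E) :
    Λ.real {P | U * P * U.conjTranspose ∈ E} = Λ.real E := by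
  conv_rhs => rw [← h.invariant U hU, Measure.real, Measure.map_apply (measurable_conj U) hE]
  rfl

theorem exists_unitary_row {x : Fin n → ℂ} (hx : ∑ k, ‖x k‖ ^ 2 = 1) (j : Fin n) :
    ∃ U ∈ Matrix.unitaryGroup (Fin n) ℂ, ∀ k, U j k = x k := by
  set v : Fin n → EuclideanSpace ℂ (Fin n) := fun _ => WithLp.toLp 2 x with hv
  have hnorm : ‖(WithLp.toLp 2 x : EuclideanSpace ℂ (Fin n))‖ = 1 := by
    rw [EuclideanSpace.norm_eq]
    simp [hx]
  have ho : Orthonormal ℂ (({j} : Set (Fin n)).domRestrict v) := by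
    refine ⟨fun i => hnorm, fun i k hik => ?_⟩
    exact absurd (Subtype.ext (i.2.trans k.2.symm)) hik
  obtain ⟨b, hb⟩ := ho.exists_orthonormalBasis_extension_of_card_eq (by simp)
  refine ⟨Matrix.of fun i k => b i k, ?_, fun k => ?_⟩
  · rw [Matrix.mem_unitaryGroup_iff]
    ext i k
    have := orthonormal_iff_ite.1 b.orthonormal k i
    rw [Matrix.mul_apply, Matrix.one_apply]
    simp only [Matrix.star_apply, Matrix.of_apply]
    rw [PiLp.inner_apply] at this
    simp only [RCLike.inner_apply] at this
    simp only [eq_comm (a := i)]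
    exact this
  · rw [Matrix.of_apply, hb j rfl]

/-- For real `x` one has `|Re (P x)|² ≤ |P x|² = ⟨x, P x⟩`. The real part of `P` therefore meets the
hypothesis of the chaos estimate, although it need not be a projection. -/
theorem IsProj.sum_sq_le {P : Matrix (Fin n) (Fin n) ℂ} (hP : IsProj P) (x : Fin n → ℝ) :
    ∑ i, (∑ j, P.map Complex.re i j * x j) ^ 2 ≤
      ∑ i, ∑ j, P.map Complex.re i j * (x i * x j) := by
  have h1 : ∀ i, (∑ j, P.map Complex.re i j * x j) = (∑ j, P i j * x j).re := by
    intro i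
    rw [Complex.re_sum]
    simp
  have h2 : ∑ i, ∑ j, P.map Complex.re i j * (x i * x j) =
      (∑ i, ∑ j, (x i : ℂ) * (P i j * x j)).re := by
    simp only [Complex.re_sum]
    refine Finset.sum_congr rfl fun i _ => Finset.sum_congr rfl fun j _ => ?_
    simp only [Complex.re_ofReal_mul, Complex.re_mul_ofReal, Matrix.map_apply]
    ring
  have h3 : (∑ i, ∑ j, (x i : ℂ) * (P i j * x j)) = ∑ i, (‖∑ j, P i j * x j‖ ^ 2 : ℝ) := by
    set y : Fin n → ℂ := fun i => x i with hy
    have hys : star y = y := by ext i; simp [hy]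
    have e1 : (∑ i, ∑ j, (x i : ℂ) * (P i j * x j)) = y ⬝ᵥ P.mulVec y := by
      simp only [dotProduct, Matrix.mulVec, Finset.mul_sum, hy]
    have e2 : y ⬝ᵥ P.mulVec y = star (P.mulVec y) ⬝ᵥ P.mulVec y := by
      rw [Matrix.star_mulVec, hP.herm.eq, hys, ← Matrix.dotProduct_mulVec, Matrix.mulVec_mulVec,
        hP.idem]
    rw [e1, e2]
    push_cast
    simp only [dotProduct]
    refine Finset.sum_congr rfl fun i _ => ?_
    rw [Pi.star_apply, ← Complex.conj_mul']
    rfl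
  rw [h2, h3, Complex.ofReal_re]
  refine Finset.sum_le_sum fun i _ => ?_
  rw [h1, ← sq_abs]
  exact pow_le_pow_left₀ (abs_nonneg _) (Complex.abs_re_le_norm _) 2

theorem conj_diag_re {U P : Matrix (Fin n) (Fin n) ℂ} {j : Fin n} {ε : Fin n → Bool}
    (hU : ∀ k, U j k = (sgn (ε k) / √n : ℝ)) (hn : n ≠ 0) :
    n * ((U * P * U.conjTranspose) j j).re = signQuad (P.map Complex.re) ε := by
  have hn' : (0 : ℝ) < n := Nat.cast_pos.2 (Nat.pos_of_ne_zero hn)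
  have hs0 : √(n : ℝ) ≠ 0 := (Real.sqrt_pos.2 hn').ne'
  have e : (U * P * U.conjTranspose) j j = ∑ l, ∑ k, U j k * P k l * star (U j l) := by
    simp only [Matrix.mul_apply, Matrix.conjTranspose_apply, Finset.sum_mul]
  rw [e, Complex.re_sum, Finset.mul_sum, signQuad, Finset.sum_comm]
  refine Finset.sum_congr rfl fun l _ => ?_
  rw [Complex.re_sum, Finset.mul_sum]
  refine Finset.sum_congr rfl fun k _ => ?_
  have hst : star (U j l) = ((sgn (ε l) / √n : ℝ) : ℂ) := by
    rw [hU]; exact Complex.conj_ofReal _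
  rw [hU k, hst, Complex.re_mul_ofReal, Complex.re_ofReal_mul, Matrix.map_apply]
  field_simp
  rw [Real.sq_sqrt hn'.le]
  ring

/-- Conjugating by a unitary whose `j`-th row is `ε / √n` does not change the law and turns the
diagonal entry into a sign form of `Re P`. Since this holds for each `ε`, one may average over the
signs and apply the chaos estimate for fixed `P`; no Haar integral is needed. -/
theorem IsInvariantProjLaw.measureReal_diag_le (h : IsInvariantProjLaw r Λ) (hn : n ≠ 0)
    (hr : 1 ≤ r) {p : ℕ} (hp : p ≠ 0) (j : Fin n) :
    Λ.real {P | 20 * p * √r ≤ |n * (P j j).re - r|} ≤ Real.exp (-p) := by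
  have := h.prob
  have hn' : (0 : ℝ) < n := Nat.cast_pos.2 (Nat.pos_of_ne_zero hn)
  have hmeas : ∀ ε : Fin n → Bool, MeasurableSet {P : Matrix (Fin n) (Fin n) ℂ |
      20 * p * √(r : ℝ) ≤ |signQuad (P.map Complex.re) ε - r|} := by
    intro ε
    refine measurableSet_le measurable_const (Continuous.measurable ?_)
    unfold signQuad
    simp only [Matrix.map_apply]
    fun_prop
  have hE : MeasurableSet {P : Matrix (Fin n) (Fin n) ℂ |
      20 * p * √(r : ℝ) ≤ |n * (P j j).re - r|} :=
    measurableSet_le measurable_const (Continuous.measurable (by fun_prop))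
  have h1 : ∀ ε : Fin n → Bool, Λ.real {P | 20 * p * √r ≤ |n * (P j j).re - r|} =
      ∫ P, (if 20 * p * √(r : ℝ) ≤ |signQuad (P.map Complex.re) ε - r| then 1 else 0) ∂Λ := by
    intro ε
    obtain ⟨U, hU, hUj⟩ := exists_unitary_row (x := fun k => ((sgn (ε k) / √n : ℝ) : ℂ)) (by
      have : ∀ k, ‖((sgn (ε k) / √n : ℝ) : ℂ)‖ ^ 2 = (n : ℝ)⁻¹ := fun k => by
        rw [Complex.norm_real, Real.norm_eq_abs, abs_div, abs_sgn, div_pow, sq_abs,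
          Real.sq_sqrt hn'.le, one_pow, one_div]
      simp only [this]
      simp [hn]) j
    rw [← h.measureReal_conj hU hE]
    have e : {P : Matrix (Fin n) (Fin n) ℂ | U * P * U.conjTranspose ∈
        {P : Matrix (Fin n) (Fin n) ℂ | 20 * p * √(r : ℝ) ≤ |n * (P j j).re - r|}} =
        {P | 20 * p * √(r : ℝ) ≤ |signQuad (P.map Complex.re) ε - r|} := by
      ext P
      change _ ≤ |n * ((U * P * U.conjTranspose) j j).re - r| ↔ _
      rw [conj_diag_re hUj hn]
      rfl
    rw [e, ← integral_indicator_one (hmeas ε)]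
    rfl
  have h2 : Λ.real {P | 20 * p * √r ≤ |n * (P j j).re - r|} =
      ∫ P, signAvg (fun ε : Fin n → Bool =>
        if 20 * p * √(r : ℝ) ≤ |signQuad (P.map Complex.re) ε - r| then 1 else 0) ∂Λ := by
    rw [← signAvg_const (κ := Fin n) (Λ.real _)]
    unfold signAvg
    rw [integral_finsetSum]
    · refine Finset.sum_congr rfl fun ε _ => ?_
      rw [integral_const_mul, ← h1 ε]
    · intro ε _
      exact (((integrable_const (1 : ℝ)).indicator (hmeas ε)).congr
        (Filter.Eventually.of_forall fun P => rfl)).const_mul _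
  rw [h2]
  calc _ ≤ ∫ _P : Matrix (Fin n) (Fin n) ℂ, Real.exp (-p) ∂Λ := by
        refine integral_mono_of_nonneg (Filter.Eventually.of_forall fun P => ?_)
          (integrable_const _) ?_
        · refine Finset.sum_nonneg fun ε _ => mul_nonneg (by positivity) ?_
          dsimp only
          split_ifs <;> norm_num
        · filter_upwards [h.proj] with P hP
          have htr : ∑ i, P.map Complex.re i i = r := by
            have := congrArg Complex.re hP.2
            rw [Matrix.trace, Complex.re_sum] at this
            simpa using this
          have hsymm : (P.map Complex.re).IsSymm := by
            ext i k
            have := congrArg Complex.re (hP.1.herm.apply i k)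
            simpa using this
          have := signAvg_indicator_le hsymm hP.1.sum_sq_le (by rw [htr]; exact_mod_cast hr) hp
          rw [htr] at this
          exact this
    _ = Real.exp (-p) := by simp

theorem ip_unitary_diagonal {U : Matrix (Fin n) (Fin n) ℂ} (d : Fin n → ℝ)
    {P : Matrix (Fin n) (Fin n) ℂ}
    (hH : (U * Matrix.diagonal (fun i => (d i : ℂ)) * star U).IsHermitian) :
    ip (U * Matrix.diagonal (fun i => (d i : ℂ)) * star U) P =
      ∑ i, d i * ((star U * P * U) i i).re := by
  rw [ip_eq_re_trace hH, Matrix.mul_assoc, Matrix.mul_assoc, Matrix.trace_mul_comm,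
    Matrix.mul_assoc, Matrix.trace, Complex.re_sum]
  refine Finset.sum_congr rfl fun i _ => ?_
  rw [Matrix.diag_apply, Matrix.diagonal_mul, Complex.re_ofReal_mul]

/-- Expanding gives `2 tr(W² P)` minus the squared norm of `P W P`. -/
theorem IsProj.hsNorm_tang_sq_le {P : Matrix (Fin n) (Fin n) ℂ} (hP : IsProj P)
    {W : Matrix (Fin n) (Fin n) ℂ} (hW : W.IsHermitian) :
    hsNorm (tang P W) ^ 2 ≤ 2 * ip (W ^ 2) P := by
  have hW2 : (W ^ 2).IsHermitian := hW.pow 2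
  have h1 : hsNorm (tang P W) ^ 2 = (Matrix.trace (W * tang P W)).re := by
    rw [← ip_self, hP.ip_tang_left, hP.tang_tang, ip_eq_re_trace hW]
  have h2 : Matrix.trace (W * tang P W) = 2 * Matrix.trace (W ^ 2 * P) -
      Matrix.trace ((P * W * P) * (P * W * P)) := by
    have e1 : Matrix.trace (W * (P * W)) = Matrix.trace (W ^ 2 * P) := by
      rw [← Matrix.mul_assoc, Matrix.trace_mul_comm, ← Matrix.mul_assoc, sq]
    have e2 : Matrix.trace (W * (W * P)) = Matrix.trace (W ^ 2 * P) := by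
      rw [← Matrix.mul_assoc, sq]
    have e3 : Matrix.trace ((P * W * P) * (P * W * P)) = Matrix.trace (W * (P * W * P)) := by
      have : P * W * P * (P * W * P) = P * (W * (P * W * P)) := by
        calc P * W * P * (P * W * P) = P * W * (P * P) * W * P := by simp only [Matrix.mul_assoc]
          _ = _ := by rw [hP.idem]; simp only [Matrix.mul_assoc]
      rw [this, Matrix.trace_mul_comm]
      have : W * (P * W * P) * P = W * (P * W * (P * P)) := by simp only [Matrix.mul_assoc]
      rw [this, hP.idem]
    rw [tang, Matrix.mul_sub, Matrix.mul_add, Matrix.trace_sub, Matrix.trace_add, e1, e2, e3]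
    ring
  have hH : (P * W * P).IsHermitian := by
    rw [Matrix.IsHermitian, Matrix.conjTranspose_mul, Matrix.conjTranspose_mul, hP.herm.eq, hW.eq,
      Matrix.mul_assoc]
  have h3 : 0 ≤ (Matrix.trace ((P * W * P) * (P * W * P))).re := by
    rw [← ip_eq_re_trace hH, ip_self]; positivity
  rw [h1, h2, ip_eq_re_trace hW2, Complex.sub_re]
  simp only [Complex.mul_re, Complex.re_ofNat, Complex.im_ofNat, zero_mul, sub_zero]
  linarith

/-- In an eigenbasis of `W` only the diagonal of the rotated projection enters, and a union bound
over its `n` entries suffices. The eigenvalues have absolute sum at most `B` and square sum at most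
`B²`. The constant 42 is `2 · 21`; the 40 leaves room for the factor `(1 - r / n)⁻¹ ≤ 10 / 9`. -/
theorem IsInvariantProjLaw.measureReal_not_incoherent_le (h : IsInvariantProjLaw r Λ) (hn : n ≠ 0)
    (hr : 1 ≤ r) (hrn : (r : ℝ) ≤ n / 10) {p : ℕ} (hp : p ≠ 0) {W : Matrix (Fin n) (Fin n) ℂ}
    (hW : W.IsHermitian) {B : ℝ} (hB : traceNorm W ≤ B) :
    Λ.real {P | ¬ (hsNorm (tang P W) ^ 2 ≤ 42 * p * B ^ 2 * (r / n) ∧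
      |ip W (golfStart P (r / n))| ≤ 40 * p * B * (√r / n))} ≤ n * Real.exp (-p) := by
  have := h.prob
  have hn' : (0 : ℝ) < n := Nat.cast_pos.2 (Nat.pos_of_ne_zero hn)
  have hr1 : (1 : ℝ) ≤ r := by exact_mod_cast hr
  have hp1 : (1 : ℝ) ≤ p := by exact_mod_cast Nat.one_le_iff_ne_zero.2 hp
  obtain ⟨U, hU, hWU⟩ := exists_unitary_diagonal hW
  set d := hW.eigenvalues with hd
  have hd1 : ∑ i, |d i| ≤ B := by rw [← traceNorm_eq_sum_abs hW]; exact hB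
  have hB0 : 0 ≤ B := (Finset.sum_nonneg fun i _ => abs_nonneg _).trans hd1
  have hdi : ∀ i, |d i| ≤ B := fun i =>
    (Finset.single_le_sum (fun i _ => abs_nonneg (d i)) (Finset.mem_univ i)).trans hd1
  have hUs : star U ∈ Matrix.unitaryGroup (Fin n) ℂ := Unitary.star_mem hU
  have hUU : star U * U = 1 := Matrix.mem_unitaryGroup_iff'.1 hU
  have hmeas : ∀ j : Fin n, MeasurableSet {P : Matrix (Fin n) (Fin n) ℂ |
      20 * p * √(r : ℝ) ≤ |n * (P j j).re - r|} := fun j =>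
    measurableSet_le measurable_const (Continuous.measurable (by fun_prop))
  set bad : Fin n → Set (Matrix (Fin n) (Fin n) ℂ) := fun j => {P | star U * P * (star U).conjTranspose ∈
    {P : Matrix (Fin n) (Fin n) ℂ | 20 * p * √(r : ℝ) ≤ |n * (P j j).re - r|}} with hbad
  have hbadle : ∀ j, Λ.real (bad j) ≤ Real.exp (-p) := fun j => by
    rw [hbad]
    exact (h.measureReal_conj hUs (hmeas j)).trans_le (h.measureReal_diag_le hn hr hp j)
  have hsub : ∀ᵐ P ∂Λ, P ∈ {P | ¬ (hsNorm (tang P W) ^ 2 ≤ 42 * p * B ^ 2 * (r / n) ∧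
      |ip W (golfStart P (r / n))| ≤ 40 * p * B * (√r / n))} → P ∈ ⋃ j, bad j := by
    filter_upwards [h.proj] with P hP hPmem
    by_contra hcon
    simp only [Set.mem_iUnion, not_exists] at hcon
    have hj : ∀ j, |((star U * P * U) j j).re - r / n| ≤ 20 * p * (√r / n) := by
      intro j
      have h0 : ¬ 20 * p * √(r : ℝ) ≤
        |n * ((star U * P * (star U).conjTranspose) j j).re - r| := hcon j
      have := not_le.1 h0
      rw [← Matrix.star_eq_conjTranspose, star_star] at this
      have e : ((star U * P * U) j j).re - r / n = (n * ((star U * P * U) j j).re - r) / n := by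
        field_simp
      rw [e, abs_div, abs_of_pos hn', div_le_iff₀ hn']
      refine this.le.trans (le_of_eq ?_)
      field_simp
    have hsr : √(r : ℝ) ≤ r := by
      rw [Real.sqrt_le_left (by linarith)]
      nlinarith
    refine hPmem ⟨?_, ?_⟩
    · refine (hP.1.hsNorm_tang_sq_le hW).trans ?_
      have hW2 : W ^ 2 = U * Matrix.diagonal (fun i => ((d i ^ 2 : ℝ) : ℂ)) * star U := by
        rw [hWU, pow_unitary_diagonal hU]
        push_cast
        rfl
      have hH := hW.pow 2
      rw [hW2] at hH ⊢
      rw [ip_unitary_diagonal _ hH]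
      have hjb : ∀ j, ((star U * P * U) j j).re ≤ 21 * p * (r / n) := by
        intro j
        have h1 := (abs_le.1 (hj j)).2
        have h2 : √(r : ℝ) / n ≤ r / n := by gcongr
        have h3 : (r : ℝ) / n ≤ p * (r / n) := le_mul_of_one_le_left (by positivity) hp1
        nlinarith
      have hd2 : ∑ i, d i ^ 2 ≤ B ^ 2 := by
        calc ∑ i, d i ^ 2 ≤ ∑ i, B * |d i| := by
              refine Finset.sum_le_sum fun i _ => ?_
              rw [← sq_abs, sq]
              exact mul_le_mul_of_nonneg_right (hdi i) (abs_nonneg _)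
          _ ≤ B * B := by rw [← Finset.mul_sum]; exact mul_le_mul_of_nonneg_left hd1 hB0
          _ = B ^ 2 := (sq B).symm
      calc 2 * ∑ i, d i ^ 2 * ((star U * P * U) i i).re
          ≤ 2 * ∑ i, d i ^ 2 * (21 * p * (r / n)) := by
            gcongr with i
            exact hjb i
        _ ≤ 2 * (B ^ 2 * (21 * p * (r / n))) := by
            rw [← Finset.sum_mul]
            gcongr
        _ = _ := by ring
    · have hH := hW
      have h1s : (0 : ℝ) < 1 - r / n := by
        have : (r : ℝ) / n ≤ 1 / 10 := by rw [div_le_iff₀ hn']; linarith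
        linarith
      have key : ip W P - r / n * ip W 1 = ∑ i, d i * (((star U * P * U) i i).re - r / n) := by
        rw [hWU] at hH
        have e1 := ip_unitary_diagonal d (P := P) hH
        have e2 := ip_unitary_diagonal d (P := 1) hH
        rw [← hWU] at e1 e2
        rw [e1, e2, Matrix.mul_one, hUU, Finset.mul_sum, ← Finset.sum_sub_distrib]
        refine Finset.sum_congr rfl fun i _ => ?_
        rw [Matrix.one_apply_eq, Complex.one_re]
        ring
      rw [ip_golfStart, key, abs_mul, abs_of_pos (inv_pos.2 h1s), inv_mul_le_iff₀ h1s]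
      calc |∑ i, d i * (((star U * P * U) i i).re - r / n)|
          ≤ ∑ i, |d i| * (20 * p * (√r / n)) := by
            refine (Finset.abs_sum_le_sum_abs _ _).trans (Finset.sum_le_sum fun i _ => ?_)
            rw [abs_mul]
            exact mul_le_mul_of_nonneg_left (hj i) (abs_nonneg _)
        _ ≤ B * (20 * p * (√r / n)) := by
            rw [← Finset.sum_mul]
            gcongr
        _ ≤ (1 - r / n) * (40 * p * B * (√r / n)) := by
            have : (r : ℝ) / n ≤ 1 / 10 := by rw [div_le_iff₀ hn']; linarith
            have hx : 0 ≤ p * B * (√(r : ℝ) / n) := by positivity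
            nlinarith
  calc _ ≤ Λ.real (⋃ j, bad j) :=
        ENNReal.toReal_mono (measure_ne_top _ _) (measure_mono_ae hsub)
    _ ≤ ∑ j, Λ.real (bad j) := measureReal_iUnion_fintype_le _
    _ ≤ ∑ _j : Fin n, Real.exp (-p) := Finset.sum_le_sum fun j _ => hbadle j
    _ = n * Real.exp (-p) := by simp

end

end CompressedSensing

/-! ### From random states to random projections. -/

namespace CompressedSensing

set_option linter.unusedSectionVars false

section

open Filter Topology

variable {n r : ℕ} {Λ : Measure (Matrix (Fin n) (Fin n) ℂ)} {ρ : Matrix (Fin n) (Fin n) ℂ}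

/-- The orthogonal projection onto the range of a state. -/
noncomputable def suppProj (ρ : Matrix (Fin n) (Fin n) ℂ) : Matrix (Fin n) (Fin n) ℂ :=
  limUnder atTop fun k : ℕ => 1 - (1 - ρ) ^ k

/-- Positivity and trace one put the eigenvalues `x` of `ρ` in `[0, 1]`, so `1 - (1 - x) ^ k` tends
to 0 at `x = 0` and to 1 elsewhere. As a limit of polynomials in `ρ`, the support projection is
measurable almost everywhere and compatible with conjugation. -/
theorem IsState.exists_tendsto (h : IsState r ρ) :
    ∃ P, Tendsto (fun k : ℕ => 1 - (1 - ρ) ^ k) atTop (𝓝 P) ∧ IsProj P ∧ P.trace = r ∧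
      P * ρ = ρ := by
  obtain ⟨hpos, htr, hrank⟩ := h
  obtain ⟨U, hU, hρU⟩ := exists_unitary_diagonal hpos.isHermitian
  set d := hpos.isHermitian.eigenvalues with hd
  have hUU : star U * U = 1 := Matrix.mem_unitaryGroup_iff'.1 hU
  have hUU' : U * star U = 1 := Matrix.mem_unitaryGroup_iff.1 hU
  have hd0 : ∀ i, 0 ≤ d i := hpos.eigenvalues_nonneg
  have hd1 : ∑ i, d i = 1 := by
    have h1 := hpos.isHermitian.trace_eq_sum_eigenvalues
    rw [htr] at h1
    have h2 := congrArg Complex.re h1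
    simpa using h2.symm
  have hdi : ∀ i, d i ≤ 1 := fun i => hd1 ▸
    Finset.single_le_sum (fun i _ => hd0 i) (Finset.mem_univ i)
  set x : Fin n → ℂ := fun i => if d i = 0 then 0 else 1 with hx
  have hmul : ∀ y z : Fin n → ℂ, (U * Matrix.diagonal y * star U) * (U * Matrix.diagonal z * star U) =
      U * Matrix.diagonal (fun i => y i * z i) * star U := by
    intro y z
    calc _ = U * Matrix.diagonal y * (star U * U) * Matrix.diagonal z * star U := by
          simp only [Matrix.mul_assoc]
      _ = _ := by
          rw [hUU, Matrix.mul_one, Matrix.mul_assoc U, Matrix.diagonal_mul_diagonal]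
  refine ⟨U * Matrix.diagonal x * star U, ?_, ⟨?_, ?_⟩, ?_, ?_⟩
  · have hk : ∀ k : ℕ, 1 - (1 - ρ) ^ k =
        U * Matrix.diagonal (fun i => ((1 - (1 - d i) ^ k : ℝ) : ℂ)) * star U := by
      intro k
      have hone : ∀ y : Fin n → ℂ, 1 - U * Matrix.diagonal y * star U =
          U * Matrix.diagonal (fun i => 1 - y i) * star U := by
        intro y
        have : Matrix.diagonal (fun i => 1 - y i) = 1 - Matrix.diagonal y := by
          rw [← Matrix.diagonal_one, Matrix.diagonal_sub]
        rw [this, Matrix.mul_sub, Matrix.sub_mul, Matrix.mul_one, hUU']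
      rw [hρU, hone, pow_unitary_diagonal hU, hone]
      push_cast
      rfl
    simp only [hk]
    refine Tendsto.mul_const _ (Tendsto.const_mul _ ?_)
    refine (Continuous.matrix_diagonal continuous_id).continuousAt.tendsto.comp
      (tendsto_pi_nhds.2 fun i => ?_)
    change Tendsto (fun k : ℕ => ((1 - (1 - d i) ^ k : ℝ) : ℂ)) atTop (𝓝 (x i))
    by_cases hi : d i = 0
    · rw [show x i = 0 from if_pos hi]
      simp [hi]
    · have h1 : Tendsto (fun k : ℕ => 1 - (1 - d i) ^ k) atTop (𝓝 (1 - 0)) := by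
        refine (tendsto_pow_atTop_nhds_zero_of_lt_one (by linarith [hdi i]) ?_).const_sub 1
        have := (hd0 i).lt_of_ne (Ne.symm hi)
        linarith
      have h2 := (Complex.continuous_ofReal.tendsto _).comp h1
      rw [sub_zero, Complex.ofReal_one] at h2
      rw [show x i = 1 from if_neg hi]
      exact h2
  · rw [Matrix.IsHermitian, Matrix.conjTranspose_mul, Matrix.conjTranspose_mul,
      Matrix.diagonal_conjTranspose, ← Matrix.star_eq_conjTranspose, ← Matrix.star_eq_conjTranspose,
      star_star, Matrix.mul_assoc]
    congr 3
    ext i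
    simp only [hx, Pi.star_apply]
    split_ifs <;> simp
  · rw [hmul]
    congr 3
    ext i
    simp only [hx]
    split_ifs <;> simp
  · rw [Matrix.mul_assoc, Matrix.trace_mul_comm, Matrix.mul_assoc, hUU, Matrix.mul_one,
      Matrix.trace_diagonal, ← hrank, hpos.isHermitian.rank_eq_card_non_zero_eigs,
      Fintype.card_subtype]
    simp only [hx, ← hd]
    rw [Finset.card_filter]
    push_cast
    refine Finset.sum_congr rfl fun i _ => ?_
    by_cases hi : d i = 0 <;> simp [hi]
  · conv_lhs => rw [hρU]
    conv_rhs => rw [hρU]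
    rw [hmul]
    congr 3
    ext i
    simp only [hx]
    split_ifs with hi
    · simp [hi]
    · simp

theorem IsState.tendsto_suppProj (h : IsState r ρ) :
    Tendsto (fun k : ℕ => 1 - (1 - ρ) ^ k) atTop (𝓝 (suppProj ρ)) := by
  obtain ⟨P, hP, -⟩ := h.exists_tendsto
  exact tendsto_nhds_limUnder ⟨P, hP⟩

theorem IsState.suppProj_spec (h : IsState r ρ) :
    IsProj (suppProj ρ) ∧ (suppProj ρ).trace = r ∧ suppProj ρ * ρ = ρ := by
  obtain ⟨P, hP, h1⟩ := h.exists_tendsto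
  rwa [tendsto_nhds_unique h.tendsto_suppProj hP]

theorem suppProj_conj {U : Matrix (Fin n) (Fin n) ℂ} (hU : U ∈ Matrix.unitaryGroup (Fin n) ℂ)
    (h : IsState r ρ) :
    suppProj (U * ρ * U.conjTranspose) = U * suppProj ρ * U.conjTranspose := by
  have hUU : U.conjTranspose * U = 1 := Matrix.mem_unitaryGroup_iff'.1 hU
  have hUU' : U * U.conjTranspose = 1 := Matrix.mem_unitaryGroup_iff.1 hU
  have hpow : ∀ k : ℕ, (1 - U * ρ * U.conjTranspose) ^ k = U * (1 - ρ) ^ k * U.conjTranspose := by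
    intro k
    induction k with
    | zero => rw [pow_zero, pow_zero, Matrix.mul_one, hUU']
    | succ k ih =>
      have e : 1 - U * ρ * U.conjTranspose = U * (1 - ρ) * U.conjTranspose := by
        rw [Matrix.mul_sub, Matrix.sub_mul, Matrix.mul_one, hUU']
      rw [pow_succ, ih, e, pow_succ]
      calc _ = U * (1 - ρ) ^ k * (U.conjTranspose * U) * (1 - ρ) * U.conjTranspose := by
            simp only [Matrix.mul_assoc]
        _ = _ := by rw [hUU, Matrix.mul_one]; simp only [Matrix.mul_assoc]
  have h1 := (h.tendsto_suppProj.const_mul U).mul_const U.conjTranspose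
  have e : ∀ k : ℕ, U * (1 - (1 - ρ) ^ k) * U.conjTranspose =
      1 - (1 - U * ρ * U.conjTranspose) ^ k := fun k => by
    rw [hpow, Matrix.mul_sub, Matrix.sub_mul, Matrix.mul_one, hUU']
  simp only [e] at h1
  exact h1.limUnder_eq

theorem IsInvariantStateLaw.aemeasurable_suppProj (h : IsInvariantStateLaw r Λ) :
    AEMeasurable suppProj Λ := by
  have : TopologicalSpace.PseudoMetrizableSpace (Matrix (Fin n) (Fin n) ℂ) :=
    inferInstanceAs (TopologicalSpace.PseudoMetrizableSpace (Fin n → Fin n → ℂ))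
  refine aemeasurable_of_tendsto_metrizable_ae atTop
    (f := fun (k : ℕ) (ρ : Matrix (Fin n) (Fin n) ℂ) => 1 - (1 - ρ) ^ k) (fun k => ?_) ?_
  · exact (Continuous.measurable (by fun_prop)).aemeasurable
  · filter_upwards [h.state] with ρ hρ using hρ.tendsto_suppProj

theorem measurableSet_isProj : MeasurableSet {P : Matrix (Fin n) (Fin n) ℂ | IsProj P ∧ P.trace = r} := by
  have e : {P : Matrix (Fin n) (Fin n) ℂ | IsProj P ∧ P.trace = r} =
      {P | P.conjTranspose = P} ∩ {P | P * P = P} ∩ {P | P.trace = (r : ℂ)} := by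
    ext P
    exact ⟨fun h => ⟨⟨h.1.1, h.1.2⟩, h.2⟩, fun h => ⟨⟨h.1.1, h.1.2⟩, h.2⟩⟩
  rw [e]
  refine IsClosed.measurableSet ?_
  exact ((isClosed_eq (by fun_prop) (by fun_prop)).inter
    (isClosed_eq (by fun_prop) (by fun_prop))).inter (isClosed_eq (by fun_prop) (by fun_prop))

theorem IsInvariantStateLaw.isInvariantProjLaw (h : IsInvariantStateLaw r Λ) :
    IsInvariantProjLaw r (Λ.map suppProj) where
  prob := by
    have := h.prob
    exact Measure.isProbabilityMeasure_map h.aemeasurable_suppProj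
  proj := by
    rw [ae_map_iff h.aemeasurable_suppProj measurableSet_isProj]
    filter_upwards [h.state] with ρ hρ using ⟨hρ.suppProj_spec.1, hρ.suppProj_spec.2.1⟩
  invariant U hU := by
    have hae := h.aemeasurable_suppProj
    rw [AEMeasurable.map_map_of_aemeasurable (measurable_conj U).aemeasurable hae]
    conv_rhs => rw [← h.invariant U hU]
    rw [AEMeasurable.map_map_of_aemeasurable (by rwa [h.invariant U hU])
      (measurable_conj U).aemeasurable]
    refine Measure.map_congr ?_
    filter_upwards [h.state] with ρ hρ using (suppProj_conj hU hρ).symm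

theorem IsInvariantStateLaw.rank_pos (h : IsInvariantStateLaw r Λ) : 1 ≤ r := by
  have := h.prob
  obtain ⟨ρ, hρ⟩ := h.state.exists
  rcases Nat.eq_zero_or_pos r with rfl | hr
  · obtain ⟨h1, h2, -⟩ := hρ.suppProj_spec
    rw [Nat.cast_zero, ← h1.idem] at h2
    have h3 : suppProj ρ = 0 := by
      rw [← hsNorm_eq_zero, ← sq_eq_zero_iff, ← ip_self, ip_eq_re_trace h1.herm, h2,
        Complex.zero_re]
    have h4 := hρ.suppProj_spec.2.2
    rw [h3, Matrix.zero_mul] at h4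
    have := hρ.2.1
    rw [← h4, Matrix.trace_zero] at this
    exact absurd this zero_ne_one
  · exact hr

/-- For each observable most projections are incoherent, hence for most projections most observables
are. `F` stands for any property, here successful reconstruction, implied by incoherence outside
measure `ε`. -/
theorem IsInvariantStateLaw.measure_not_le {S : Type*} [MeasurableSpace S] {μ : Measure S}
    {w : S → Matrix (Fin n) (Fin n) ℂ} {B ε : ℝ} {p : ℕ} (h : IsInvariantStateLaw r Λ)
    (hw : IsTightFrame μ w) (hB : ∀ α, traceNorm (w α) ≤ B) (hn : n ≠ 0)
    (hrn : (r : ℝ) ≤ n / 10) (hp : p ≠ 0) (hε : 0 < ε) {F : Matrix (Fin n) (Fin n) ℂ → Prop}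
    (hF : ∀ ρ P : Matrix (Fin n) (Fin n) ℂ, ρ.PosSemidef → IsProj P → P.trace = r → P * ρ = ρ →
      μ.real {α | ¬ (hsNorm (tang P (w α)) ^ 2 ≤ 42 * p * B ^ 2 * (r / n) ∧
        |ip (w α) (golfStart P (r / n))| ≤ 40 * p * B * (√r / n))} ≤ ε → F ρ) :
    Λ {ρ | ¬ F ρ} ≤ ENNReal.ofReal (n * Real.exp (-p) / ε) := by
  have := hw.prob
  have hΛ := h.isInvariantProjLaw
  have hΛp := hΛ.prob
  set D : Set (Matrix (Fin n) (Fin n) ℂ × S) := {z |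
    ¬ (hsNorm (tang z.1 (w z.2)) ^ 2 ≤ 42 * p * B ^ 2 * (r / n) ∧
        |ip (w z.2) (golfStart z.1 (r / n))| ≤ 40 * p * B * (√r / n))} with hD
  have hDm : MeasurableSet D := by
    have hws : Measurable fun z : Matrix (Fin n) (Fin n) ℂ × S => w z.2 :=
      hw.measurable_frame.comp measurable_snd
    have h1 : Measurable fun z : Matrix (Fin n) (Fin n) ℂ × S => hsNorm (tang z.1 (w z.2)) := by
      have hc : Continuous fun y : Matrix (Fin n) (Fin n) ℂ × Matrix (Fin n) (Fin n) ℂ =>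
          hsNorm (tang y.1 y.2) := by
        refine continuous_hsNorm.comp ?_
        unfold tang
        fun_prop
      intro s hs
      exact (measurable_fst.prodMk hws) (hc.measurable hs)
    have h2 : Measurable fun z : Matrix (Fin n) (Fin n) ℂ × S =>
        ip (w z.2) (golfStart z.1 (r / n)) := by
      refine measurable_ip_comp hws ?_
      have hc : Continuous fun P : Matrix (Fin n) (Fin n) ℂ => golfStart P (r / n) := by
        unfold golfStart
        fun_prop
      exact hc.measurable.comp measurable_fst
    have h3 : MeasurableSet {z : Matrix (Fin n) (Fin n) ℂ × S |
        |ip (w z.2) (golfStart z.1 (r / n))| ≤ 40 * p * B * (√r / n)} :=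
      measurableSet_le (measurable_norm.comp h2) measurable_const
    exact ((measurableSet_le (h1.pow_const 2) measurable_const).inter h3).compl
  have key := measureReal_lt_measureReal_le (π := Λ.map suppProj) (μ := μ) hDm hε fun α =>
    hΛ.measureReal_not_incoherent_le hn h.rank_pos hrn hp (hw.hermitian α) (hB α)
  calc Λ {ρ | ¬ F ρ} ≤ Λ (suppProj ⁻¹' {P | ε < μ.real {α | (P, α) ∈ D}}) := by
        refine measure_mono_ae ?_
        filter_upwards [h.state] with ρ hρ
        intro hnF
        by_contra hcon
        obtain ⟨h1, h2, h3⟩ := hρ.suppProj_spec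
        exact hnF (hF ρ (suppProj ρ) hρ.1 h1 h2 h3 (not_lt.1 hcon))
    _ ≤ (Λ.map suppProj) {P | ε < μ.real {α | (P, α) ∈ D}} :=
        Measure.le_map_apply h.aemeasurable_suppProj _
    _ ≤ _ := by
        rw [← ofReal_measureReal]
        exact ENNReal.ofReal_le_ofReal key

end

end CompressedSensing

/-! ### Choice of the numerical parameters. -/

namespace CompressedSensing

set_option linter.unusedSectionVars false

section

variable {S : Type*} [MeasurableSpace S] {n r : ℕ} {μ : Measure S}
  {w : S → Matrix (Fin n) (Fin n) ℂ}

/-- The number of samples of a batch, divided by `n r`, and by the incoherence parameter. -/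
def batchLevel (b s p l : ℕ) : ℕ := 2 ^ 34 * (s ^ 2 * b ^ 2 * p * l ^ 2)

/-- The number of samples of a batch, divided by `n r`. -/
def batchSize (b s p l : ℕ) : ℕ := 42 * p * b ^ 2 * batchLevel b s p l

theorem fluct_op_aux {x ρ N s b p l : ℝ} (hx : 1 ≤ x) (hρ : 1 ≤ ρ) (hs : 1 ≤ s) (hb : 1 ≤ b)
    (hp : 1 ≤ p) (hl : 1 ≤ l) (hN : 192 * 8640 ^ 2 * (s ^ 2 * b ^ 4 * l ^ 2 * p ^ 2) ≤ N) :
    2 * (x ^ 2 / (x * ρ * N) * (2 * √(6 * s * (2 * (x * ρ * N / x) + 30 * s * b ^ 2)))) ≤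
      1 / (9 * l) * (x / (240 * p * b * √ρ)) := by
  have hN1 : 1 ≤ N := by
    refine le_trans ?_ hN
    have : 1 ≤ s ^ 2 * b ^ 4 * l ^ 2 * p ^ 2 :=
      one_le_mul_of_one_le_of_one_le (one_le_mul_of_one_le_of_one_le
        (one_le_mul_of_one_le_of_one_le (one_le_pow₀ hs) (one_le_pow₀ hb)) (one_le_pow₀ hl))
        (one_le_pow₀ hp)
    linarith
  have hR : 0 < √ρ := Real.sqrt_pos.2 (by linarith)
  have hR2 : √ρ ^ 2 = ρ := Real.sq_sqrt (by linarith)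
  have h1 : √(6 * s * (2 * (x * ρ * N / x) + 30 * s * b ^ 2)) ≤ √ρ * N / (8640 * l * p * b) := by
    refine Real.sqrt_le_iff.2 ⟨by positivity, ?_⟩
    have e1 : x * ρ * N / x = ρ * N := by field_simp
    have hρN : 1 ≤ ρ * N := one_le_mul_of_one_le_of_one_le hρ hN1
    have hsb : 1 ≤ s * b ^ 2 := one_le_mul_of_one_le_of_one_le hs (one_le_pow₀ hb)
    have e2 : 6 * s * (2 * (x * ρ * N / x) + 30 * s * b ^ 2) ≤ 192 * s ^ 2 * b ^ 2 * (ρ * N) := by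
      rw [e1]
      have h3 : ρ * N ≤ s * b ^ 2 * (ρ * N) := le_mul_of_one_le_left (by linarith) hsb
      have h4 : s * b ^ 2 ≤ s * b ^ 2 * (ρ * N) := le_mul_of_one_le_right (by linarith) hρN
      calc 6 * s * (2 * (ρ * N) + 30 * s * b ^ 2)
          ≤ 6 * s * (2 * (s * b ^ 2 * (ρ * N)) + 30 * (s * b ^ 2 * (ρ * N))) := by
            refine mul_le_mul_of_nonneg_left ?_ (by positivity)
            linarith
        _ = _ := by ring
    refine e2.trans ?_
    rw [div_pow, mul_pow, hR2, le_div_iff₀ (by positivity)]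
    have := mul_le_mul_of_nonneg_left hN (by positivity : 0 ≤ ρ * N)
    calc _ = ρ * N * (192 * 8640 ^ 2 * (s ^ 2 * b ^ 4 * l ^ 2 * p ^ 2)) := by ring
      _ ≤ ρ * N * N := this
      _ = _ := by ring
  calc 2 * (x ^ 2 / (x * ρ * N) * (2 * √(6 * s * (2 * (x * ρ * N / x) + 30 * s * b ^ 2))))
      ≤ 2 * (x ^ 2 / (x * ρ * N) * (2 * (√ρ * N / (8640 * l * p * b)))) := by gcongr
    _ = x * √ρ / (2160 * l * p * b * √ρ ^ 2) := by rw [hR2]; field_simp; norm_num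
    _ = _ := by field_simp; norm_num

theorem fluct_ip_aux {x B s p l L : ℝ} (hx : 1 ≤ x) (hxs : x ≤ Real.exp s) (hs : 1 ≤ s) (hB : 1 ≤ B)
    (hp : 1 ≤ p) (hl : 1 ≤ l) (hL : 2 ^ 34 * (s ^ 2 * B ^ 2 * p * l ^ 2) = L) :
    4 / (1 / (24 * x ^ 3 * B ^ 2)) * Real.exp (-L / 64) ≤ 1 / (9 * l) := by
  have key : 864 * x ^ 3 * B ^ 2 * l ≤ Real.exp (L / 64) := by
    have h1 : (864 : ℝ) ≤ Real.exp 863 := by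
      have := Real.add_one_le_exp (863 : ℝ); linarith
    have h2 : x ^ 3 ≤ Real.exp (3 * s) := by
      have : Real.exp (3 * s) = Real.exp s ^ 3 := by
        rw [← Real.exp_nat_mul]; norm_num
      rw [this]; gcongr
    have h3 : B ^ 2 ≤ Real.exp (B ^ 2) := by have := Real.add_one_le_exp (B ^ 2); linarith
    have h4 : l ≤ Real.exp l := by have := Real.add_one_le_exp l; linarith
    calc 864 * x ^ 3 * B ^ 2 * l
        ≤ Real.exp 863 * Real.exp (3 * s) * Real.exp (B ^ 2) * Real.exp l := by gcongr
      _ = Real.exp (863 + 3 * s + B ^ 2 + l) := by rw [Real.exp_add, Real.exp_add, Real.exp_add]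
      _ ≤ Real.exp (L / 64) := by
          refine Real.exp_le_exp.2 ?_
          set T := s ^ 2 * B ^ 2 * p * l ^ 2 with hT
          have hs2 : s ≤ s ^ 2 := by nlinarith
          have hl2 : l ≤ l ^ 2 := by nlinarith
          have hB2 : 1 ≤ B ^ 2 := one_le_pow₀ hB
          have t1 : 1 ≤ s ^ 2 * p * l ^ 2 := one_le_mul_of_one_le_of_one_le
            (one_le_mul_of_one_le_of_one_le (one_le_pow₀ hs) hp) (one_le_pow₀ hl)
          have t2 : B ^ 2 ≤ T := by
            have := le_mul_of_one_le_left (by positivity : 0 ≤ B ^ 2) t1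
            rw [hT]; linarith
          have t3 : 1 ≤ B ^ 2 * p * l ^ 2 := one_le_mul_of_one_le_of_one_le
            (one_le_mul_of_one_le_of_one_le hB2 hp) (one_le_pow₀ hl)
          have t4 : s ^ 2 ≤ T := by
            have := le_mul_of_one_le_left (by positivity : 0 ≤ s ^ 2) t3
            rw [hT]; linarith
          have t5 : 1 ≤ s ^ 2 * B ^ 2 * p := one_le_mul_of_one_le_of_one_le
            (one_le_mul_of_one_le_of_one_le (one_le_pow₀ hs) hB2) hp
          have t6 : l ^ 2 ≤ T := le_mul_of_one_le_left (by positivity : 0 ≤ l ^ 2) t5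
          rw [← hL]
          linarith
  have e : 4 / (1 / (24 * x ^ 3 * B ^ 2)) * Real.exp (-L / 64) =
      (864 * x ^ 3 * B ^ 2 * l) / Real.exp (L / 64) * (1 / (9 * l)) := by
    rw [neg_div, Real.exp_neg]
    field_simp
    norm_num
  rw [e]
  exact mul_le_of_le_one_left (by positivity) ((div_le_one (Real.exp_pos _)).2 key)

theorem measureReal_not_isReconstructed_le_of_incoherent (hw : IsTightFrame μ w) {b s p l : ℕ}
    (hB : ∀ α, traceNorm (w α) ≤ b) (hn : 1 ≤ n) (hr : 1 ≤ r) (hrn : (r : ℝ) ≤ n / 10)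
    (hb : 1 ≤ b) (hs : 1 ≤ s) (hns : (n : ℝ) ≤ Real.exp s) (hp : 1 ≤ p) (hl : 1 ≤ l)
    (hl2 : 8 * (n : ℝ) ^ 2 * b < 2 ^ l) {ρ P : Matrix (Fin n) (Fin n) ℂ} (hρ : ρ.PosSemidef)
    (hP : IsProj P) (htr : P.trace = r) (hPρ : P * ρ = ρ)
    (hbad : μ.real {α | ¬ (hsNorm (tang P (w α)) ^ 2 ≤ 42 * p * (b : ℝ) ^ 2 * (r / n) ∧
        |ip (w α) (golfStart P (r / n))| ≤ 40 * p * b * (√r / n))} ≤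
      1 / (24 * (n : ℝ) ^ 3 * (b : ℝ) ^ 2) / 2) :
    (Measure.pi fun _ : Fin (l * (n * r * batchSize b s p l)) => μ).real
      {β | ¬ IsReconstructed (fun i => w (β i)) ρ} ≤ 11 / 24 := by
  have := hw.prob
  have hn1 : (1 : ℝ) ≤ n := by exact_mod_cast hn
  have hr1 : (1 : ℝ) ≤ r := by exact_mod_cast hr
  have hb1 : (1 : ℝ) ≤ b := by exact_mod_cast hb
  have hs1 : (1 : ℝ) ≤ s := by exact_mod_cast hs
  have hp1 : (1 : ℝ) ≤ p := by exact_mod_cast hp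
  have hl1 : (1 : ℝ) ≤ l := by exact_mod_cast hl
  have hR : 0 < √(r : ℝ) := Real.sqrt_pos.2 (by linarith)
  have hRr : √(r : ℝ) ≤ r := by
    rw [Real.sqrt_le_left (by linarith)]
    nlinarith
  have hRn : √(r : ℝ) ≤ n := by linarith
  have hN0 : batchSize b s p l ≠ 0 := by unfold batchSize batchLevel; positivity
  have hLc : ((batchLevel b s p l : ℕ) : ℝ) = 2 ^ 34 * ((s : ℝ) ^ 2 * b ^ 2 * p * l ^ 2) := by
    unfold batchLevel; push_cast; ring
  have hNc : ((batchSize b s p l : ℕ) : ℝ) = 42 * p * (b : ℝ) ^ 2 * batchLevel b s p l := by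
    unfold batchSize; push_cast; ring
  have hL0 : (0 : ℝ) < batchLevel b s p l := by rw [hLc]; positivity
  set L : ℝ := ((batchLevel b s p l : ℕ) : ℝ) with hL
  set N : ℝ := ((batchSize b s p l : ℕ) : ℝ) with hN
  set ε : ℝ := 1 / (24 * (n : ℝ) ^ 3 * (b : ℝ) ^ 2) with hε
  have hmc : ((n * r * batchSize b s p l : ℕ) : ℝ) = n * r * N := by push_cast; rfl
  have hNpos : 0 < N := Nat.cast_pos.2 (Nat.pos_of_ne_zero hN0)
  set θ : ℝ := 42 * p * (b : ℝ) ^ 2 * (r / n) with hθ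
  set Gd : Set S := {α | hsNorm (tang P (w α)) ^ 2 ≤ θ} with hGd
  have hGm : MeasurableSet Gd := measurableSet_le ((continuous_hsNorm.measurable.comp
    ((continuous_tang P).measurable.comp hw.measurable_frame)).pow_const 2) measurable_const
  have hθ0 : 0 < θ := by positivity
  have hθL : (n : ℝ) ^ 2 * θ * L = n * r * N := by
    rw [hθ, hNc]; field_simp
  -- The values are matched to the initial scale `t = 40 p b √r / n`: `q t = 2 √r` bounds the norm
  -- of the starting point, `2 γ t = 1/3`, and `δ = 1 / (9 l)` makes the `l` batches fail with
  -- probability at most `1/3`. The batch size is exactly `n² θ L`.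
  have h_scheme : IsGolfScheme μ w P Gd (n * r * batchSize b s p l) s b θ L ε
      (n / (240 * p * b * √r)) (1 / (9 * l)) (n / (20 * p * b)) := by
    refine
      { frame := hw, traceNorm_le := hB, nonneg := by positivity, dim := by omega,
        card := by positivity, proj := hP, measurableSet := hGm, exponent := by omega,
        dim_le := hns, pos_L := hL0, pos_ε := by positivity, pos_γ := by positivity,
        pos_q := by positivity, nonneg_δ := by positivity, nonneg_θ := by positivity,
        incoherent := fun α hα => hα, compl := ?_, card_ge := ?_, bias_ip := ?_, bias_hs := ?_,
        bias_op := ?_, fluct_hs := ?_, fluct_ip := ?_, fluct_op := ?_ }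
    · refine (measureReal_mono ?_).trans hbad
      intro α hα h
      exact hα h.1
    · rw [hmc, hθL]
    · rw [hε]
      have : 4 * ((n : ℝ) ^ 2 * (1 / (24 * (n : ℝ) ^ 3 * (b : ℝ) ^ 2)) * (b : ℝ) ^ 3) *
          (n / (20 * p * b)) = 1 / (120 * p) := by field_simp; norm_num
      rw [this, div_le_one (by positivity)]
      linarith
    · rw [hε]
      have : 4 * ((n : ℝ) ^ 2 * (1 / (24 * (n : ℝ) ^ 3 * (b : ℝ) ^ 2)) * (b : ℝ) ^ 2) =
          1 / (6 * n) := by field_simp; norm_num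
      rw [this, div_le_one (by positivity)]
      linarith
    · rw [hε]
      have : 2 * ((n : ℝ) ^ 2 * (1 / (24 * (n : ℝ) ^ 3 * (b : ℝ) ^ 2)) * (b : ℝ) ^ 2) *
          (n / (20 * p * b)) = 1 / (240 * p * b) := by field_simp; norm_num
      rw [this, div_le_div_iff₀ (by positivity) (by positivity)]
      have h0 : (0 : ℝ) ≤ 240 * p * b := by positivity
      rw [one_mul, mul_comm (n : ℝ)]
      exact mul_le_mul_of_nonneg_left hRn h0
    · have e : (n : ℝ) ^ 2 * θ / (n * r * batchSize b s p l : ℕ) = 1 / L := by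
        rw [hmc, ← hθL]; field_simp
      have h1 : √(1 / L) ≤ 1 / (72 * l) := by
        refine Real.sqrt_le_iff.2 ⟨by positivity, ?_⟩
        rw [div_pow, one_pow, div_le_div_iff₀ hL0 (by positivity), hLc]
        have h2 : (1 : ℝ) ≤ (s : ℝ) ^ 2 * b ^ 2 * p := one_le_mul_of_one_le_of_one_le
          (one_le_mul_of_one_le_of_one_le (one_le_pow₀ hs1) (one_le_pow₀ hb1)) hp1
        have h3 := le_mul_of_one_le_left (by positivity : 0 ≤ (l : ℝ) ^ 2) h2
        have h4 := sq_nonneg (l : ℝ)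
        rw [mul_pow]
        linarith
      rw [e]
      calc 8 * √(1 / L) ≤ 8 * (1 / (72 * l)) := by gcongr
        _ = 1 / (9 * l) := by field_simp; norm_num
    · exact fluct_ip_aux hn1 hns hs1 hb1 hp1 hl1 hLc.symm
    · rw [hmc]
      refine fluct_op_aux hn1 hr1 hs1 hb1 hp1 hl1 ?_
      rw [hNc, hLc]
      have h0 : (0 : ℝ) ≤ (s : ℝ) ^ 2 * b ^ 4 * l ^ 2 * p ^ 2 := by positivity
      have e : 42 * (p : ℝ) * (b : ℝ) ^ 2 * (2 ^ 34 * ((s : ℝ) ^ 2 * b ^ 2 * p * l ^ 2)) =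
          42 * 2 ^ 34 * ((s : ℝ) ^ 2 * b ^ 4 * l ^ 2 * p ^ 2) := by ring
      rw [e]
      exact mul_le_mul_of_nonneg_right (by norm_num) h0
  have hqt : (n : ℝ) / (20 * p * b) * (40 * p * b * (√r / n)) = 2 * √r := by
    field_simp; norm_num
  refine (h_scheme.measureReal_not_isReconstructed_le (l := l) (by omega) (r := r) (by positivity)
    hrn (by exact_mod_cast htr) hρ hPρ (t := 40 * p * b * (√r / n)) (by positivity) hqt.symm.le ?_ ?_
      ?_ ?_).trans ?_
  · refine le_of_eq ?_
    field_simp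
    norm_num
  · refine (measureReal_mono ?_).trans hbad
    intro α hα h
    exact absurd h.2 (not_le.2 hα.2)
  -- The certificate error `2 √r / 2 ^ l` must beat the factor `2 n b` of the kernel bound; `√r ≤ n`
  -- and the choice of `l` ensure it.
  · rw [hqt, div_mul_eq_mul_div, div_lt_iff₀ (by positivity)]
    have : √(r : ℝ) * (n * b) ≤ n * (n * b) := by gcongr
    linarith
  · rw [hLc]
    have h1 : (1 : ℝ) ≤ s * b ^ 2 * p * l ^ 2 * l := one_le_mul_of_one_le_of_one_le
      (one_le_mul_of_one_le_of_one_le (one_le_mul_of_one_le_of_one_le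
        (one_le_mul_of_one_le_of_one_le hs1 (one_le_pow₀ hb1)) hp1) (one_le_pow₀ hl1)) hl1
    have h2 := le_mul_of_one_le_right (by positivity : (0 : ℝ) ≤ s) h1
    calc (2 : ℝ) ^ 15 * (12 * (s : ℝ)) ≤ (2 : ℝ) ^ 34 * (s : ℝ) := by linarith
      _ ≤ (2 : ℝ) ^ 34 * ((s : ℝ) * (s * b ^ 2 * p * l ^ 2 * l)) := by gcongr
      _ = _ := by ring
  · refine le_of_eq ?_
    field_simp
    norm_num

theorem measureReal_not_isReconstructed_le_of_large_rank (hw : IsTightFrame μ w) {b s p l : ℕ}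
    (hB : ∀ α, traceNorm (w α) ≤ b) (hn : 1 ≤ n) (hrn : (n : ℝ) / 10 ≤ r)
    (hb : 1 ≤ b) (hs : 1 ≤ s) (hns : (n : ℝ) ≤ Real.exp s) (hp : 1 ≤ p) (hl : 1 ≤ l)
    {ρ : Matrix (Fin n) (Fin n) ℂ} (hρ : ρ.PosSemidef) :
    (Measure.pi fun _ : Fin (l * (n * r * batchSize b s p l)) => μ).real
      {β | ¬ IsReconstructed (fun i => w (β i)) ρ} ≤ 1 / 8 := by
  have hn1 : (1 : ℝ) ≤ n := by exact_mod_cast hn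
  have hr : 1 ≤ r := by
    have : (0 : ℝ) < r := by linarith
    exact_mod_cast this
  have hb1 : (1 : ℝ) ≤ b := by exact_mod_cast hb
  have hs1 : (1 : ℝ) ≤ s := by exact_mod_cast hs
  have hp1 : (1 : ℝ) ≤ p := by exact_mod_cast hp
  have hl1 : (1 : ℝ) ≤ l := by exact_mod_cast hl
  refine measureReal_not_isReconstructed_le_of_card_ge hw hB (by positivity) (by omega) ?_
    (p := s) (by omega) hns ?_ hρ.isHermitian
  · unfold batchSize batchLevel; positivity
  · unfold batchSize batchLevel
    push_cast
    have h1 : (1 : ℝ) ≤ l * (p ^ 2 * b ^ 2 * s * l ^ 2) := one_le_mul_of_one_le_of_one_le hl1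
      (one_le_mul_of_one_le_of_one_le (one_le_mul_of_one_le_of_one_le
        (one_le_mul_of_one_le_of_one_le (one_le_pow₀ hp1) (one_le_pow₀ hb1)) hs1) (one_le_pow₀ hl1))
    have h2 := le_mul_of_one_le_right
      (by positivity : (0 : ℝ) ≤ 42 * 2 ^ 34 * (n ^ 2 / 10 * (s * b ^ 2))) h1
    calc (2 : ℝ) ^ 15 * (12 * s * (n ^ 2 * b ^ 2)) ≤
          42 * 2 ^ 34 * (n ^ 2 / 10 * (s * b ^ 2)) := by
          have : (0 : ℝ) ≤ s * (n ^ 2 * b ^ 2) := by positivity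
          linarith
      _ ≤ _ := h2
      _ = 42 * 2 ^ 34 * (n * (n / 10) * (s * b ^ 2)) * (l * (p ^ 2 * b ^ 2 * s * l ^ 2)) := by ring
      _ ≤ 42 * 2 ^ 34 * (n * r * (s * b ^ 2)) * (l * (p ^ 2 * b ^ 2 * s * l ^ 2)) := by gcongr
      _ = _ := by ring

end

end CompressedSensing

/-! ### Logarithmic parameters and the conclusion. -/

namespace CompressedSensing

set_option linter.unusedSectionVars false

section

/-- A natural number of the order of `1 + log n`. -/
noncomputable def logCeil (n : ℕ) : ℕ := ⌈1 + Real.log n⌉₊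

variable {n : ℕ}

theorem one_add_log_le_logCeil (n : ℕ) : 1 + Real.log n ≤ logCeil n := Nat.le_ceil _

theorem logCeil_le (n : ℕ) : (logCeil n : ℝ) ≤ 2 * (1 + Real.log n) := by
  have h0 : 0 ≤ Real.log n := Real.log_natCast_nonneg n
  have := Nat.ceil_lt_add_one (by linarith : 0 ≤ 1 + Real.log n)
  unfold logCeil
  linarith

theorem one_le_logCeil (n : ℕ) : 1 ≤ logCeil n := by
  have h0 : 0 ≤ Real.log n := Real.log_natCast_nonneg n
  have h1 := one_add_log_le_logCeil n
  have : (1 : ℝ) ≤ logCeil n := by linarith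
  exact_mod_cast this

theorem le_exp_logCeil (hn : 1 ≤ n) : (n : ℝ) ≤ Real.exp (logCeil n) := by
  have h := one_add_log_le_logCeil n
  have hn0 : (0 : ℝ) < n := by exact_mod_cast hn
  calc (n : ℝ) = Real.exp (Real.log n) := (Real.exp_log hn0).symm
    _ ≤ _ := Real.exp_le_exp.2 (by linarith)

/-- The factor `2 ^ (7 s) = 16 ^ s · 8 ^ s` absorbs 8 and `n²`, while `2 ^ (b s)` and `2 ^ (a s)`
absorb `b` and `s ^ a`. -/
theorem eight_mul_sq_mul_lt_two_pow {s b a : ℕ} (hs : 1 ≤ s) (hb : 1 ≤ b)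
    (hns : (n : ℝ) ≤ Real.exp s) :
    8 * (n : ℝ) ^ 2 * ((b * s ^ a : ℕ) : ℝ) < 2 ^ ((7 + a + b) * s) := by
  have h1 : (n : ℝ) ^ 2 ≤ 8 ^ s := by
    have he : Real.exp s = Real.exp 1 ^ s := by rw [← Real.exp_nat_mul, mul_one]
    have hee : Real.exp 1 ^ 2 ≤ 8 := by
      have := Real.exp_one_lt_d9
      have h0 := Real.exp_pos 1
      nlinarith
    calc (n : ℝ) ^ 2 ≤ (Real.exp s) ^ 2 := by gcongr
      _ = (Real.exp 1 ^ 2) ^ s := by rw [he, ← pow_mul, ← pow_mul, mul_comm]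
      _ ≤ 8 ^ s := by gcongr
  have h2 : (8 : ℝ) < 16 ^ s := by
    have : (16 : ℝ) ^ 1 ≤ 16 ^ s := pow_le_pow_right₀ (by norm_num) hs
    linarith
  have h3 : (b : ℝ) ≤ 2 ^ (b * s) := by
    have h : b ≤ 2 ^ (b * s) := (Nat.lt_two_pow_self (n := b)).le.trans
      (Nat.pow_le_pow_right (by norm_num) (Nat.le_mul_of_pos_right b hs))
    exact_mod_cast h
  have h4 : (s : ℝ) ^ a ≤ 2 ^ (s * a) := by
    have h : s ^ a ≤ (2 ^ s) ^ a := Nat.pow_le_pow_left (Nat.lt_two_pow_self (n := s)).le a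
    rw [← pow_mul] at h
    exact_mod_cast h
  have hb0 : (0 : ℝ) < b := by exact_mod_cast hb
  have hs0 : (0 : ℝ) < s := by exact_mod_cast hs
  push_cast
  calc 8 * (n : ℝ) ^ 2 * (b * (s : ℝ) ^ a) ≤ 8 * 8 ^ s * (2 ^ (b * s) * 2 ^ (s * a)) := by gcongr
    _ < 16 ^ s * 8 ^ s * (2 ^ (b * s) * 2 ^ (s * a)) := by gcongr
    _ = 2 ^ ((7 + a + b) * s) := by
      rw [← mul_pow, show (16 : ℝ) * 8 = 2 ^ 7 by norm_num, ← pow_mul, ← pow_add, ← pow_add]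
      congr 1
      ring

theorem mul_exp_neg_div_le {s b a d : ℕ} (hn : 1 ≤ n) (hs : 1 ≤ s) (hb : 1 ≤ b)
    (hns : (n : ℝ) ≤ Real.exp s) :
    n * Real.exp (-(((d + 4 + 2 * a) * s : ℕ) : ℝ)) /
        (1 / (24 * (n : ℝ) ^ 3 * ((b * s ^ a : ℕ) : ℝ) ^ 2) / 2) ≤
      48 * (b : ℝ) ^ 2 / (n : ℝ) ^ d := by
  have hn0 : (0 : ℝ) < n := by exact_mod_cast hn
  have hs0 : (0 : ℝ) < s := by exact_mod_cast hs
  have hb0 : (0 : ℝ) < b := by exact_mod_cast hb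
  have he : Real.exp (((d + 4 + 2 * a) * s : ℕ) : ℝ) =
      Real.exp s ^ (d + 4) * Real.exp s ^ (2 * a) := by
    rw [← pow_add, ← Real.exp_nat_mul]
    push_cast
    ring_nf
  have h1 : (n : ℝ) ^ (d + 4) * (s : ℝ) ^ (2 * a) ≤ Real.exp (((d + 4 + 2 * a) * s : ℕ) : ℝ) := by
    rw [he]
    have : (s : ℝ) ≤ Real.exp s := by have := Real.add_one_le_exp (s : ℝ); linarith
    gcongr
  have h2 : n * Real.exp (-(((d + 4 + 2 * a) * s : ℕ) : ℝ)) /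
      (1 / (24 * (n : ℝ) ^ 3 * ((b * s ^ a : ℕ) : ℝ) ^ 2) / 2) =
      48 * (b : ℝ) ^ 2 / (n : ℝ) ^ d * (((n : ℝ) ^ (d + 4) * (s : ℝ) ^ (2 * a)) /
        Real.exp (((d + 4 + 2 * a) * s : ℕ) : ℝ)) := by
    rw [Real.exp_neg]
    push_cast
    field_simp
    ring
  rw [h2]
  exact mul_le_of_le_one_right (by positivity) ((div_le_one (Real.exp_pos _)).2 h1)

theorem failureProb_lt_half {S : Type*} [MeasurableSpace S] {μ : Measure S}
    [IsProbabilityMeasure μ] {w : S → Matrix (Fin n) (Fin n) ℂ} {m : ℕ}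
    {ρ : Matrix (Fin n) (Fin n) ℂ} (h : (Measure.pi fun _ : Fin m => μ).real
      {β | ¬ IsReconstructed (fun i => w (β i)) ρ} ≤ 11 / 24) :
    failureProb μ w m ρ < 1 / 2 := by
  rw [failureProb, ← ofReal_measureReal]
  refine (ENNReal.ofReal_le_ofReal h).trans_lt ?_
  rw [ENNReal.ofReal_lt_iff_lt_toReal (by norm_num) (by simp)]
  norm_num

end

end CompressedSensing

open CompressedSensing

theorem mainTheorem4 (A : ℝ) (a d : ℕ) :
    ∃ (K C : ℝ) (k : ℕ) (m : ℕ → ℕ → ℕ),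
      (∀ n r : ℕ, 1 ≤ n → (m n r : ℝ) ≤ K * (n * r) * (1 + Real.log n) ^ k) ∧
      ∀ (n r : ℕ) (S : Type*) [MeasurableSpace S] (μ : MeasureTheory.Measure S)
        (w : S → Matrix (Fin n) (Fin n) ℂ)
        (Λ : MeasureTheory.Measure (Matrix (Fin n) (Fin n) ℂ)),
        1 ≤ n →
        CompressedSensing.IsTightFrame μ w →
        (∀ α, CompressedSensing.traceNorm (w α) ≤ A * (1 + Real.log n) ^ a) →
        CompressedSensing.IsInvariantStateLaw r Λ →
        Λ {ρ | ¬ CompressedSensing.failureProb μ w (m n r) ρ < 1 / 2} ≤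
          ENNReal.ofReal (C / (n : ℝ) ^ d) := by
  set b : ℕ := ⌈|A|⌉₊ + 1 with hb
  have hAb : |A| ≤ b := by
    have := Nat.le_ceil |A|
    rw [hb]; push_cast; linarith
  have hb1 : 1 ≤ b := Nat.le_add_left 1 _
  -- In the probability `n exp(-c s)` divided by the allowed bad fraction, `d` gives the decay, 4
  -- pays for the powers of `n`, and `2 a` for the logarithms in the squared trace-norm bound.
  set c : ℕ := d + 4 + 2 * a with hc
  -- With `s` of order `1 + log n`, the number of samples carries `s` to the power `4 a + 7`: `4 a`
  -- from the trace-norm bound, 3 from the number of batches, 2 from the incoherence exponent and 2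
  -- from the dimension exponent.
  refine ⟨42 * 2 ^ 34 * c ^ 2 * b ^ 4 * (7 + a + b : ℕ) ^ 3 * 2 ^ (4 * a + 7), 48 * b ^ 2, 4 * a + 7,
    fun n r => (7 + a + b) * logCeil n * (n * r * batchSize (b * logCeil n ^ a) (logCeil n)
      (c * logCeil n) ((7 + a + b) * logCeil n)), fun n r hn => ?_, ?_⟩
  · have h1 : (logCeil n : ℝ) ^ (4 * a + 7) ≤ (2 * (1 + Real.log n)) ^ (4 * a + 7) :=
      pow_le_pow_left₀ (Nat.cast_nonneg _) (logCeil_le n) _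
    rw [mul_pow] at h1
    set s := logCeil n
    calc _ = 42 * 2 ^ 34 * (c : ℝ) ^ 2 * b ^ 4 * (7 + a + b : ℕ) ^ 3 * (n * r) *
          (s : ℝ) ^ (4 * a + 7) := by
          unfold batchSize batchLevel
          push_cast
          ring
      _ ≤ 42 * 2 ^ 34 * (c : ℝ) ^ 2 * b ^ 4 * (7 + a + b : ℕ) ^ 3 * (n * r) *
          (2 ^ (4 * a + 7) * (1 + Real.log n) ^ (4 * a + 7)) := by gcongr
      _ = _ := by ring
  · intro n r S _ μ w Λ hn hw hA hΛ
    have := hw.prob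
    have hs := one_le_logCeil n
    have hns := le_exp_logCeil hn
    have hlog := one_add_log_le_logCeil n
    have h0 : 0 ≤ Real.log n := Real.log_natCast_nonneg n
    set s := logCeil n
    have hB : ∀ α, traceNorm (w α) ≤ (b * s ^ a : ℕ) := fun α => by
      refine (hA α).trans ?_
      push_cast
      have h1 : (1 + Real.log n) ^ a ≤ (s : ℝ) ^ a := pow_le_pow_left₀ (by linarith) hlog a
      exact mul_le_mul ((le_abs_self A).trans hAb) h1 (by positivity) (by positivity)
    have hbs : 1 ≤ b * s ^ a := Nat.one_le_iff_ne_zero.2 (by positivity)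
    have hp : 1 ≤ c * s := Nat.one_le_iff_ne_zero.2 (by positivity)
    have hl : 1 ≤ (7 + a + b) * s := Nat.one_le_iff_ne_zero.2 (by positivity)
    rcases le_total (r : ℝ) (n / 10) with hrn | hrn
    · have hn0 : (0 : ℝ) < n := by exact_mod_cast hn
      refine (hΛ.measure_not_le hw hB (by omega) hrn (p := c * s) (by omega)
        (ε := 1 / (24 * (n : ℝ) ^ 3 * ((b * s ^ a : ℕ) : ℝ) ^ 2) / 2) (by positivity)
        fun ρ P hρ hP htr hPρ hbad => ?_).trans
          (ENNReal.ofReal_le_ofReal (mul_exp_neg_div_le hn hs hb1 hns))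
      exact failureProb_lt_half (measureReal_not_isReconstructed_le_of_incoherent hw hB hn
        hΛ.rank_pos hrn hbs hs hns hp hl (eight_mul_sq_mul_lt_two_pow hs hb1 hns) hρ hP htr hPρ hbad)
    -- For large rank every state is recovered with the required probability, so the exceptional set
    -- lies in the null set of non-states.
    · have hnull : Λ {ρ | ¬ failureProb μ w ((7 + a + b) * s * (n * r *
          batchSize (b * s ^ a) s (c * s) ((7 + a + b) * s))) ρ < 1 / 2} = 0 := by
        refine measure_mono_null ?_ (ae_iff.1 hΛ.state)
        intro ρ hρ hst
        refine hρ (failureProb_lt_half ?_)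
        refine (measureReal_not_isReconstructed_le_of_large_rank hw hB hn hrn hbs hs hns hp hl
          hst.1).trans (by norm_num)
      exact hnull.trans_le zero_le
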